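/- Conventions. All simplicial complexes are finite flag complexes (every nonempty finite set of vertices that are pairwise joined by edges spans a simplex) and all subcomplexes are full (a simplex of the ambient complex whose vertices all lie in the subcomplex belongs to it). All homology used to define spheres and disks has rational coefficients. The sphere of dimension $-1$ is the empty set. A complex $S$ is a $GHS^{m}$ (generalized homology $m$-sphere) if it has the homology of $\mathbb S^{m}$ and is a homology $m$-manifold, i.e. the link of each $j$-simplex has the homology of $\mathbb S^{m-j-1}$. A pair $(D,\partial D)$ is a $GHD^{m}$ (generalized homology $m$-disk) if $H_i(D,\partial D)$ is $\mathbb Q$ for $i=m$ and $0$ for $i\neq m$, and it is a homology $m$-manifold with boundary, i.e. for each $j$-simplex $\sigma$ not in $\partial D$ its link has the homology of $\mathbb S^{m-j-1}$, and for each $j$-simplex $\sigma$ of $\partial D$ the homology of its link in $D$ relative to its link in $\partial D$ is $\mathbb Q$ in degree $m-j-1$ and $0$ in the other degrees. For a flag complex $L$ let $W_L$ be the right-angled Coxeter group with one generator $s$ for each vertex, relations $s^2=1$, and $(st)^2=1$ whenever $\{s,t\}$ is an edge of $L$. Let $\Sigma_L$ be the cubical complex whose cells are the cosets $wW_\sigma$,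 where $w\in W_L$, $\sigma$ is a simplex of $L$ or empty, and $W_\sigma$ is the subgroup generated by the vertices of $\sigma$; the cell $wW_\sigma$ is a cube of dimension $\dim\sigma+1$, and faces correspond to inclusions of cosets. For a full subcomplex $A$ of $L$ let $W_L\Sigma_A$ be the subcomplex of all cells $wW_\sigma$ with $\sigma$ a simplex of $A$ or empty. Let $\mathcal H_i$ denote reduced $\ell^2$-homology ($\ell^2$-cycles modulo the closure of the $\ell^2$-boundaries), and put $\mathfrak h_i(A)=\mathcal H_i(W_L\Sigma_A)$, $\mathfrak h_i(L,A)=\mathcal H_i(\Sigma_L,W_L\Sigma_A)$, $\beta_i(A)=\dim_{W_L}\mathfrak h_i(A)$ and $\beta_i(L,A)=\dim_{W_L}\mathfrak h_i(L,A)$, where $\dim_{W_L}$ is the von Neumann dimension. Statement $\mathrm{III}(2k+1)$, $k\ge 0$: for every $GHS^{2k}$ $S$ and every vertex $v$ of $S$ such that $(D,S_v)$ is a $GHD^{2k}$, where $D=S-v$ is the full subcomplex spanned by the vertices other than $v$ and $S_v$ is the link of $v$ (so that $S=D\cup CS_v$, the cone having cone point $v$), the map $$j_*\oplus h_*\colon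 \mathfrak h_k(S_v)\to\mathfrak h_k(D)\oplus\mathfrak h_k(CS_v)$$ induced by the inclusions (all groups formed in $\Sigma_S$) is injective. Statement $\mathrm{V}(n)$, $n\ge 0$: for every $GHS^{n-1}$ $S$ and every full subcomplex $A$ of $S$: if $n=2k$ is even, then $\beta_i(S,A)=0$ for all $i>k$; if $n=2k+1$ is odd, then $\beta_i(A)=0$ for all $i>k$. Theorem. Let $k\ge 1$. If $\mathrm{III}(2k-1)$ is true, then $\mathrm{V}(n)$ is true for all $n\le 2k$. -/

import Mathlib

noncomputable section

/-! ### Simplicial complexes, links, cones, flag complexes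

Complexes have a finite set of vertices; `PreAbstractSimplicialComplex V` allows elements of `V`
that are not vertices (used for subcomplexes), `AbstractSimplicialComplex V` has vertex set exactly
`V` (used for the ambient complex).  All simplices are nonempty; `simplices` adds the empty one. -/

section Complexes

variable {V : Type}

/-- The simplices of `K` together with the empty simplex (of dimension `-1`). -/
def simplices (K : PreAbstractSimplicialComplex V) : Set (Finset V) :=
  insert ∅ K.faces

theorem simplices_down (K : PreAbstractSimplicialComplex V) {σ τ : Finset V}
    (hσ : σ ∈ simplices K) (h : τ ⊆ σ) : τ ∈ simplices K := by
  rcases τ.eq_empty_or_nonempty with h0 | h0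
  · exact Or.inl h0
  · rcases hσ with rfl | hσ
    · exact Or.inl (Finset.subset_empty.mp h)
    · exact Or.inr ((K.isRelLowerSet_faces hσ).2 h h0)

theorem simplices_mono {K L : PreAbstractSimplicialComplex V} (h : K ≤ L) :
    simplices K ⊆ simplices L :=
  Set.insert_subset_insert h

variable [DecidableEq V]

/-- `K` is a flag complex: a nonempty finite set of vertices which are pairwise connected by edges
spans a simplex. -/
def IsFlag (K : PreAbstractSimplicialComplex V) : Prop :=
  ∀ σ : Finset V, σ.Nonempty → (∀ s ∈ σ, {s} ∈ K.faces) →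
    (∀ s ∈ σ, ∀ t ∈ σ, s ≠ t → {s, t} ∈ K.faces) → σ ∈ K.faces

/-- `A` is a full subcomplex of `L`. -/
def IsFullSubcomplex (A L : PreAbstractSimplicialComplex V) : Prop :=
  A ≤ L ∧ ∀ σ ∈ L.faces, (∀ s ∈ σ, {s} ∈ A.faces) → σ ∈ A.faces

/-- The link of the (possibly empty) simplex `σ` in `K`. -/
def link (K : PreAbstractSimplicialComplex V) (σ : Finset V) : PreAbstractSimplicialComplex V where
  faces := {τ | τ.Nonempty ∧ Disjoint τ σ ∧ τ ∪ σ ∈ K.faces}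
  isRelLowerSet_faces := by
    rintro τ ⟨h0, hd, hK⟩
    refine ⟨h0, fun ρ hρ hρ0 => ⟨hρ0, hd.mono_left hρ, ?_⟩⟩
    exact (K.isRelLowerSet_faces hK).2 (Finset.union_subset_union_left hρ)
      (hρ0.mono Finset.subset_union_left)

/-- `K - v`: the subcomplex of all simplices which do not have `v` as a vertex. -/
def deleteVertex (K : PreAbstractSimplicialComplex V) (v : V) : PreAbstractSimplicialComplex V where
  faces := {τ | τ ∈ K.faces ∧ v ∉ τ}
  isRelLowerSet_faces := by
    rintro τ ⟨hK, hv⟩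
    exact ⟨(K.isRelLowerSet_faces hK).1,
      fun ρ hρ hρ0 => ⟨(K.isRelLowerSet_faces hK).2 hρ hρ0, fun h => hv (hρ h)⟩⟩

/-- The cone on `K` with cone point `v`, where `v` is not a vertex of `K`: its simplices are `{v}`,
the simplices `τ` of `K`, and the joins `τ ∪ {v}`. -/
def cone (v : V) (K : PreAbstractSimplicialComplex V) : PreAbstractSimplicialComplex V where
  faces := {τ | τ.Nonempty ∧ τ.erase v ∈ simplices K}
  isRelLowerSet_faces := by
    rintro τ ⟨h0, hK⟩
    exact ⟨h0, fun ρ hρ hρ0 => ⟨hρ0, simplices_down K hK (Finset.erase_subset_erase v hρ)⟩⟩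

end Complexes

/-! ### Boundary operators, rational homology, generalized homology spheres and disks -/

section Homology

variable {V : Type} [Fintype V] [LinearOrder V]

/-- The simplicial boundary operator.  A simplex is oriented by the order of its vertices, and an
`M`-valued chain is a function on simplices; the coefficient of `∂ f` at `τ` is the sum over the
vertices `s ∉ τ` of `± f (τ ∪ {s})`, the sign being `(-1)^j` if `s` is in position `j` (counted
from `0`) in `τ ∪ {s}`.  For `F = simplices X \ simplices Y` and chains supported on `F` this is the
boundary operator of the (augmented) relative chain complex `C(X) / C(Y)`, whose basis is `F`. -/
def simplicialBoundary (R : Type*) [CommRing R] {M : Type*} [AddCommGroup M] [Module R M]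
    (F : Set (Finset V)) : (Finset V → M) →ₗ[R] (Finset V → M) := by
  classical
  exact
  { toFun := fun f τ =>
      if τ ∈ F then
        ∑ s ∈ Finset.univ.filter (fun s => s ∉ τ),
          (-1 : R) ^ (τ.filter (fun t => t < s)).card • f (insert s τ)
      else 0
    map_add' := by
      intro f g
      funext τ
      by_cases h : τ ∈ F <;> simp [h, smul_add, Finset.sum_add_distrib]
    map_smul' := by
      intro c f
      funext τ
      by_cases h : τ ∈ F <;> simp [h, Finset.smul_sum, smul_comm c] }

/-- Rational chains supported on the simplices of `F` with `m` vertices (dimension `m - 1`). -/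
def rationalChains (F : Set (Finset V)) (m : ℕ) : Submodule ℚ (Finset V → ℚ) where
  carrier := {f | ∀ σ, ¬ (σ ∈ F ∧ σ.card = m) → f σ = 0}
  add_mem' := by
    intro f g hf hg σ h
    simp [hf σ h, hg σ h]
  zero_mem' := by
    intro σ _
    rfl
  smul_mem' := by
    intro c f hf σ h
    simp [hf σ h]

/-- Rational cycles. -/
def rationalCycles (F : Set (Finset V)) (m : ℕ) : Submodule ℚ (Finset V → ℚ) :=
  rationalChains F m ⊓ LinearMap.ker (simplicialBoundary ℚ F)

/-- Rational boundaries. -/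
def rationalBoundaries (F : Set (Finset V)) (m : ℕ) : Submodule ℚ (Finset V → ℚ) :=
  (rationalChains F (m + 1)).map (simplicialBoundary ℚ F)

/-- The dimension of the rational homology of the augmented chain complex on `F` in dimension
`m - 1` (that is, spanned by simplices with `m` vertices).  For `F = simplices X` this is reduced
homology `H̃_{m-1}(X; ℚ)`, and for `F = simplices X \ simplices Y` it is `H_{m-1}(X, Y; ℚ)`. -/
def rationalBetti (F : Set (Finset V)) (m : ℕ) : ℕ :=
  Module.finrank ℚ
    (rationalCycles F m ⧸ (rationalBoundaries F m).submoduleOf (rationalCycles F m))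

/-- `X` has the reduced rational homology of the sphere of dimension `n - 1`
(the sphere of dimension `-1` being the empty set). -/
def HasHomologyOfSphere (X : PreAbstractSimplicialComplex V) (n : ℕ) : Prop :=
  ∀ m : ℕ, rationalBetti (simplices X) m = if m = n then 1 else 0

/-- `(X, Y)` has the relative rational homology of the disk of dimension `n - 1` relative to its
boundary sphere: `H_{n-1}(X, Y) = ℚ`, the other groups vanish. -/
def HasHomologyOfDisk (X Y : PreAbstractSimplicialComplex V) (n : ℕ) : Prop :=
  ∀ m : ℕ, rationalBetti (simplices X \ simplices Y) m = if m = n then 1 else 0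

/-- `S` is a generalized homology sphere of dimension `n - 1` over `ℚ`: it has the homology of
the sphere of dimension `n - 1`, and the link of every simplex `σ` has the homology of the sphere
of dimension `n - 1 - σ.card`, i.e. `S` is a homology `(n-1)`-manifold.
(For `σ.card > n` there is no such sphere, so `S` has dimension at most `n - 1`.) -/
def IsGHS (S : PreAbstractSimplicialComplex V) (n : ℕ) : Prop :=
  HasHomologyOfSphere S n ∧
    ∀ σ ∈ S.faces, ∃ j : ℕ, j + σ.card = n ∧ HasHomologyOfSphere (link S σ) j

/-- `(D, B)` is a generalized homology disk of dimension `n - 1` over `ℚ` with boundary `B`: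
it has the relative homology of a disk of dimension `n - 1`, and it is a homology
`(n-1)`-manifold with boundary, i.e. links of simplices not in `B` have the homology of spheres and
links of simplices of `B`, relative to their links in `B`, that of disks modulo boundary. -/
def IsGHD (D B : PreAbstractSimplicialComplex V) (n : ℕ) : Prop :=
  B ≤ D ∧ HasHomologyOfDisk D B n ∧
    (∀ σ ∈ D.faces, σ ∉ B.faces →
      ∃ j : ℕ, j + σ.card = n ∧ HasHomologyOfSphere (link D σ) j) ∧
    (∀ σ ∈ B.faces,
      ∃ j : ℕ, j + σ.card = n ∧ HasHomologyOfDisk (link D σ) (link B σ) j)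

end Homology

/-! ### Right-angled Coxeter groups and the reduced `ℓ²`-homology of `Σ_L` -/

section Coxeter

variable {V : Type} [Fintype V] [LinearOrder V]

/-- The right-angled Coxeter matrix of `L`: `m(s,s) = 1`, `m(s,t) = 2` if `{s,t}` is an edge, and
`m(s,t) = ∞` (encoded by `0`, i.e. no relation) otherwise. -/
def racMatrix (L : AbstractSimplicialComplex V) : CoxeterMatrix V := by
  classical
  exact
  { M := Matrix.of fun s t => if s = t then 1 else if {s, t} ∈ L.faces then 2 else 0
    isSymm := by
      ext s t
      simp only [Matrix.transpose_apply, Matrix.of_apply, eq_comm (a := t), Finset.pair_comm t]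
    diagonal := by
      intro s
      simp
    off_diagonal := by
      intro s t h
      simp only [Matrix.of_apply, h, if_false]
      split_ifs <;> simp }

/-- The right-angled Coxeter group `W_L`. -/
abbrev RACG (L : AbstractSimplicialComplex V) : Type := (racMatrix L).Group

/-- The fundamental generator of `W_L` given by the vertex `s`. -/
def gen (L : AbstractSimplicialComplex V) (s : V) : RACG L := (racMatrix L).simple s

/-- The real Hilbert space `ℓ²(G)`. -/
abbrev EllTwo (G : Type) : Type := lp (fun _ : G => ℝ) 2

/-- The Hilbert space `ℓ²(G)^I`, on which `G` acts by left translation in each coordinate. -/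
abbrev EllTwoPow (G I : Type) [Fintype I] : Type := PiLp 2 (fun _ : I => EllTwo G)

/-- The element of `ℓ²(G)^I` which is the characteristic function of `1 ∈ G` in the coordinate `i`
and zero in the other coordinates. -/
def unitVector (G I : Type) [Group G] [Fintype I] (i : I) : EllTwoPow G I := by
  classical
  exact WithLp.toLp 2 (Pi.single i (lp.single 2 (1 : G) (1 : ℝ)))

/-- The von Neumann dimension `dim_G K = tr_G p = ∑ i, ⟨p e_i, e_i⟩` of a closed `G`-stable subspace
`K` of `ℓ²(G)^I`, where `p` is the orthogonal projection onto `K` (the closure, which is `K` itself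
for closed `K`, only serves to make the expression defined for all `K`). -/
def vonNeumannDim {G I : Type} [Group G] [Fintype I] (K : Submodule ℝ (EllTwoPow G I)) : ℝ :=
  ∑ i : I, inner ℝ (K.topologicalClosure.starProjection (unitVector G I i)) (unitVector G I i)

variable (L : AbstractSimplicialComplex V)

/-- The Hilbert space `ℓ²(W_L)^I`, with `I` the set of all finite sets of vertices; it contains all
the spaces of `ℓ²`-chains below. -/
abbrev ChainSpace : Type := EllTwoPow (RACG L) (Finset V)

/-- Cellular `ℓ²`-chains of dimension `i` of the cubical complex `Σ_L`, supported on the cubes whose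
type lies in `F`.

The cells of `Σ_L` are the cosets `g W_σ`, where `σ` is a simplex of `L` or empty; such a cell is a
cube of dimension `σ.card`, its vertices are the elements of the coset, and its edges in direction
`s ∈ σ` join `h` to `h s`.  Each corner `g` of the cube orients it: the directions `s ∈ σ`, in the
order of the vertices of `L`, are each taken to point towards the corner `g`.  The corners `g` and
`g s`, `s ∈ σ`, give opposite orientations.  So an `ℓ²`-chain is a square summable function `f`
such that `f σ g` (the coefficient at the cube `g W_σ` with the orientation of its corner `g`)
satisfies `f σ (g s) = - f σ g` for `s ∈ σ`. In this form the chains are a closed subspace of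
`ℓ²(W_L)^I`, stable under left translation. -/
def ellTwoChains (F : Set (Finset V)) (i : ℕ) : Submodule ℝ (ChainSpace L) where
  carrier := {f | (∀ σ, ¬ (σ ∈ F ∧ σ.card = i) → f σ = 0) ∧
    ∀ σ, ∀ s ∈ σ, ∀ g : RACG L, f σ (g * gen L s) = - f σ g}
  add_mem' := by
    rintro f g ⟨hf, hf'⟩ ⟨hg, hg'⟩
    refine ⟨fun σ h => by simp [hf σ h, hg σ h], fun σ s hs w => ?_⟩
    have h1 := hf' σ s hs w
    have h2 := hg' σ s hs w
    simp only [PiLp.add_apply, lp.coeFn_add, Pi.add_apply, h1, h2]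
    ring
  zero_mem' := by
    refine ⟨fun σ _ => by simp, fun σ s _ w => by simp⟩
  smul_mem' := by
    rintro c f ⟨hf, hf'⟩
    refine ⟨fun σ h => by simp [hf σ h], fun σ s hs w => ?_⟩
    have h1 := hf' σ s hs w
    simp only [PiLp.smul_apply, lp.coeFn_smul, Pi.smul_apply, h1, smul_neg]

/-- The cellular boundary operator of `Σ_L` on the chains supported on cubes with type in `F`.

Let `h` be a corner of the cell `h W_τ`.  The cubes having it as a facet are the `h W_{τ ∪ {s}}`,
with `s ∉ τ`. Orient both at the corner `h`; as the direction `s` points towards `h`, the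
incidence number is `(-1)^j` if `s` is in position `j` (counted from `0`) in `τ ∪ {s}`.  Hence
`(∂ f) τ h = ∑_{s ∉ τ} (-1)^j f (τ ∪ {s}) h`. -/
def ellTwoBoundary (F : Set (Finset V)) : ChainSpace L →ₗ[ℝ] ChainSpace L :=
  (WithLp.linearEquiv 2 ℝ (Finset V → EllTwo (RACG L))).symm.toLinearMap ∘ₗ
    simplicialBoundary ℝ F ∘ₗ
      (WithLp.linearEquiv 2 ℝ (Finset V → EllTwo (RACG L))).toLinearMap

/-- `ℓ²`-cycles. -/
def ellTwoCycles (F : Set (Finset V)) (i : ℕ) : Submodule ℝ (ChainSpace L) :=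
  ellTwoChains L F i ⊓ LinearMap.ker (ellTwoBoundary L F)

/-- `ℓ²`-boundaries. -/
def ellTwoBoundaries (F : Set (Finset V)) (i : ℕ) : Submodule ℝ (ChainSpace L) :=
  (ellTwoChains L F (i + 1)).map (ellTwoBoundary L F)

/-- The closure of the `ℓ²`-boundaries, as a subspace of the space of cycles. -/
def closedBoundaries (F : Set (Finset V)) (i : ℕ) : Submodule ℝ (ellTwoCycles L F i) :=
  (ellTwoBoundaries L F i).topologicalClosure.submoduleOf (ellTwoCycles L F i)

/-- Reduced `ℓ²`-homology: cycles modulo the closure of the boundaries. -/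
abbrev ReducedHomology (F : Set (Finset V)) (i : ℕ) : Type :=
  ellTwoCycles L F i ⧸ closedBoundaries L F i

/-- The reduced `ℓ²`-homology as a Hilbert `W_L`-module: the orthogonal complement of the closure of
the boundaries in the space of cycles. -/
def harmonicCycles (F : Set (Finset V)) (i : ℕ) : Submodule ℝ (ChainSpace L) :=
  ellTwoCycles L F i ⊓ (ellTwoBoundaries L F i)ᗮ

/-- `𝔥_i(A) = ℋ_i(W_L Σ_A)`, for a full subcomplex `A` of `L`. -/
abbrev hHomology (A : PreAbstractSimplicialComplex V) (i : ℕ) : Type :=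
  ReducedHomology L (simplices A) i

/-- `β_i(A) = dim_{W_L} 𝔥_i(A)`. -/
def ellTwoBetti (A : PreAbstractSimplicialComplex V) (i : ℕ) : ℝ :=
  vonNeumannDim (harmonicCycles L (simplices A) i)

/-- `β_i(L, A) = dim_{W_L} 𝔥_i(L, A)`, where `𝔥_i(L, A) = ℋ_i(Σ_L, W_L Σ_A)`. -/
def ellTwoBettiRel (A : PreAbstractSimplicialComplex V) (i : ℕ) : ℝ :=
  vonNeumannDim
    (harmonicCycles L (simplices L.toPreAbstractSimplicialComplex \ simplices A) i)

variable {A B : PreAbstractSimplicialComplex V}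

theorem ellTwoChains_mono (h : A ≤ B) (i : ℕ) :
    ellTwoChains L (simplices A) i ≤ ellTwoChains L (simplices B) i :=
  fun _ hf => ⟨fun σ hσ => hf.1 σ fun hA => hσ ⟨simplices_mono h hA.1, hA.2⟩, hf.2⟩

theorem ellTwoBoundary_eq (h : A ≤ B) (i : ℕ) {f : ChainSpace L}
    (hf : f ∈ ellTwoChains L (simplices A) i) :
    ellTwoBoundary L (simplices A) f = ellTwoBoundary L (simplices B) f := by
  ext1 τ
  by_cases hA : τ ∈ simplices A
  · simp [ellTwoBoundary, simplicialBoundary, hA, simplices_mono h hA]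
  · have h0 : ∀ s, f (insert s τ) = 0 := fun s =>
      hf.1 _ fun hs => hA (simplices_down A hs.1 (Finset.subset_insert s τ))
    simp [ellTwoBoundary, simplicialBoundary, hA, h0]

theorem ellTwoCycles_mono (h : A ≤ B) (i : ℕ) :
    ellTwoCycles L (simplices A) i ≤ ellTwoCycles L (simplices B) i := by
  rintro f ⟨hf, hk⟩
  refine ⟨ellTwoChains_mono L h i hf, ?_⟩
  have hk' : ellTwoBoundary L (simplices A) f = 0 := hk
  exact (ellTwoBoundary_eq L h i hf).symm.trans hk'

theorem ellTwoBoundaries_mono (h : A ≤ B) (i : ℕ) :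
    ellTwoBoundaries L (simplices A) i ≤ ellTwoBoundaries L (simplices B) i := by
  rintro _ ⟨f, hf, rfl⟩
  exact ⟨f, ellTwoChains_mono L h _ hf, (ellTwoBoundary_eq L h _ hf).symm⟩

/-- The map `𝔥_i(A) → 𝔥_i(B)` induced by the inclusion of `A` in `B`. -/
def inducedMap (h : A ≤ B) (i : ℕ) : hHomology L A i →ₗ[ℝ] hHomology L B i :=
  Submodule.mapQ (closedBoundaries L (simplices A) i) (closedBoundaries L (simplices B) i)
    (Submodule.inclusion (ellTwoCycles_mono L h i))
    (fun _ hx => Submodule.topologicalClosure_mono (ellTwoBoundaries_mono L h i) hx)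

end Coxeter

/-! ### The statements III and V -/

section Statements

variable {V : Type} [DecidableEq V]

theorem link_le_deleteVertex (S : PreAbstractSimplicialComplex V) (v : V) :
    link S {v} ≤ deleteVertex S v := by
  rintro τ ⟨h0, hd, hS⟩
  exact ⟨(S.isRelLowerSet_faces hS).2 Finset.subset_union_left h0,
    Finset.disjoint_singleton_right.mp hd⟩

theorem le_cone (v : V) (K : PreAbstractSimplicialComplex V) : K ≤ cone v K :=
  fun _ h => ⟨(K.isRelLowerSet_faces h).1,
    simplices_down K (Or.inr h) (Finset.erase_subset v _)⟩

/-- `III(n)`, for odd `n = 2k+1`.  Let `S` be a flag complex which is a generalized homology sphere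
of dimension `2k`, and `v` a vertex such that `(D, S_v)`, where `D = S - v` and `S_v` is the link
of `v`, is a generalized homology disk of dimension `2k`; so `S = D ∪ C S_v`.  Then
`j_* ⊕ h_* : 𝔥_k(S_v) → 𝔥_k(D) ⊕ 𝔥_k(C S_v)` is injective. -/
def StatementIII (n : ℕ) : Prop :=
  ∀ k : ℕ, n = 2 * k + 1 →
    ∀ (V : Type) [Fintype V] [LinearOrder V] (S : AbstractSimplicialComplex V) (v : V),
      IsFlag S.toPreAbstractSimplicialComplex →
      IsGHS S.toPreAbstractSimplicialComplex (2 * k + 1) →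
      IsGHD (deleteVertex S.toPreAbstractSimplicialComplex v)
        (link S.toPreAbstractSimplicialComplex {v}) (2 * k + 1) →
      Function.Injective
        ((inducedMap S (link_le_deleteVertex S.toPreAbstractSimplicialComplex v) k).prod
          (inducedMap S (le_cone v (link S.toPreAbstractSimplicialComplex {v})) k))

/-- `V(n)`.  Let `S` be a flag complex which is a generalized homology sphere of dimension `n - 1`,
and `A` a full subcomplex.  If `n = 2k`, then `β_i(S, A) = 0` for all `i > k`; if `n = 2k+1`, then
`β_i(A) = 0` for all `i > k`. -/
def StatementV (n : ℕ) : Prop :=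
  ∀ (V : Type) [Fintype V] [LinearOrder V] (S : AbstractSimplicialComplex V)
    (A : PreAbstractSimplicialComplex V),
      IsFlag S.toPreAbstractSimplicialComplex →
      IsGHS S.toPreAbstractSimplicialComplex n →
      IsFullSubcomplex A S.toPreAbstractSimplicialComplex →
      (∀ k : ℕ, n = 2 * k → ∀ i : ℕ, k < i → ellTwoBettiRel S A i = 0) ∧
      (∀ k : ℕ, n = 2 * k + 1 → ∀ i : ℕ, k < i → ellTwoBetti S A i = 0)

end Statements

end

noncomputable section

set_option linter.unusedSectionVars false

open Filter Topology

/-! ### Operators on `ℓ²` -/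

section EllTwoOperators

variable {A B C : Type}

/-! The argument alternates between odd and even indices and builds or exhausts a subcomplex one
vertex at a time. For index 2m+1, let a full subcomplex B of the sphere S gain a vertex v. By
Mayer-Vietoris, a new class in degree j+1 gives a class in degree j on the link of v in B, and this
class bounds both in B - v and in the cone. The relative half of V(2m), applied to the links of v in
S and in B, makes the passage from the link in B to the link in S injective on homology. In the link
of v in S the class is killed by III(2m+1) if j = m, and by V(2m) with the empty subcomplex if j > m
(`ambientV_odd`). For index 2m+2, the pair (S, A) is filtered by adding to A the missing vertices;
each layer is an open star, whose homology is the part antisymmetric under v of the homology of a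
link with degree shifted by one, and V(2m+1) applies to the link (`ambientV_even`).

This induction needs III in all odd indices up to 2k-1, while only the top one is given. The missing
cases come from joins with a pentagon P (`harmonicIII_of_ambientIII_succ`). Joining raises the
dimension of a homology sphere by two and is compatible with links, deletions and cones of vertices
of S. The group of the join is a product, so exterior multiplication by a nonzero harmonic 1-cycle z
of the pentagon turns a counterexample to III(2m+1) into one to III(2m+3). Such a z exists by an
Euler characteristic count, 1 - 5/2 + 5/4 < 0 (`exists_harmonicCycle_pentagon`).

Reduced homology is only weakly exact: a limit of boundaries need not be a boundary. What makes
diagram chases work is finiteness of the von Neumann dimension. The rank theorem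
`card_sub_trace_ker` yields the density statement `mem_closure_preimage_image`, which allows a cycle
that is a limit of boundaries to be approximated by cycles that actually bound. The two weak
exactness lemmas `mem_closure_boundaries_of_homologyVanishes_sdiff` and
`homologyVanishes_of_isClosedIn` follow.

All inductive statements are formed in the complex of one fixed ambient L, because passing to links
and subcomplexes changes the sphere but should not change the group. The given III, which lives in
the intrinsic complex of S, is transferred by restricting harmonic chains to cosets of the special
subgroup (`harmonicIII_of_statementIII`). Its disk hypothesis holds for every vertex of a homology
sphere (`IsGHS.isGHD`). -/

/-- The element of `ℓ²(B)` given by a square summable function. -/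
def EllTwo.ofFun (f : B → ℝ) (h : Summable fun b => f b * f b) : EllTwo B :=
  ⟨f, (memℓp_gen_iff (by norm_num)).2 (by
    refine h.congr fun b => ?_
    simp [← pow_two])⟩

@[simp]
theorem EllTwo.ofFun_apply (f : B → ℝ) (h : Summable fun b => f b * f b) (b : B) :
    EllTwo.ofFun f h b = f b := rfl

theorem EllTwo.inner_eq (x y : EllTwo B) : inner ℝ x y = ∑' b, x b * y b := by
  rw [lp.inner_eq_tsum]
  exact tsum_congr fun b => by simp [mul_comm]

theorem EllTwo.summable_mul (x y : EllTwo B) : Summable fun b => x b * y b :=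
  (lp.summable_inner x y).congr fun b => by simp [mul_comm]

theorem EllTwo.norm_sq (x : EllTwo B) : ‖x‖ ^ 2 = ∑' b, x b * x b := by
  rw [← real_inner_self_eq_norm_sq, EllTwo.inner_eq]

/-- The restriction `ℓ²(A) → ℓ²(B)` along an injective map `B → A`. -/
def EllTwo.pullback (φ : B → A) (hφ : Function.Injective φ) : EllTwo A →L[ℝ] EllTwo B :=
  LinearMap.mkContinuous
    { toFun := fun f => EllTwo.ofFun (fun b => f (φ b))
        ((EllTwo.summable_mul f f).comp_injective hφ)
      map_add' := fun f g => by ext; simp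
      map_smul' := fun c f => by ext; simp } 1 (fun f => by
    rw [one_mul]
    refine le_of_sq_le_sq ?_ (norm_nonneg _)
    rw [EllTwo.norm_sq, EllTwo.norm_sq]
    exact tsum_comp_le_tsum_of_inj (EllTwo.summable_mul f f) (fun _ => mul_self_nonneg _) hφ)

@[simp]
theorem EllTwo.pullback_apply (φ : B → A) (hφ : Function.Injective φ) (f : EllTwo A) (b : B) :
    EllTwo.pullback φ hφ f b = f (φ b) := rfl

/-- A tuple of operators into `ℓ²(B)` as an operator into `ℓ²(B)^J`. -/
def EllTwoPow.pi {E J : Type} [NormedAddCommGroup E] [NormedSpace ℝ E] [Fintype J]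
    (T : J → E →L[ℝ] EllTwo B) : E →L[ℝ] EllTwoPow B J :=
  (PiLp.continuousLinearEquiv 2 ℝ (fun _ : J => EllTwo B)).symm.toContinuousLinearMap ∘L
    ContinuousLinearMap.pi T

@[simp]
theorem EllTwoPow.pi_apply {E J : Type} [NormedAddCommGroup E] [NormedSpace ℝ E] [Fintype J]
    (T : J → E →L[ℝ] EllTwo B) (x : E) (j : J) : EllTwoPow.pi T x j = T j x := rfl

/-- The coordinate projection `ℓ²(B)^J → ℓ²(B)`. -/
def EllTwoPow.coord {J : Type} [Fintype J] (j : J) : EllTwoPow B J →L[ℝ] EllTwo B :=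
  PiLp.proj 2 (fun _ : J => EllTwo B) j

@[simp]
theorem EllTwoPow.coord_apply {J : Type} [Fintype J] (j : J) (x : EllTwoPow B J) :
    EllTwoPow.coord j x = x j := rfl

theorem EllTwoPow.inner_eq {J : Type} [Fintype J] (x y : EllTwoPow B J) :
    inner ℝ x y = ∑ j, ∑' b, x j b * y j b := by
  rw [PiLp.inner_apply]
  exact Finset.sum_congr rfl fun j _ => EllTwo.inner_eq _ _

@[ext]
theorem EllTwoPow.ext' {J : Type} [Fintype J] {x y : EllTwoPow B J}
    (h : ∀ j b, x j b = y j b) : x = y := by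
  ext j b
  exact h j b

end EllTwoOperators

/-! ### Translations, equivariant operators, the von Neumann trace -/

section Trace

variable {G I J K : Type} [Group G] [Fintype I] [Fintype J] [Fintype K]

/-- Left translation on `ℓ²(G)^I`. -/
def leftTranslation (I : Type) [Fintype I] (g : G) : EllTwoPow G I →L[ℝ] EllTwoPow G I :=
  EllTwoPow.pi fun i => EllTwo.pullback (g⁻¹ * ·) (mul_right_injective _) ∘L EllTwoPow.coord i

@[simp]
theorem leftTranslation_apply (g : G) (x : EllTwoPow G I) (i : I) (h : G) :
    leftTranslation I g x i h = x i (g⁻¹ * h) := rfl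

theorem inner_leftTranslation (g : G) (x y : EllTwoPow G I) :
    inner ℝ (leftTranslation I g x) y = inner ℝ x (leftTranslation I g⁻¹ y) := by
  rw [EllTwoPow.inner_eq, EllTwoPow.inner_eq]
  refine Finset.sum_congr rfl fun i _ => ?_
  rw [← (Equiv.mulLeft g).tsum_eq]
  simp

theorem inner_unitVector (x : EllTwoPow G I) (i : I) :
    inner ℝ x (unitVector G I i) = x i 1 := by
  classical
  rw [PiLp.inner_apply, Finset.sum_eq_single i]
  · simp [unitVector, lp.inner_single_right]
  · intro j _ hj
    simp [unitVector, hj]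
  · simp

theorem inner_leftTranslation_unitVector (x : EllTwoPow G I) (i : I) (g : G) :
    inner ℝ x (leftTranslation I g (unitVector G I i)) = x i g := by
  rw [real_inner_comm, inner_leftTranslation, real_inner_comm, inner_unitVector]
  simp

/-- An operator which commutes with left translations. -/
def IsEquivariant (T : EllTwoPow G I →L[ℝ] EllTwoPow G J) : Prop :=
  ∀ g x, T (leftTranslation I g x) = leftTranslation J g (T x)

/-- A subspace which is stable under left translations. -/
def IsStable (Z : Submodule ℝ (EllTwoPow G I)) : Prop :=
  ∀ g : G, ∀ x ∈ Z, leftTranslation I g x ∈ Z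

theorem IsEquivariant.comp {S : EllTwoPow G J →L[ℝ] EllTwoPow G K}
    {T : EllTwoPow G I →L[ℝ] EllTwoPow G J} (hS : IsEquivariant S) (hT : IsEquivariant T) :
    IsEquivariant (S ∘L T) := fun g x => by simp [hT g, hS g]

theorem IsEquivariant.sub {S T : EllTwoPow G I →L[ℝ] EllTwoPow G J} (hS : IsEquivariant S)
    (hT : IsEquivariant T) : IsEquivariant (S - T) := fun g x => by simp [hT g, hS g]

theorem IsEquivariant.smul {T : EllTwoPow G I →L[ℝ] EllTwoPow G J} (c : ℝ)
    (hT : IsEquivariant T) : IsEquivariant (c • T) := fun g x => by simp [hT g]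

theorem IsEquivariant.one : IsEquivariant (1 : EllTwoPow G I →L[ℝ] EllTwoPow G I) :=
  fun _ _ => rfl

theorem IsEquivariant.pow {T : EllTwoPow G I →L[ℝ] EllTwoPow G I} (hT : IsEquivariant T) (n : ℕ) :
    IsEquivariant (T ^ n) := by
  induction n with
  | zero => exact IsEquivariant.one
  | succ n ih => rw [pow_succ]; exact ih.comp hT

theorem IsEquivariant.adjoint {T : EllTwoPow G I →L[ℝ] EllTwoPow G J} (hT : IsEquivariant T) :
    IsEquivariant (ContinuousLinearMap.adjoint T) := fun g x => by
  refine ext_inner_right ℝ fun y => ?_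
  rw [ContinuousLinearMap.adjoint_inner_left, inner_leftTranslation, inner_leftTranslation,
    ContinuousLinearMap.adjoint_inner_left, hT]

theorem IsEquivariant.isStable_ker {T : EllTwoPow G I →L[ℝ] EllTwoPow G J}
    (hT : IsEquivariant T) : IsStable T.ker := fun g x hx => by
  simp only [LinearMap.mem_ker, ContinuousLinearMap.coe_coe] at hx ⊢
  rw [hT, hx, map_zero]

theorem IsStable.orthogonal {Z : Submodule ℝ (EllTwoPow G I)} (hZ : IsStable Z) :
    IsStable Zᗮ := fun g x hx => by
  rw [Submodule.mem_orthogonal] at hx ⊢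
  intro u hu
  rw [real_inner_comm, inner_leftTranslation, real_inner_comm]
  exact hx _ (hZ _ _ hu)

theorem IsStable.isEquivariant_starProjection {Z : Submodule ℝ (EllTwoPow G I)}
    [Z.HasOrthogonalProjection] (hZ : IsStable Z) : IsEquivariant Z.starProjection := by
  intro g x
  apply Submodule.eq_starProjection_of_mem_orthogonal
  · exact hZ _ _ (Submodule.starProjection_apply_mem _ _)
  · rw [← map_sub]
    exact hZ.orthogonal _ _ (Submodule.sub_starProjection_mem_orthogonal _)

/-- The von Neumann trace of an operator. -/
def vonNeumannTrace (T : EllTwoPow G I →L[ℝ] EllTwoPow G I) : ℝ :=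
  ∑ i, inner ℝ (T (unitVector G I i)) (unitVector G I i)

theorem vonNeumannTrace_sub (S T : EllTwoPow G I →L[ℝ] EllTwoPow G I) :
    vonNeumannTrace (S - T) = vonNeumannTrace S - vonNeumannTrace T := by
  simp [vonNeumannTrace, inner_sub_left]

theorem vonNeumannTrace_add (S T : EllTwoPow G I →L[ℝ] EllTwoPow G I) :
    vonNeumannTrace (S + T) = vonNeumannTrace S + vonNeumannTrace T := by
  simp [vonNeumannTrace, inner_add_left, Finset.sum_add_distrib]

theorem vonNeumannTrace_one :
    vonNeumannTrace (1 : EllTwoPow G I →L[ℝ] EllTwoPow G I) = Fintype.card I := by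
  classical
  simp [vonNeumannTrace, unitVector]

/-- An equivariant operator is convolution by a matrix over the group; passing to the adjoint
transposes the matrix and inverts the group element. -/
theorem IsEquivariant.apply_unitVector {T : EllTwoPow G I →L[ℝ] EllTwoPow G J}
    (hT : IsEquivariant T) (i : I) (j : J) (g : G) :
    T (unitVector G I i) j g =
      ContinuousLinearMap.adjoint T (unitVector G J j) i g⁻¹ := by
  rw [← inner_leftTranslation_unitVector, ← inner_leftTranslation_unitVector,
    ContinuousLinearMap.adjoint_inner_left, hT, real_inner_comm, inner_leftTranslation]

theorem vonNeumannTrace_comp (S : EllTwoPow G I →L[ℝ] EllTwoPow G J)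
    (T : EllTwoPow G J →L[ℝ] EllTwoPow G I) : vonNeumannTrace (T ∘L S) =
      ∑ i, ∑ j, ∑' g, S (unitVector G I i) j g *
        ContinuousLinearMap.adjoint T (unitVector G I i) j g := by
  refine Finset.sum_congr rfl fun i _ => ?_
  rw [ContinuousLinearMap.comp_apply, ← ContinuousLinearMap.adjoint_inner_right,
    EllTwoPow.inner_eq]

/-- Both traces are sums of products of matrix coefficients over i, j and g. The substitution of
`g⁻¹` for `g` exchanges the coefficients of each operator with those of its adjoint and so matches
the two sums. -/
theorem vonNeumannTrace_comp_comm {S : EllTwoPow G I →L[ℝ] EllTwoPow G J}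
    {T : EllTwoPow G J →L[ℝ] EllTwoPow G I} (hS : IsEquivariant S) (hT : IsEquivariant T) :
    vonNeumannTrace (T ∘L S) = vonNeumannTrace (S ∘L T) := by
  refine (vonNeumannTrace_comp S T).trans (Eq.trans ?_ (vonNeumannTrace_comp T S).symm)
  refine Finset.sum_comm.trans ?_
  refine Finset.sum_congr rfl fun j _ => Finset.sum_congr rfl fun i _ => ?_
  refine ((Equiv.inv G).tsum_eq _).symm.trans (tsum_congr fun g => ?_)
  have h1 := hS.apply_unitVector i j g⁻¹
  have h2 := hT.apply_unitVector j i g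
  rw [inv_inv] at h1
  simp only [Equiv.inv_apply]
  rw [h1, h2, mul_comm]

/-! ### The von Neumann dimension -/

theorem vonNeumannDim_eq_trace (Z : Submodule ℝ (EllTwoPow G I)) [Z.HasOrthogonalProjection]
    (hZ : IsClosed (Z : Set (EllTwoPow G I))) :
    vonNeumannDim Z = vonNeumannTrace Z.starProjection := by
  have h : Z.topologicalClosure = Z := hZ.submodule_topologicalClosure_eq
  unfold vonNeumannDim vonNeumannTrace
  congr! 4

theorem vonNeumannDim_bot : vonNeumannDim (⊥ : Submodule ℝ (EllTwoPow G I)) = 0 := by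
  rw [vonNeumannDim_eq_trace _ (by simp)]
  simp [vonNeumannTrace]

theorem inner_starProjection_self (Z : Submodule ℝ (EllTwoPow G I)) [Z.HasOrthogonalProjection]
    (x : EllTwoPow G I) : inner ℝ (Z.starProjection x) x = ‖Z.starProjection x‖ ^ 2 := by
  conv_lhs =>
    rw [← Submodule.starProjection_eq_self_iff.2 (Submodule.starProjection_apply_mem Z x)]
  rw [Submodule.inner_starProjection_left_eq_right, real_inner_self_eq_norm_sq]

theorem vonNeumannTrace_starProjection_mono {Y Z : Submodule ℝ (EllTwoPow G I)}
    [Y.HasOrthogonalProjection] [Z.HasOrthogonalProjection] (h : Y ≤ Z) :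
    vonNeumannTrace Y.starProjection ≤ vonNeumannTrace Z.starProjection := by
  refine Finset.sum_le_sum fun i _ => ?_
  rw [inner_starProjection_self, inner_starProjection_self]
  have h1 : Y.starProjection (unitVector G I i) =
      Y.starProjection (Z.starProjection (unitVector G I i)) := by
    rw [← ContinuousLinearMap.comp_apply, Submodule.starProjection_comp_starProjection_of_le h]
  rw [h1]
  gcongr
  exact Submodule.norm_starProjection_apply_le _ _

/-- Faithfulness of the trace: it is the sum of the squared norms of the projected unit vectors, so
all of these vanish. By equivariance the projection then kills every translate, and the translates
read off all coordinates. -/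
theorem eq_bot_of_vonNeumannTrace_eq_zero {Z : Submodule ℝ (EllTwoPow G I)}
    [Z.HasOrthogonalProjection] (hZ : IsStable Z) (h : vonNeumannTrace Z.starProjection = 0) :
    Z = ⊥ := by
  have h1 : ∀ i, Z.starProjection (unitVector G I i) = 0 := by
    intro i
    have := (Finset.sum_eq_zero_iff_of_nonneg (fun i _ => by
      rw [inner_starProjection_self]; positivity)).1 h i (Finset.mem_univ i)
    rw [inner_starProjection_self] at this
    simpa using this
  refine (Submodule.eq_bot_iff _).2 fun x hx => ?_
  ext i g
  rw [← inner_leftTranslation_unitVector, ← Submodule.starProjection_eq_self_iff.2 hx,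
    Submodule.inner_starProjection_left_eq_right, hZ.isEquivariant_starProjection, h1]
  simp

end Trace

/-! ### The rank theorem for equivariant operators -/

section Rank

variable {G I J K : Type} [Group G] [Fintype I] [Fintype J] [Fintype K]

/-- The mean ergodic theorem: averages of the powers of a contraction converge strongly to the
projection onto its fixed vectors. The trace involves finitely many unit vectors, so it passes to
the limit. This expresses dimensions of kernels through traces of polynomials, without spectral
calculus. -/
theorem tendsto_average_vonNeumannTrace_pow (A : EllTwoPow G I →L[ℝ] EllTwoPow G I)
    (hA : ‖A‖ ≤ 1) (Z : Submodule ℝ (EllTwoPow G I)) [Z.HasOrthogonalProjection]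
    (hZ : ∀ x, x ∈ Z ↔ A x = x) :
    Tendsto (fun N : ℕ => (N : ℝ)⁻¹ * ∑ k ∈ Finset.range N, vonNeumannTrace (A ^ k)) atTop
      (𝓝 (vonNeumannTrace Z.starProjection)) := by
  have hZ' : Z = A.eqLocus (1 : EllTwoPow G I →L[ℝ] EllTwoPow G I) := by
    ext x
    exact (hZ x).trans Iff.rfl
  have h : ∀ i, Tendsto (fun N : ℕ => inner ℝ (birkhoffAverage ℝ A _root_.id N (unitVector G I i))
      (unitVector G I i)) atTop
      (𝓝 (inner ℝ (Z.starProjection (unitVector G I i)) (unitVector G I i))) := by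
    intro i
    refine Tendsto.inner ?_ tendsto_const_nhds
    subst hZ'
    exact ContinuousLinearMap.tendsto_birkhoffAverage_orthogonalProjection A hA _
  refine (tendsto_finsetSum Finset.univ fun i _ => h i).congr fun N => ?_
  simp only [birkhoffAverage, birkhoffSum, vonNeumannTrace, inner_smul_left, sum_inner,
    RCLike.conj_to_real, id, ← Finset.mul_sum]
  rw [Finset.sum_comm]
  simp

/-- Expanding the square gives ‖x‖² - 2‖Tx‖² + ‖T*Tx‖², and the last term is at most ‖Tx‖². -/
theorem norm_one_sub_adjoint_comp_le (T : EllTwoPow G I →L[ℝ] EllTwoPow G J) (hT : ‖T‖ ≤ 1) :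
    ‖(1 : EllTwoPow G I →L[ℝ] EllTwoPow G I) - ContinuousLinearMap.adjoint T ∘L T‖ ≤ 1 := by
  refine ContinuousLinearMap.opNorm_le_bound _ zero_le_one fun x => ?_
  rw [one_mul]
  refine le_of_sq_le_sq ?_ (norm_nonneg _)
  have h1 : ‖ContinuousLinearMap.adjoint T (T x)‖ ≤ ‖T x‖ :=
    (ContinuousLinearMap.le_of_opNorm_le _ (by simpa using hT) _).trans (by rw [one_mul])
  have h2 : inner ℝ x (ContinuousLinearMap.adjoint T (T x)) = ‖T x‖ ^ 2 := by
    rw [ContinuousLinearMap.adjoint_inner_right, real_inner_self_eq_norm_sq]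
  have h3 : ((1 : EllTwoPow G I →L[ℝ] EllTwoPow G I) - ContinuousLinearMap.adjoint T ∘L T) x =
      x - ContinuousLinearMap.adjoint T (T x) := rfl
  rw [h3, norm_sub_sq_real, h2]
  nlinarith [norm_nonneg (ContinuousLinearMap.adjoint T (T x)), norm_nonneg (T x)]

theorem mem_ker_iff_one_sub_adjoint_comp (T : EllTwoPow G I →L[ℝ] EllTwoPow G J)
    (x : EllTwoPow G I) : x ∈ T.ker ↔
      ((1 : EllTwoPow G I →L[ℝ] EllTwoPow G I) - ContinuousLinearMap.adjoint T ∘L T) x = x := by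
  have h3 : ((1 : EllTwoPow G I →L[ℝ] EllTwoPow G I) - ContinuousLinearMap.adjoint T ∘L T) x =
      x - ContinuousLinearMap.adjoint T (T x) := rfl
  rw [h3, sub_eq_self, LinearMap.mem_ker]
  refine ⟨fun h => ?_, fun h => ?_⟩
  · rw [show T x = 0 from h, map_zero]
  · have h2 : inner ℝ x (ContinuousLinearMap.adjoint T (T x)) = ‖T x‖ ^ 2 := by
      rw [ContinuousLinearMap.adjoint_inner_right, real_inner_self_eq_norm_sq]
    rw [h, inner_zero_right] at h2
    have : ‖T x‖ = 0 := by simpa using h2.symm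
    exact norm_eq_zero.1 this

/-- Write A = 1 - T*T and B = 1 - TT*. Each further power subtracts the trace of (A^k T*)T on one
side and of T(A^k T*) = B^k TT* on the other; these agree by the trace property. Only the traces of
the two identities differ. -/
theorem vonNeumannTrace_one_sub_pow (T : EllTwoPow G I →L[ℝ] EllTwoPow G J)
    (hT : IsEquivariant T) (k : ℕ) :
    vonNeumannTrace ((1 - ContinuousLinearMap.adjoint T ∘L T) ^ k) - Fintype.card I =
      vonNeumannTrace ((1 - T ∘L ContinuousLinearMap.adjoint T) ^ k) - Fintype.card J := by
  set A : EllTwoPow G I →L[ℝ] EllTwoPow G I := 1 - ContinuousLinearMap.adjoint T ∘L T with hA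
  set B : EllTwoPow G J →L[ℝ] EllTwoPow G J := 1 - T ∘L ContinuousLinearMap.adjoint T with hB
  have hAe : IsEquivariant A := IsEquivariant.one.sub (hT.adjoint.comp hT)
  have hc : ∀ k, T ∘L (A ^ k) = (B ^ k) ∘L T := by
    intro k
    induction k with
    | zero => rfl
    | succ k ih =>
      have h1 : T ∘L A = B ∘L T := by
        ext1 x
        simp [hA, hB]
      calc T ∘L (A ^ (k + 1)) = (T ∘L (A ^ k)) ∘L A := by rw [pow_succ]; rfl
        _ = (B ^ k) ∘L (T ∘L A) := by rw [ih]; rfl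
        _ = (B ^ k * B) ∘L T := by rw [h1]; rfl
        _ = (B ^ (k + 1)) ∘L T := by rw [pow_succ]
  induction k with
  | zero => simp [vonNeumannTrace_one]
  | succ k ih =>
    have h1 : A ^ (k + 1) = A ^ k - ((A ^ k) ∘L ContinuousLinearMap.adjoint T) ∘L T := by
      rw [pow_succ, hA, mul_sub, mul_one]; rfl
    have h2 : B ^ (k + 1) = B ^ k - T ∘L ((A ^ k) ∘L ContinuousLinearMap.adjoint T) := by
      rw [pow_succ, ← ContinuousLinearMap.comp_assoc, hc, hB, mul_sub, mul_one]; rfl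
    have h3 := vonNeumannTrace_comp_comm hT ((hAe.pow k).comp hT.adjoint)
    rw [h1, h2, vonNeumannTrace_sub, vonNeumannTrace_sub, h3]
    linarith

theorem card_sub_trace_ker_of_norm_le_one (T : EllTwoPow G I →L[ℝ] EllTwoPow G J) (hT : IsEquivariant T)
    (hn : ‖T‖ ≤ 1) :
    Fintype.card I - vonNeumannTrace T.ker.starProjection =
      Fintype.card J - vonNeumannTrace (ContinuousLinearMap.adjoint T).ker.starProjection := by
  have h1 := tendsto_average_vonNeumannTrace_pow _ (norm_one_sub_adjoint_comp_le T hn) T.ker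
    (mem_ker_iff_one_sub_adjoint_comp T)
  have h2 := tendsto_average_vonNeumannTrace_pow _
    (norm_one_sub_adjoint_comp_le (ContinuousLinearMap.adjoint T) (by simpa using hn))
    (ContinuousLinearMap.adjoint T).ker
    (mem_ker_iff_one_sub_adjoint_comp (ContinuousLinearMap.adjoint T))
  rw [ContinuousLinearMap.adjoint_adjoint] at h2
  have h3 := tendsto_nhds_unique_of_eventuallyEq h1 (h2.add_const ((Fintype.card I : ℝ) -
    Fintype.card J)) ?_
  · linarith
  -- The empty average is 0, so the averages differ by the constant only from N = 1 on.
  · filter_upwards [eventually_gt_atTop 0] with N hN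
    have h4 : ∀ k, vonNeumannTrace ((1 - ContinuousLinearMap.adjoint T ∘L T) ^ k) =
      vonNeumannTrace ((1 - T ∘L ContinuousLinearMap.adjoint T) ^ k) +
        ((Fintype.card I : ℝ) - Fintype.card J) := fun k => by
      linarith [vonNeumannTrace_one_sub_pow T hT k]
    have hN' : (N : ℝ) ≠ 0 := by positivity
    simp only [h4, Finset.sum_add_distrib, Finset.sum_const, Finset.card_range, nsmul_eq_mul]
    field_simp

/-- The rank theorem: an equivariant operator and its adjoint have closed images of the same
von Neumann dimension. -/
theorem card_sub_trace_ker (T : EllTwoPow G I →L[ℝ] EllTwoPow G J) (hT : IsEquivariant T) :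
    Fintype.card I - vonNeumannTrace T.ker.starProjection =
      Fintype.card J - vonNeumannTrace (ContinuousLinearMap.adjoint T).ker.starProjection := by
  -- Scaling to a contraction changes neither kernel; the summand 1 gives a positive denominator
  -- even for T = 0.
  set c : ℝ := (1 + ‖T‖)⁻¹ with hc
  have hp : 0 < 1 + ‖T‖ := by positivity
  have hc0 : c ≠ 0 := by positivity
  have hn : ‖c • T‖ ≤ 1 := by
    rw [norm_smul, hc, norm_inv, Real.norm_of_nonneg hp.le, inv_mul_le_one₀ hp]
    linarith
  have h := card_sub_trace_ker_of_norm_le_one (c • T) (hT.smul c) hn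
  have h1 : (c • T).ker = T.ker := by
    ext x
    simp [hc0]
  have h2 : (ContinuousLinearMap.adjoint (c • T)).ker = (ContinuousLinearMap.adjoint T).ker := by
    ext x
    simp [hc0]
  simp only [h1, h2] at h
  convert h

end Rank

/-! ### Direct sums -/

section DirectSum

variable {G I J K : Type} [Group G] [Fintype I] [Fintype J] [Fintype K]

def EllTwoPow.fst : EllTwoPow G (I ⊕ J) →L[ℝ] EllTwoPow G I :=
  EllTwoPow.pi fun i => EllTwoPow.coord (Sum.inl i)

def EllTwoPow.snd : EllTwoPow G (I ⊕ J) →L[ℝ] EllTwoPow G J :=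
  EllTwoPow.pi fun j => EllTwoPow.coord (Sum.inr j)

def EllTwoPow.inl : EllTwoPow G I →L[ℝ] EllTwoPow G (I ⊕ J) :=
  EllTwoPow.pi (Sum.elim EllTwoPow.coord 0)

def EllTwoPow.inr : EllTwoPow G J →L[ℝ] EllTwoPow G (I ⊕ J) :=
  EllTwoPow.pi (Sum.elim 0 EllTwoPow.coord)

open EllTwoPow

@[simp] theorem EllTwoPow.fst_inl (x : EllTwoPow G I) : fst (inl (J := J) x) = x := rfl
@[simp] theorem EllTwoPow.snd_inr (x : EllTwoPow G J) : snd (inr (I := I) x) = x := rfl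
@[simp] theorem EllTwoPow.fst_inr (x : EllTwoPow G J) : fst (inr (I := I) x) = 0 := rfl
@[simp] theorem EllTwoPow.snd_inl (x : EllTwoPow G I) : snd (inl (J := J) x) = 0 := rfl

theorem EllTwoPow.inl_fst_add_inr_snd (x : EllTwoPow G (I ⊕ J)) :
    inl (fst x) + inr (snd x) = x := by
  ext i g
  rcases i with i | j
  · exact add_zero _
  · exact zero_add _

theorem isEquivariant_fst : IsEquivariant (fst : EllTwoPow G (I ⊕ J) →L[ℝ] EllTwoPow G I) :=
  fun _ _ => rfl

theorem isEquivariant_snd : IsEquivariant (snd : EllTwoPow G (I ⊕ J) →L[ℝ] EllTwoPow G J) :=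
  fun _ _ => rfl

theorem inner_inr (x : EllTwoPow G J) (y : EllTwoPow G (I ⊕ J)) :
    inner ℝ (inr x) y = inner ℝ x (snd y) := by
  rw [EllTwoPow.inner_eq, EllTwoPow.inner_eq, Fintype.sum_sum_type]
  have h1 : ∀ (i : I) (g : G), inr (I := I) x (Sum.inl i) g = 0 := fun _ _ => rfl
  have h2 : ∀ (j : J) (g : G), inr (I := I) x (Sum.inr j) g = x j g := fun _ _ => rfl
  simp only [h1, h2, zero_mul, tsum_zero, Finset.sum_const_zero, zero_add]
  rfl

theorem starProjection_map_inr (Z : Submodule ℝ (EllTwoPow G J)) [Z.HasOrthogonalProjection]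
    (N : Submodule ℝ (EllTwoPow G (I ⊕ J))) [N.HasOrthogonalProjection]
    (hN : ∀ x, x ∈ N ↔ fst x = 0 ∧ snd x ∈ Z) (x : EllTwoPow G (I ⊕ J)) :
    N.starProjection x = inr (Z.starProjection (snd x)) := by
  apply Submodule.eq_starProjection_of_mem_orthogonal
  · exact (hN _).2 ⟨rfl, Submodule.starProjection_apply_mem _ _⟩
  · rw [Submodule.mem_orthogonal]
    intro u hu
    obtain ⟨h1, h2⟩ := (hN u).1 hu
    rw [← inl_fst_add_inr_snd u, h1, map_zero, zero_add, inner_inr, map_sub, snd_inr]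
    exact (Submodule.mem_orthogonal _ _).1
      (Submodule.sub_starProjection_mem_orthogonal (K := Z) (snd x)) _ h2

/-- The dimension does not depend on the free module into which a space is embedded. In
`dense_preimage_range` it compares the kernel of T with its copy among pairs with first component
zero. -/
theorem vonNeumannTrace_map_inr (Z : Submodule ℝ (EllTwoPow G J)) [Z.HasOrthogonalProjection]
    (N : Submodule ℝ (EllTwoPow G (I ⊕ J))) [N.HasOrthogonalProjection]
    (hN : ∀ x, x ∈ N ↔ fst x = 0 ∧ snd x ∈ Z) :
    vonNeumannTrace N.starProjection = vonNeumannTrace Z.starProjection := by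
  classical
  have h1 : ∀ i : I, snd (unitVector G (I ⊕ J) (Sum.inl i)) = 0 := by
    intro i
    ext j g
    simp [snd, unitVector]
  have h2 : ∀ j : J, snd (unitVector G (I ⊕ J) (Sum.inr j)) = unitVector G J j := by
    intro j
    ext j' g
    by_cases h : j' = j
    · subst h; simp [snd, unitVector]
    · simp [snd, unitVector, h]
  unfold vonNeumannTrace
  simp only [starProjection_map_inr Z N hN, Fintype.sum_sum_type, inner_inr, h1, h2, map_zero,
    inner_zero_right, Finset.sum_const_zero, zero_add]

end DirectSum

/-! ### Operator ranges -/

section Density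

variable {G I J K : Type} [Group G] [Fintype I] [Fintype J] [Fintype K]

open EllTwoPow

/-- The kernel of S after the projection onto M is the orthogonal sum of the complement of M and of
N, so its projection is 1 - p_M + p_N. -/
theorem trace_ker_comp_starProjection (M N : Submodule ℝ (EllTwoPow G I))
    [M.HasOrthogonalProjection] [N.HasOrthogonalProjection]
    (S : EllTwoPow G I →L[ℝ] EllTwoPow G J) (hN : ∀ x, x ∈ N ↔ x ∈ M ∧ S x = 0) :
    vonNeumannTrace (S ∘L M.starProjection).ker.starProjection =
      Fintype.card I - vonNeumannTrace M.starProjection + vonNeumannTrace N.starProjection := by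
  rw [← vonNeumannTrace_one (G := G), ← vonNeumannTrace_sub, ← vonNeumannTrace_add]
  congr 1
  ext1 x
  have hNM : N ≤ M := fun y hy => ((hN y).1 hy).1
  apply Submodule.eq_starProjection_of_mem_orthogonal
  · have h1 : M.starProjection (x - M.starProjection x + N.starProjection x) =
        N.starProjection x := by
      rw [map_add, map_sub,
        Submodule.starProjection_eq_self_iff.2 (Submodule.starProjection_apply_mem M x),
        Submodule.starProjection_eq_self_iff.2 (hNM (Submodule.starProjection_apply_mem N x))]
      simp
    have h2 : S (N.starProjection x) = 0 := ((hN _).1 (Submodule.starProjection_apply_mem N x)).2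
    rw [LinearMap.mem_ker]
    exact (congrArg S h1).trans h2
  · rw [Submodule.mem_orthogonal]
    intro u hu
    have hu' : M.starProjection u ∈ N :=
      (hN _).2 ⟨Submodule.starProjection_apply_mem M u, hu⟩
    have h3 : x - (1 - M.starProjection + N.starProjection : EllTwoPow G I →L[ℝ] _) x =
        M.starProjection x - N.starProjection x := by
      simp only [add_apply, sub_apply, one_apply_eq_self]
      abel
    have h4 : M.starProjection x - N.starProjection x =
        M.starProjection (x - N.starProjection x) := by
      rw [map_sub,
        Submodule.starProjection_eq_self_iff.2 (hNM (Submodule.starProjection_apply_mem N x))]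
    rw [h3, h4, ← Submodule.inner_starProjection_left_eq_right]
    exact (Submodule.mem_orthogonal _ _).1
      (Submodule.sub_starProjection_mem_orthogonal (K := N) x) _ hu'

/-- A dimension count on the fibre product M of the pairs with Rx = Ty. Since R maps into the
closure of the range of T, the map (x, y) ↦ Rx - Ty has the rank of T, hence dim M = |I| + dim ker
T. The projection of M to the first component has kernel ker T, so it has full rank |I|, and an
equivariant operator of full rank has dense range. -/
theorem dense_preimage_range {R : EllTwoPow G I →L[ℝ] EllTwoPow G K}
    {T : EllTwoPow G J →L[ℝ] EllTwoPow G K} (hR : IsEquivariant R) (hT : IsEquivariant T)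
    (h : ∀ x, R x ∈ closure (Set.range T)) (x : EllTwoPow G I) :
    x ∈ closure {x | ∃ y, R x = T y} := by
  set Φ : EllTwoPow G (I ⊕ J) →L[ℝ] EllTwoPow G K := R ∘L fst - T ∘L snd with hΦ
  have hΦe : IsEquivariant Φ := (hR.comp isEquivariant_fst).sub (hT.comp isEquivariant_snd)
  have hΦa : ∀ z, Φ z = R (fst z) - T (snd z) := fun z => rfl
  set M := Φ.ker with hM
  have hMe : IsStable M := hΦe.isStable_ker
  have hmem : ∀ z, z ∈ M ↔ R (fst z) = T (snd z) := fun z => by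
    rw [hM, LinearMap.mem_ker, ← sub_eq_zero (a := R (fst z))]; rfl
  set Ψ : EllTwoPow G (I ⊕ J) →L[ℝ] EllTwoPow G I := fst ∘L M.starProjection with hΨ
  have hΨe : IsEquivariant Ψ := isEquivariant_fst.comp hMe.isEquivariant_starProjection
  let N : Submodule ℝ (EllTwoPow G (I ⊕ J)) := M ⊓ (fst (I := I) (J := J) (G := G)).ker
  have hNc : IsClosed (N : Set (EllTwoPow G (I ⊕ J))) := by
    rw [Submodule.coe_inf]
    exact Φ.isClosed_ker.inter (fst (I := I) (J := J) (G := G)).isClosed_ker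
  have : CompleteSpace N := hNc.completeSpace_coe
  -- The ranges of Φ and T have the same closure, hence the same orthogonal complement.
  have hker : (ContinuousLinearMap.adjoint Φ).ker = (ContinuousLinearMap.adjoint T).ker := by
    ext k
    rw [LinearMap.mem_ker, LinearMap.mem_ker]
    constructor
    · intro hk
      refine ext_inner_right ℝ fun y => ?_
      have h1 : inner ℝ (ContinuousLinearMap.adjoint Φ k) (inr y) = 0 := by
        rw [show ContinuousLinearMap.adjoint Φ k = 0 from hk, inner_zero_left]
      rw [ContinuousLinearMap.adjoint_inner_left, hΦa] at h1
      simp only [fst_inr, snd_inr, map_zero, zero_sub, inner_neg_right, neg_eq_zero] at h1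
      rw [ContinuousLinearMap.coe_coe, ContinuousLinearMap.adjoint_inner_left, h1, inner_zero_left]
    · intro hk
      have h1 : ∀ z ∈ closure (Set.range T), inner ℝ k z = 0 := by
        intro z hz
        have hcl : IsClosed {z | inner ℝ k z = 0} :=
          isClosed_eq (continuous_const.inner continuous_id) continuous_const
        refine closure_minimal ?_ hcl hz
        rintro _ ⟨y, rfl⟩
        show inner ℝ k (T y) = 0
        rw [← ContinuousLinearMap.adjoint_inner_left,
          show ContinuousLinearMap.adjoint T k = 0 from hk, inner_zero_left]
      refine ext_inner_right ℝ fun z => ?_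
      rw [ContinuousLinearMap.coe_coe, ContinuousLinearMap.adjoint_inner_left, hΦa, inner_sub_right,
        h1 _ (h _), h1 _ (subset_closure ⟨_, rfl⟩), sub_zero, inner_zero_left]
  have d1 := card_sub_trace_ker Φ hΦe
  have d2 := card_sub_trace_ker T hT
  have d3 := card_sub_trace_ker Ψ hΨe
  have d4 := trace_ker_comp_starProjection M N fst (fun z => by
    rw [Submodule.mem_inf, LinearMap.mem_ker]; rfl)
  have d5 := vonNeumannTrace_map_inr T.ker N (fun z => by
    rw [Submodule.mem_inf, hmem, LinearMap.mem_ker, LinearMap.mem_ker]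
    constructor
    · rintro ⟨h1, h2⟩
      have h2' : fst z = 0 := h2
      exact ⟨h2', by rw [h2', map_zero] at h1; exact h1.symm⟩
    · rintro ⟨h1, h2⟩
      have h2' : T (snd z) = 0 := h2
      exact ⟨by rw [h1, h2', map_zero], h1⟩)
  simp only [hker] at d1
  rw [Fintype.card_sum, Nat.cast_add] at d1 d3 d4
  -- From `d1` and `d2`, dim M = |I| + dim ker T; with `d4` and `d5`, dim ker Ψ = |J|; so in `d3`
  -- the rank of Ψ is |I|.
  have d6 : vonNeumannTrace (ContinuousLinearMap.adjoint Ψ).ker.starProjection = 0 := by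
    have d4' : vonNeumannTrace Ψ.ker.starProjection = _ := d4
    linarith
  have hbot := eq_bot_of_vonNeumannTrace_eq_zero hΨe.adjoint.isStable_ker d6
  have hdense : (Ψ.range).topologicalClosure = ⊤ := by
    rw [Submodule.topologicalClosure_eq_top_iff, ContinuousLinearMap.orthogonal_range, hbot]
  have hx : x ∈ (Ψ.range).topologicalClosure := hdense ▸ Submodule.mem_top
  refine closure_mono ?_ hx
  rintro _ ⟨z, rfl⟩
  exact ⟨snd (M.starProjection z), (hmem _).1 (Submodule.starProjection_apply_mem M z)⟩

/-- Density of operator ranges, a consequence of the finiteness of the von Neumann dimension: if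
`R` maps `Z` into the closure of `T(C)`, then the elements of `Z` which `R` maps into `T(C)` are
dense in `Z`. -/
theorem mem_closure_preimage_image {R : EllTwoPow G I →L[ℝ] EllTwoPow G K}
    {T : EllTwoPow G J →L[ℝ] EllTwoPow G K} (hR : IsEquivariant R) (hT : IsEquivariant T)
    {Z : Submodule ℝ (EllTwoPow G I)} {C : Submodule ℝ (EllTwoPow G J)}
    (hZc : IsClosed (Z : Set (EllTwoPow G I))) (hCc : IsClosed (C : Set (EllTwoPow G J)))
    (hZ : IsStable Z) (hC : IsStable C) (h : ∀ z ∈ Z, R z ∈ closure (T '' C))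
    {z : EllTwoPow G I} (hz : z ∈ Z) :
    z ∈ closure {z | z ∈ Z ∧ ∃ y ∈ C, R z = T y} := by
  have : CompleteSpace Z := hZc.completeSpace_coe
  have : CompleteSpace C := hCc.completeSpace_coe
  have h1 := dense_preimage_range (hR.comp hZ.isEquivariant_starProjection)
    (hT.comp hC.isEquivariant_starProjection) (fun x => by
      refine closure_mono ?_ (h _ (Submodule.starProjection_apply_mem Z x))
      rintro _ ⟨y, hy, rfl⟩
      exact ⟨y, congrArg T (Submodule.starProjection_eq_self_iff.2 hy)⟩) z
  have h2 := map_mem_closure Z.starProjection.continuous h1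
    (t := {z | z ∈ Z ∧ ∃ y ∈ C, R z = T y}) (by
      rintro x ⟨y, hy⟩
      exact ⟨Submodule.starProjection_apply_mem Z x, _, Submodule.starProjection_apply_mem C y, hy⟩)
  rwa [Submodule.starProjection_eq_self_iff.2 hz] at h2

end Density

/-! ### Algebra of the simplicial boundary operator -/

section BoundaryAlgebra

variable {V : Type} [Fintype V] [LinearOrder V] {R M : Type*} [CommRing R] [AddCommGroup M]
  [Module R M]

/-- The incidence number of `τ` in `insert s τ`. -/
def incidence (R : Type*) [CommRing R] (τ : Finset V) (s : V) : R :=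
  (-1) ^ (τ.filter (fun t => t < s)).card

theorem incidence_mul_self (τ : Finset V) (s : V) : incidence R τ s * incidence R τ s = 1 := by
  rw [incidence, ← pow_add, Even.neg_one_pow ⟨_, rfl⟩]

theorem incidence_insert_of_lt {τ : Finset V} {s t : V} (hs : s ∉ τ) (h : s < t) :
    incidence R (insert s τ) t = - incidence R τ t := by
  rw [incidence, incidence, Finset.filter_insert, if_pos h, Finset.card_insert_of_notMem, pow_succ]
  · ring
  · simp [hs]

theorem incidence_insert_of_not_lt {τ : Finset V} {s t : V} (h : ¬ s < t) :
    incidence R (insert s τ) t = incidence R τ t := by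
  rw [incidence, incidence, Finset.filter_insert, if_neg h]

/-- Inserting a vertex shifts the position of exactly the larger vertices, so of the two insertions
one flips the other's sign and the other does not. -/
theorem incidence_mul_incidence_insert {τ : Finset V} {s t : V} (hs : s ∉ τ) (ht : t ∉ τ)
    (hst : s ≠ t) : incidence R τ s * incidence R (insert s τ) t =
      - (incidence R τ t * incidence R (insert t τ) s) := by
  rcases lt_or_gt_of_ne hst with h | h
  · rw [incidence_insert_of_lt hs h, incidence_insert_of_not_lt h.not_gt]
    ring
  · rw [incidence_insert_of_lt ht h, incidence_insert_of_not_lt h.not_gt]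
    ring

theorem simplicialBoundary_of_mem {F : Set (Finset V)} {τ : Finset V} (h : τ ∈ F)
    (f : Finset V → M) : simplicialBoundary R F f τ =
      ∑ s with s ∉ τ, incidence R τ s • f (insert s τ) := by
  simp [simplicialBoundary, h, incidence]

theorem simplicialBoundary_of_notMem {F : Set (Finset V)} {τ : Finset V} (h : τ ∉ F)
    (f : Finset V → M) : simplicialBoundary R F f τ = 0 := by
  simp [simplicialBoundary, h]

/-- The terms adding s and then t cancel those adding t and then s. Order convexity of F, which
holds for differences of complexes, ensures that an intermediate simplex outside F contributes
nothing. -/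
theorem simplicialBoundary_boundary {F : Set (Finset V)} (hF : F.OrdConnected)
    {f : Finset V → M} (hf : ∀ σ, σ ∉ F → f σ = 0) :
    simplicialBoundary R F (simplicialBoundary R F f) = 0 := by
  funext τ
  by_cases hτ : τ ∈ F
  swap
  · exact simplicialBoundary_of_notMem hτ _
  have h1 : ∀ s, simplicialBoundary R F f (insert s τ) =
      ∑ t with t ∉ insert s τ, incidence R (insert s τ) t • f (insert t (insert s τ)) := by
    intro s
    by_cases hs : insert s τ ∈ F
    · exact simplicialBoundary_of_mem hs _
    · rw [simplicialBoundary_of_notMem hs, Finset.sum_eq_zero]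
      intro t _
      rw [hf, smul_zero]
      exact fun ht => hs (hF.out hτ ht ⟨Finset.subset_insert _ _, Finset.subset_insert _ _⟩)
  rw [simplicialBoundary_of_mem hτ]
  simp only [h1, Finset.smul_sum, smul_smul, Pi.zero_apply]
  rw [Finset.sum_sigma']
  refine Finset.sum_involution (fun x _ => ⟨x.2, x.1⟩) ?_ ?_ ?_ ?_
  · rintro ⟨s, t⟩ h
    simp only [Finset.mem_sigma, Finset.mem_filter, Finset.mem_univ, true_and,
      Finset.mem_insert, not_or] at h
    rw [incidence_mul_incidence_insert h.1 h.2.2 (Ne.symm h.2.1), neg_smul,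
      Finset.insert_comm]
    exact neg_add_cancel _
  · rintro ⟨s, t⟩ h _ h'
    simp only [Finset.mem_sigma, Finset.mem_filter, Finset.mem_univ, true_and,
      Finset.mem_insert, not_or] at h
    exact h.2.1 (congrArg Sigma.fst h')
  · rintro ⟨s, t⟩ h
    simp only [Finset.mem_sigma, Finset.mem_filter, Finset.mem_univ, true_and,
      Finset.mem_insert, not_or] at h ⊢
    exact ⟨h.2.2, fun h' => h.2.1 h'.symm, h.1⟩
  · rintro ⟨s, t⟩ h
    rfl

/-- `G` is closed under passing to faces in `F`. -/
def IsClosedIn (G F : Set (Finset V)) : Prop :=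
  G ⊆ F ∧ ∀ σ ∈ G, ∀ τ ∈ F, τ ⊆ σ → τ ∈ G

theorem simplicialBoundary_eq_of_isClosedIn {G F : Set (Finset V)} (h : IsClosedIn G F)
    {f : Finset V → M} (hf : ∀ σ, σ ∉ G → f σ = 0) :
    simplicialBoundary R F f = simplicialBoundary R G f := by
  funext τ
  by_cases hG : τ ∈ G
  · rw [simplicialBoundary_of_mem hG, simplicialBoundary_of_mem (h.1 hG)]
  · rw [simplicialBoundary_of_notMem hG]
    by_cases hF : τ ∈ F
    · rw [simplicialBoundary_of_mem hF]
      refine Finset.sum_eq_zero fun s _ => ?_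
      rw [hf, smul_zero]
      exact fun hs => hG (h.2 _ hs _ hF (Finset.subset_insert _ _))
    · rw [simplicialBoundary_of_notMem hF]

open Classical in
/-- The restriction of a chain to a set of simplices. -/
def restrictTo (R : Type*) [CommRing R] {M : Type*} [AddCommGroup M] [Module R M]
    (O : Set (Finset V)) : (Finset V → M) →ₗ[R] (Finset V → M) where
  toFun f σ := if σ ∈ O then f σ else 0
  map_add' f g := by funext σ; by_cases h : σ ∈ O <;> simp [h]
  map_smul' c f := by funext σ; by_cases h : σ ∈ O <;> simp [h]

theorem restrictTo_of_mem {O : Set (Finset V)} {σ : Finset V} (h : σ ∈ O) (f : Finset V → M) :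
    restrictTo R O f σ = f σ := if_pos h

theorem restrictTo_of_notMem {O : Set (Finset V)} {σ : Finset V} (h : σ ∉ O) (f : Finset V → M) :
    restrictTo R O f σ = 0 := if_neg h

/-- Restriction is the quotient map from chains on F to relative chains modulo G; it is a chain map
because G contains the faces in F of its members. -/
theorem simplicialBoundary_restrictTo {G F : Set (Finset V)} (h : IsClosedIn G F)
    {f : Finset V → M} (hf : ∀ σ, σ ∉ F → f σ = 0) :
    simplicialBoundary R (F \ G) (restrictTo R (F \ G) f) =
      restrictTo R (F \ G) (simplicialBoundary R F f) := by
  funext τ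
  by_cases hτ : τ ∈ F \ G
  · rw [simplicialBoundary_of_mem hτ, restrictTo_of_mem hτ, simplicialBoundary_of_mem hτ.1]
    refine Finset.sum_congr rfl fun s _ => ?_
    by_cases hs : insert s τ ∈ F \ G
    · rw [restrictTo_of_mem hs]
    · rw [restrictTo_of_notMem hs, hf]
      exact fun hF => hs ⟨hF, fun hG => hτ.2 (h.2 _ hG _ hτ.1 (Finset.subset_insert _ _))⟩
  · rw [simplicialBoundary_of_notMem hτ, restrictTo_of_notMem hτ]

/-- Removing the vertex `v` from the simplices which contain it, with signs. -/
def removeVertex (R : Type*) [CommRing R] {M : Type*} [AddCommGroup M] [Module R M]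
    (v : V) : (Finset V → M) →ₗ[R] (Finset V → M) where
  toFun f τ := if v ∈ τ then 0 else incidence R τ v • f (insert v τ)
  map_add' f g := by funext σ; by_cases h : v ∈ σ <;> simp [h]
  map_smul' c f := by funext σ; by_cases h : v ∈ σ <;> simp [h, smul_comm c]

/-- Adding the vertex `v` to the simplices which do not contain it, with signs. -/
def joinVertex (R : Type*) [CommRing R] {M : Type*} [AddCommGroup M] [Module R M]
    (v : V) : (Finset V → M) →ₗ[R] (Finset V → M) where
  toFun f σ := if v ∈ σ then incidence R (σ.erase v) v • f (σ.erase v) else 0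
  map_add' f g := by funext σ; by_cases h : v ∈ σ <;> simp [h]
  map_smul' c f := by funext σ; by_cases h : v ∈ σ <;> simp [h, smul_comm c]

theorem removeVertex_of_mem {v : V} {τ : Finset V} (h : v ∈ τ) (f : Finset V → M) :
    removeVertex R v f τ = 0 := if_pos h

theorem removeVertex_of_notMem {v : V} {τ : Finset V} (h : v ∉ τ) (f : Finset V → M) :
    removeVertex R v f τ = incidence R τ v • f (insert v τ) := if_neg h

theorem joinVertex_of_mem {v : V} {τ : Finset V} (h : v ∈ τ) (f : Finset V → M) :
    joinVertex R v f τ = incidence R (τ.erase v) v • f (τ.erase v) := if_pos h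

theorem joinVertex_of_notMem {v : V} {τ : Finset V} (h : v ∉ τ) (f : Finset V → M) :
    joinVertex R v f τ = 0 := if_neg h

theorem joinVertex_removeVertex {v : V} {f : Finset V → M} (hf : ∀ σ, v ∉ σ → f σ = 0) :
    joinVertex R v (removeVertex R v f) = f := by
  funext σ
  by_cases h : v ∈ σ
  · rw [joinVertex_of_mem h, removeVertex_of_notMem (Finset.notMem_erase _ _), smul_smul,
      incidence_mul_self, one_smul, Finset.insert_erase h]
  · rw [joinVertex_of_notMem h, hf σ h]

theorem removeVertex_joinVertex {v : V} {f : Finset V → M} (hf : ∀ σ, v ∈ σ → f σ = 0) :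
    removeVertex R v (joinVertex R v f) = f := by
  funext σ
  by_cases h : v ∈ σ
  · rw [removeVertex_of_mem h, hf σ h]
  · rw [removeVertex_of_notMem h, joinVertex_of_mem (Finset.mem_insert_self _ _),
      Finset.erase_insert h, smul_smul, incidence_mul_self, one_smul]

/-- The link of `v` in a set of simplices. -/
def linkSet (F : Set (Finset V)) (v : V) : Set (Finset V) := {τ | v ∉ τ ∧ insert v τ ∈ F}

/-- The chain complex of a star is that of the link shifted by one. The sign arises from moving v
past the added vertex. -/
theorem simplicialBoundary_removeVertex {F : Set (Finset V)} (v : V) (f : Finset V → M) :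
    simplicialBoundary R (linkSet F v) (removeVertex R v f) =
      - removeVertex R v (simplicialBoundary R F f) := by
  funext τ
  rw [Pi.neg_apply]
  by_cases hv : v ∈ τ
  · rw [simplicialBoundary_of_notMem (fun h => h.1 hv), removeVertex_of_mem hv, neg_zero]
  by_cases hτ : insert v τ ∈ F
  swap
  · rw [simplicialBoundary_of_notMem (fun h => hτ h.2), removeVertex_of_notMem hv,
      simplicialBoundary_of_notMem hτ, smul_zero, neg_zero]
  rw [simplicialBoundary_of_mem (show τ ∈ linkSet F v from ⟨hv, hτ⟩), removeVertex_of_notMem hv,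
    simplicialBoundary_of_mem hτ, Finset.smul_sum, ← Finset.sum_neg_distrib]
  symm
  refine Finset.sum_subset_zero_on_sdiff ?_ ?_ ?_
  · intro s hs
    simp only [Finset.mem_filter, Finset.mem_univ, true_and, Finset.mem_insert, not_or] at hs ⊢
    exact hs.2
  · intro s hs
    simp only [Finset.mem_sdiff, Finset.mem_filter, Finset.mem_univ, true_and,
      Finset.mem_insert, not_or, not_and, not_not] at hs
    have : s = v := by
      by_contra h
      exact hs.1 (hs.2 h)
    rw [this, removeVertex_of_mem (Finset.mem_insert_self _ _), smul_zero]
  · intro s hs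
    simp only [Finset.mem_filter, Finset.mem_univ, true_and, Finset.mem_insert, not_or] at hs
    rw [removeVertex_of_notMem (by simp [Ne.symm hs.1, hv]), smul_smul, smul_smul,
      incidence_mul_incidence_insert hs.2 hv hs.1, neg_smul, Finset.insert_comm]

theorem map_simplicialBoundary {M' : Type*} [AddCommGroup M'] [Module R M'] (φ : M →ₗ[R] M')
    (F : Set (Finset V)) (f : Finset V → M) (τ : Finset V) :
    φ (simplicialBoundary R F f τ) = simplicialBoundary R F (fun σ => φ (f σ)) τ := by
  by_cases hτ : τ ∈ F
  · simp [simplicialBoundary_of_mem hτ]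
  · simp [simplicialBoundary_of_notMem hτ]

end BoundaryAlgebra

/-! ### Transport along an order embedding -/

section Transport

variable {U V : Type} [Fintype U] [LinearOrder U] [Fintype V] [LinearOrder V] {R M : Type*}
  [CommRing R] [AddCommGroup M] [Module R M]

theorem incidence_map (ι : U ↪o V) (τ : Finset U) (s : U) :
    incidence R (τ.map ι.toEmbedding) (ι s) = incidence R τ s := by
  rw [incidence, incidence, Finset.filter_map, Finset.card_map]
  congr 3
  ext t
  simp

/-- Monotonicity of ι preserves positions and hence signs; vertices outside its range contribute
nothing since no simplex of F contains them. -/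
theorem simplicialBoundary_map (ι : U ↪o V) {F : Set (Finset V)}
    (hF : ∀ σ ∈ F, ∀ s ∈ σ, s ∈ Set.range ι) {f : Finset V → M} (hf : ∀ σ, σ ∉ F → f σ = 0)
    (τ : Finset U) :
    simplicialBoundary R ((fun τ : Finset U => τ.map ι.toEmbedding) ⁻¹' F)
      (fun τ => f (τ.map ι.toEmbedding)) τ = simplicialBoundary R F f (τ.map ι.toEmbedding) := by
  by_cases hτ : τ.map ι.toEmbedding ∈ F
  swap
  · rw [simplicialBoundary_of_notMem hτ, simplicialBoundary_of_notMem]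
    exact hτ
  rw [simplicialBoundary_of_mem hτ, simplicialBoundary_of_mem (by exact hτ)]
  have h1 : ∀ s, incidence R τ s • f ((insert s τ).map ι.toEmbedding) =
      incidence R (τ.map ι.toEmbedding) (ι s) • f (insert (ι s) (τ.map ι.toEmbedding)) := by
    intro s
    rw [incidence_map, Finset.map_insert]
    rfl
  simp only [h1]
  refine (Finset.sum_map (Finset.univ.filter fun s => s ∉ τ) ι.toEmbedding
    (fun s => incidence R (τ.map ι.toEmbedding) s •
      f (insert s (τ.map ι.toEmbedding)))).symm.trans ?_
  refine Finset.sum_subset ?_ ?_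
  · intro t ht
    simp only [Finset.mem_map, Finset.mem_filter, Finset.mem_univ, true_and] at ht ⊢
    obtain ⟨s, hs, rfl⟩ := ht
    rintro ⟨s', hs', h⟩
    exact hs (by rwa [← ι.injective h])
  · intro t ht ht'
    rw [hf, smul_zero]
    intro h
    obtain ⟨s, rfl⟩ := hF _ h t (Finset.mem_insert_self _ _)
    apply ht'
    simp only [Finset.mem_map, Finset.mem_filter, Finset.mem_univ, true_and] at ht ⊢
    exact ⟨s, fun hs => ht ⟨s, hs, rfl⟩, rfl⟩

end Transport

/-! ### Cellular `ℓ²`-chains -/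

section Chains

variable {V : Type} [Fintype V] [LinearOrder V] (L : AbstractSimplicialComplex V)

open Classical in
/-- The boundary operator as a bounded operator. -/
def boundaryOp (F : Set (Finset V)) : ChainSpace L →L[ℝ] ChainSpace L :=
  EllTwoPow.pi fun τ =>
    if τ ∈ F then ∑ s with s ∉ τ, incidence ℝ τ s • EllTwoPow.coord (insert s τ) else 0

theorem ellTwoBoundary_apply (F : Set (Finset V)) (f : ChainSpace L) (τ : Finset V) :
    ellTwoBoundary L F f τ = simplicialBoundary ℝ F (fun σ => f σ) τ := rfl

theorem boundaryOp_eq (F : Set (Finset V)) (f : ChainSpace L) :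
    boundaryOp L F f = ellTwoBoundary L F f := by
  refine PiLp.ext fun τ => ?_
  rw [ellTwoBoundary_apply]
  by_cases hτ : τ ∈ F
  · simp [boundaryOp, hτ, simplicialBoundary_of_mem hτ]
  · simp [boundaryOp, hτ, simplicialBoundary_of_notMem hτ]

/-- Evaluation of a chain. -/
def evalChain (σ : Finset V) (g : RACG L) : ChainSpace L →L[ℝ] ℝ :=
  innerSL ℝ (leftTranslation (Finset V) g (unitVector (RACG L) (Finset V) σ))

@[simp]
theorem evalChain_apply (σ : Finset V) (g : RACG L) (f : ChainSpace L) :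
    evalChain L σ g f = f σ g := by
  rw [evalChain, innerSL_apply_apply, real_inner_comm, inner_leftTranslation_unitVector]

/-- Evaluation of an element of `ℓ²(G)` as a linear map. -/
def EllTwo.eval {B : Type} (g : B) : EllTwo B →ₗ[ℝ] ℝ where
  toFun f := f g
  map_add' _ _ := rfl
  map_smul' _ _ := rfl

theorem boundaryOp_apply_apply (F : Set (Finset V)) (f : ChainSpace L) (τ : Finset V)
    (g : RACG L) : boundaryOp L F f τ g = simplicialBoundary ℝ F (fun σ => f σ g) τ := by
  rw [boundaryOp_eq, ellTwoBoundary_apply]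
  exact map_simplicialBoundary (EllTwo.eval g) F _ τ

variable {L}

theorem mem_ellTwoChains {F : Set (Finset V)} {i : ℕ} {f : ChainSpace L} :
    f ∈ ellTwoChains L F i ↔ (∀ σ, ¬ (σ ∈ F ∧ σ.card = i) → f σ = 0) ∧
      ∀ σ, ∀ s ∈ σ, ∀ g : RACG L, f σ (g * gen L s) = - f σ g := Iff.rfl

theorem mem_ellTwoCycles {F : Set (Finset V)} {i : ℕ} {f : ChainSpace L} :
    f ∈ ellTwoCycles L F i ↔ f ∈ ellTwoChains L F i ∧ boundaryOp L F f = 0 := by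
  rw [ellTwoCycles, Submodule.mem_inf, LinearMap.mem_ker, boundaryOp_eq]

theorem mem_ellTwoBoundaries {F : Set (Finset V)} {i : ℕ} {f : ChainSpace L} :
    f ∈ ellTwoBoundaries L F i ↔ ∃ y ∈ ellTwoChains L F (i + 1), boundaryOp L F y = f := by
  simp only [ellTwoBoundaries, Submodule.mem_map, boundaryOp_eq]

theorem ellTwoChains_supp {F : Set (Finset V)} {i : ℕ} {f : ChainSpace L}
    (hf : f ∈ ellTwoChains L F i) (σ : Finset V) (h : σ ∉ F) : f σ = 0 :=
  hf.1 σ fun h' => h h'.1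

theorem ellTwoChains_supp_apply {F : Set (Finset V)} {i : ℕ} {f : ChainSpace L}
    (hf : f ∈ ellTwoChains L F i) (g : RACG L) (σ : Finset V) (h : σ ∉ F) : f σ g = 0 := by
  rw [ellTwoChains_supp hf σ h]; rfl

theorem isClosed_ellTwoChains (F : Set (Finset V)) (i : ℕ) :
    IsClosed (ellTwoChains L F i : Set (ChainSpace L)) := by
  have h : (ellTwoChains L F i : Set (ChainSpace L)) =
      (⋂ σ, ⋂ (_ : ¬ (σ ∈ F ∧ σ.card = i)), {f | EllTwoPow.coord σ f = 0}) ∩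
      ⋂ σ, ⋂ s ∈ σ, ⋂ g : RACG L, {f | evalChain L σ (g * gen L s) f = - evalChain L σ g f} := by
    ext f
    simp only [SetLike.mem_coe, mem_ellTwoChains, Set.mem_inter_iff, Set.mem_iInter,
      Set.mem_ofPred_eq, EllTwoPow.coord_apply, evalChain_apply]
  rw [h]
  refine IsClosed.inter ?_ ?_
  · exact isClosed_iInter fun σ => isClosed_iInter fun _ =>
      isClosed_eq (EllTwoPow.coord σ).continuous continuous_const
  · exact isClosed_iInter fun σ => isClosed_iInter fun s => isClosed_iInter fun _ =>
      isClosed_iInter fun g => isClosed_eq (evalChain L _ _).continuous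
        (evalChain L _ _).continuous.neg

theorem isStable_ellTwoChains (F : Set (Finset V)) (i : ℕ) : IsStable (ellTwoChains L F i) := by
  intro g f hf
  refine ⟨fun σ hσ => ?_, fun σ s hs h => ?_⟩
  · ext h
    rw [leftTranslation_apply, hf.1 σ hσ]
    rfl
  · rw [leftTranslation_apply, leftTranslation_apply, ← mul_assoc, hf.2 σ s hs]

theorem isEquivariant_boundaryOp (F : Set (Finset V)) : IsEquivariant (boundaryOp L F) := by
  intro g f
  ext σ h
  rw [leftTranslation_apply, boundaryOp_apply_apply, boundaryOp_apply_apply]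
  rfl

theorem isClosed_ellTwoCycles (F : Set (Finset V)) (i : ℕ) :
    IsClosed (ellTwoCycles L F i : Set (ChainSpace L)) := by
  have h : (ellTwoCycles L F i : Set (ChainSpace L)) =
      (ellTwoChains L F i : Set (ChainSpace L)) ∩ {f | boundaryOp L F f = 0} := by
    ext f
    exact mem_ellTwoCycles
  rw [h]
  exact (isClosed_ellTwoChains F i).inter
    (isClosed_eq (boundaryOp L F).continuous continuous_const)

theorem isStable_ellTwoCycles (F : Set (Finset V)) (i : ℕ) : IsStable (ellTwoCycles L F i) := by
  intro g f hf
  rw [mem_ellTwoCycles] at hf ⊢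
  refine ⟨isStable_ellTwoChains F i g f hf.1, ?_⟩
  rw [isEquivariant_boundaryOp, hf.2, map_zero]

theorem isStable_closure_ellTwoBoundaries (F : Set (Finset V)) (i : ℕ) :
    IsStable (ellTwoBoundaries L F i).topologicalClosure := by
  intro g f hf
  refine map_mem_closure (leftTranslation (Finset V) g).continuous hf ?_
  intro x hx
  obtain ⟨y, hy, rfl⟩ := mem_ellTwoBoundaries.1 hx
  exact mem_ellTwoBoundaries.2 ⟨_, isStable_ellTwoChains F _ g y hy,
    isEquivariant_boundaryOp F g y⟩

theorem boundaryOp_mem_ellTwoChains {F : Set (Finset V)} {i : ℕ} {f : ChainSpace L}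
    (hf : f ∈ ellTwoChains L F (i + 1)) : boundaryOp L F f ∈ ellTwoChains L F i := by
  refine ⟨fun τ hτ => ?_, fun τ t ht g => ?_⟩
  · rw [boundaryOp_eq, ellTwoBoundary_apply]
    by_cases hF : τ ∈ F
    · rw [simplicialBoundary_of_mem hF, Finset.sum_eq_zero]
      intro s hs
      rw [hf.1, smul_zero]
      rintro ⟨_, h⟩
      rw [Finset.card_insert_of_notMem (by simpa using hs)] at h
      exact hτ ⟨hF, by omega⟩
    · rw [simplicialBoundary_of_notMem hF]
  · rw [boundaryOp_apply_apply, boundaryOp_apply_apply]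
    by_cases hF : τ ∈ F
    · rw [simplicialBoundary_of_mem hF, simplicialBoundary_of_mem hF, ← Finset.sum_neg_distrib]
      refine Finset.sum_congr rfl fun s _ => ?_
      rw [hf.2 _ t (Finset.mem_insert_of_mem ht), smul_neg]
    · rw [simplicialBoundary_of_notMem hF, simplicialBoundary_of_notMem hF, neg_zero]

theorem boundaryOp_boundaryOp {F : Set (Finset V)} (hF : F.OrdConnected) {i : ℕ}
    {f : ChainSpace L} (hf : f ∈ ellTwoChains L F i) :
    boundaryOp L F (boundaryOp L F f) = 0 := by
  ext τ g
  rw [boundaryOp_apply_apply]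
  simp only [boundaryOp_apply_apply]
  exact congrFun (simplicialBoundary_boundary hF
    (ellTwoChains_supp_apply hf g)) τ

theorem ellTwoBoundaries_le_ellTwoCycles {F : Set (Finset V)} (hF : F.OrdConnected) (i : ℕ) :
    ellTwoBoundaries L F i ≤ ellTwoCycles L F i := by
  intro f hf
  obtain ⟨y, hy, rfl⟩ := mem_ellTwoBoundaries.1 hf
  exact mem_ellTwoCycles.2 ⟨boundaryOp_mem_ellTwoChains hy, boundaryOp_boundaryOp hF hy⟩

theorem closure_ellTwoBoundaries_le_ellTwoCycles {F : Set (Finset V)} (hF : F.OrdConnected)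
    (i : ℕ) : (ellTwoBoundaries L F i).topologicalClosure ≤ ellTwoCycles L F i :=
  Submodule.topologicalClosure_minimal _ (ellTwoBoundaries_le_ellTwoCycles hF i)
    (isClosed_ellTwoCycles F i)

theorem ellTwoChains_le {G F : Set (Finset V)} (h : G ⊆ F) (i : ℕ) :
    ellTwoChains L G i ≤ ellTwoChains L F i :=
  fun _ hf => ⟨fun σ hσ => hf.1 σ fun hG => hσ ⟨h hG.1, hG.2⟩, hf.2⟩

theorem boundaryOp_eq_of_isClosedIn {G F : Set (Finset V)} (h : IsClosedIn G F) {i : ℕ}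
    {f : ChainSpace L} (hf : f ∈ ellTwoChains L G i) : boundaryOp L F f = boundaryOp L G f := by
  ext τ g
  rw [boundaryOp_apply_apply, boundaryOp_apply_apply,
    simplicialBoundary_eq_of_isClosedIn h (ellTwoChains_supp_apply hf g)]

theorem ellTwoBoundaries_le {G F : Set (Finset V)} (h : IsClosedIn G F) (i : ℕ) :
    ellTwoBoundaries L G i ≤ ellTwoBoundaries L F i := by
  intro f hf
  obtain ⟨y, hy, rfl⟩ := mem_ellTwoBoundaries.1 hf
  exact mem_ellTwoBoundaries.2 ⟨y, ellTwoChains_le h.1 _ hy, boundaryOp_eq_of_isClosedIn h hy⟩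

variable (L) in
open Classical in
/-- The restriction of `ℓ²`-chains to the cubes with type in `O`. -/
def restrictOp (O : Set (Finset V)) : ChainSpace L →L[ℝ] ChainSpace L :=
  EllTwoPow.pi fun σ => if σ ∈ O then EllTwoPow.coord σ else 0

theorem restrictOp_of_mem {O : Set (Finset V)} {σ : Finset V} (h : σ ∈ O) (f : ChainSpace L) :
    restrictOp L O f σ = f σ := by
  simp [restrictOp, h]

theorem restrictOp_of_notMem {O : Set (Finset V)} {σ : Finset V} (h : σ ∉ O) (f : ChainSpace L) :
    restrictOp L O f σ = 0 := by
  simp [restrictOp, h]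

theorem restrictOp_apply_apply (O : Set (Finset V)) (f : ChainSpace L) (σ : Finset V)
    (g : RACG L) : restrictOp L O f σ g = restrictTo ℝ O (fun σ => f σ g) σ := by
  by_cases h : σ ∈ O
  · rw [restrictOp_of_mem h, restrictTo_of_mem h]
  · rw [restrictOp_of_notMem h, restrictTo_of_notMem h]; rfl

theorem isEquivariant_restrictOp (O : Set (Finset V)) : IsEquivariant (restrictOp L O) := by
  intro g f
  ext σ h
  rw [leftTranslation_apply]
  by_cases hσ : σ ∈ O
  · rw [restrictOp_of_mem hσ, restrictOp_of_mem hσ, leftTranslation_apply]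
  · rw [restrictOp_of_notMem hσ, restrictOp_of_notMem hσ]; rfl

theorem restrictOp_mem_ellTwoChains {F O : Set (Finset V)} (_ : O ⊆ F) {i : ℕ} {f : ChainSpace L}
    (hf : f ∈ ellTwoChains L F i) : restrictOp L O f ∈ ellTwoChains L O i := by
  refine ⟨fun σ hσ => ?_, fun σ s hs g => ?_⟩
  · by_cases hO : σ ∈ O
    · rw [restrictOp_of_mem hO]
      exact hf.1 σ fun h' => hσ ⟨hO, h'.2⟩
    · exact restrictOp_of_notMem hO f
  · by_cases hO : σ ∈ O
    · rw [restrictOp_of_mem hO, hf.2 σ s hs]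
    · simp [restrictOp_of_notMem hO]

theorem sub_restrictOp_mem_ellTwoChains {G F : Set (Finset V)} {i : ℕ} {f : ChainSpace L}
    (hf : f ∈ ellTwoChains L F i) : f - restrictOp L (F \ G) f ∈ ellTwoChains L G i := by
  refine ⟨fun σ hσ => ?_, (Submodule.sub_mem _ hf (ellTwoChains_le (F := F) Set.sdiff_subset i
    (restrictOp_mem_ellTwoChains Set.sdiff_subset hf))).2⟩
  rw [PiLp.sub_apply]
  by_cases hF : σ ∈ F \ G
  · rw [restrictOp_of_mem hF, sub_self]
  · rw [restrictOp_of_notMem hF, sub_zero]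
    exact hf.1 σ fun h => hF ⟨h.1, fun hG => hσ ⟨hG, h.2⟩⟩

theorem restrictOp_eq_self {O : Set (Finset V)} {i : ℕ} {f : ChainSpace L}
    (hf : f ∈ ellTwoChains L O i) : restrictOp L O f = f := by
  refine PiLp.ext fun σ => ?_
  by_cases hO : σ ∈ O
  · rw [restrictOp_of_mem hO]
  · rw [restrictOp_of_notMem hO, ellTwoChains_supp hf σ hO]

theorem boundaryOp_restrictOp {G F : Set (Finset V)} (h : IsClosedIn G F) {i : ℕ}
    {f : ChainSpace L} (hf : f ∈ ellTwoChains L F i) :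
    boundaryOp L (F \ G) (restrictOp L (F \ G) f) = restrictOp L (F \ G) (boundaryOp L F f) := by
  ext τ g
  rw [boundaryOp_apply_apply, restrictOp_apply_apply]
  simp only [restrictOp_apply_apply, boundaryOp_apply_apply]
  exact congrFun (simplicialBoundary_restrictTo h
    (ellTwoChains_supp_apply hf g)) τ

theorem restrictOp_mem_ellTwoCycles {G F : Set (Finset V)} (h : IsClosedIn G F) {i : ℕ}
    {f : ChainSpace L} (hf : f ∈ ellTwoCycles L F i) :
    restrictOp L (F \ G) f ∈ ellTwoCycles L (F \ G) i := by
  rw [mem_ellTwoCycles] at hf ⊢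
  refine ⟨restrictOp_mem_ellTwoChains Set.sdiff_subset hf.1, ?_⟩
  rw [boundaryOp_restrictOp h hf.1, hf.2, map_zero]

/-! ### Weak exactness -/

variable (L) in
/-- The reduced `ℓ²`-homology of the cubes with type in `F` vanishes in degree `i`. -/
def HomologyVanishes (F : Set (Finset V)) (i : ℕ) : Prop :=
  ellTwoCycles L F i ≤ (ellTwoBoundaries L F i).topologicalClosure

/-- Weak exactness at G: if the relative homology vanishes one degree higher, the homology of G
injects into that of F. By density the cycle may be taken to be a boundary ∂y in F. The relative
part of y is then a relative cycle, hence a limit of relative boundaries; subtracting these from y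
leaves chains whose relative part tends to zero. -/
theorem mem_closure_boundaries_of_homologyVanishes_sdiff {G F : Set (Finset V)}
    (hF : F.OrdConnected) (h : IsClosedIn G F) {i : ℕ}
    (hO : HomologyVanishes L (F \ G) (i + 1)) {c : ChainSpace L} (hc : c ∈ ellTwoCycles L G i)
    (hcF : c ∈ (ellTwoBoundaries L F i).topologicalClosure) :
    c ∈ (ellTwoBoundaries L G i).topologicalClosure := by
  have h1 := mem_closure_preimage_image (IsEquivariant.one (G := RACG L) (I := Finset V))
    (isEquivariant_boundaryOp F)
    (Z := ellTwoCycles L G i ⊓ (ellTwoBoundaries L F i).topologicalClosure)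
    (C := ellTwoChains L F (i + 1))
    ((isClosed_ellTwoCycles G i).inter (Submodule.isClosed_topologicalClosure _))
    (isClosed_ellTwoChains F _)
    (fun g x hx => ⟨isStable_ellTwoCycles G i g x hx.1,
      isStable_closure_ellTwoBoundaries F i g x hx.2⟩)
    (isStable_ellTwoChains F _) (fun z hz => by
      refine closure_mono ?_ hz.2
      intro x hx
      obtain ⟨y, hy, rfl⟩ := mem_ellTwoBoundaries.1 hx
      exact ⟨y, hy, rfl⟩) (z := c) ⟨hc, hcF⟩
  refine closure_minimal ?_ (Submodule.isClosed_topologicalClosure _) h1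
  rintro x ⟨⟨hx, -⟩, y, hy, hxy⟩
  replace hxy : x = boundaryOp L F y := hxy
  set yO := restrictOp L (F \ G) y
  have hyO : yO ∈ ellTwoCycles L (F \ G) (i + 1) := by
    refine mem_ellTwoCycles.2 ⟨restrictOp_mem_ellTwoChains Set.sdiff_subset hy, ?_⟩
    rw [boundaryOp_restrictOp h hy, ← hxy]
    refine PiLp.ext fun σ => ?_
    by_cases hσ : σ ∈ F \ G
    · rw [restrictOp_of_mem hσ, ellTwoChains_supp (mem_ellTwoCycles.1 hx).1 σ hσ.2]; rfl
    · rw [restrictOp_of_notMem hσ]; rfl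
  -- At u = yO the continuous map has value x. At a relative boundary u it has value ∂ of the part
  -- of y - ∂w lying in G, so x is a limit of boundaries in G.
  have h2 := map_mem_closure
    (show Continuous fun u => x - boundaryOp L F (yO - u) by fun_prop) (hO hyO)
    (t := ellTwoBoundaries L G i) (by
      intro u hu
      obtain ⟨w, hw, rfl⟩ := mem_ellTwoBoundaries.1 hu
      have hwF := ellTwoChains_le (F := F) Set.sdiff_subset _ hw
      have hy' : y - boundaryOp L F w ∈ ellTwoChains L F (i + 1) :=
        Submodule.sub_mem _ hy (boundaryOp_mem_ellTwoChains hwF)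
      have hr : restrictOp L (F \ G) (y - boundaryOp L F w) = yO - boundaryOp L (F \ G) w := by
        rw [map_sub, ← boundaryOp_restrictOp h hwF, restrictOp_eq_self hw]
      have hG := sub_restrictOp_mem_ellTwoChains (G := G) hy'
      refine mem_ellTwoBoundaries.2 ⟨_, hG, ?_⟩
      rw [← boundaryOp_eq_of_isClosedIn h hG, hr, map_sub, map_sub,
        boundaryOp_boundaryOp hF hwF, sub_zero, ← hxy])
  rwa [sub_self, map_zero, sub_zero] at h2

/-- Weak exactness at F. By density the cycle is a limit of cycles whose restriction is a relative
boundary ∂y exactly; subtracting ∂y in F leaves a cycle of G. Only restrictions of cycles of F are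
assumed to be trivial, since when a vertex is added the full relative homology of the star need not
vanish. -/
theorem homologyVanishes_of_isClosedIn {G F : Set (Finset V)} (hF : F.OrdConnected)
    (h : IsClosedIn G F) {i : ℕ} (hG : HomologyVanishes L G i)
    (hO : ∀ z ∈ ellTwoCycles L F i, restrictOp L (F \ G) z ∈
      (ellTwoBoundaries L (F \ G) i).topologicalClosure) :
    HomologyVanishes L F i := by
  intro z hz
  have h1 := mem_closure_preimage_image (isEquivariant_restrictOp (L := L) (F \ G))
    (isEquivariant_boundaryOp (F \ G)) (isClosed_ellTwoCycles F i)
    (isClosed_ellTwoChains (F \ G) (i + 1)) (isStable_ellTwoCycles F i)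
    (isStable_ellTwoChains (F \ G) _) (fun z hz => by
      refine closure_mono ?_ (hO z hz)
      intro x hx
      obtain ⟨y, hy, rfl⟩ := mem_ellTwoBoundaries.1 hx
      exact ⟨y, hy, rfl⟩) hz
  refine closure_minimal ?_ (Submodule.isClosed_topologicalClosure _) h1
  rintro x ⟨hx, y, hy, hxy⟩
  have hyF := ellTwoChains_le (F := F) Set.sdiff_subset _ hy
  have hb : boundaryOp L F y ∈ ellTwoBoundaries L F i := mem_ellTwoBoundaries.2 ⟨y, hyF, rfl⟩
  have hx' := mem_ellTwoCycles.1 hx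
  have hd : x - boundaryOp L F y ∈ ellTwoChains L G i := by
    have := sub_restrictOp_mem_ellTwoChains (G := G)
      (Submodule.sub_mem _ hx'.1 (boundaryOp_mem_ellTwoChains hyF))
    rwa [map_sub, ← boundaryOp_restrictOp h hyF, restrictOp_eq_self hy, hxy, sub_self,
      sub_zero] at this
  have hc : x - boundaryOp L F y ∈ ellTwoCycles L G i := by
    refine mem_ellTwoCycles.2 ⟨hd, ?_⟩
    rw [← boundaryOp_eq_of_isClosedIn h hd, map_sub, hx'.2, boundaryOp_boundaryOp hF hyF, sub_self]
  have h2 := Submodule.topologicalClosure_mono (ellTwoBoundaries_le h i) (hG hc)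
  have h3 := Submodule.add_mem _ h2 (Submodule.le_topologicalClosure _ hb)
  rwa [sub_add_cancel] at h3

/-! ### Open stars of vertices -/

open Classical in
variable (L) in
/-- Removing the vertex `v` from the types of cubes. -/
def removeVertexOp (v : V) : ChainSpace L →L[ℝ] ChainSpace L :=
  EllTwoPow.pi fun τ =>
    if v ∈ τ then 0 else incidence ℝ τ v • EllTwoPow.coord (insert v τ)

open Classical in
variable (L) in
/-- Adding the vertex `v` to the types of cubes. -/
def joinVertexOp (v : V) : ChainSpace L →L[ℝ] ChainSpace L :=
  EllTwoPow.pi fun σ =>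
    if v ∈ σ then incidence ℝ (σ.erase v) v • EllTwoPow.coord (σ.erase v) else 0

variable (L) in
/-- Right multiplication by `h`. -/
def rightTranslation (h : RACG L) : ChainSpace L →L[ℝ] ChainSpace L :=
  EllTwoPow.pi fun σ => EllTwo.pullback (· * h) (mul_left_injective h) ∘L EllTwoPow.coord σ

@[simp]
theorem rightTranslation_apply (h : RACG L) (f : ChainSpace L) (σ : Finset V) (g : RACG L) :
    rightTranslation L h f σ g = f σ (g * h) := rfl

theorem removeVertexOp_apply (v : V) (f : ChainSpace L) (τ : Finset V) :
    removeVertexOp L v f τ = removeVertex ℝ v (fun σ => f σ) τ := by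
  by_cases h : v ∈ τ
  · rw [removeVertex_of_mem h]; simp [removeVertexOp, h]
  · rw [removeVertex_of_notMem h]; simp [removeVertexOp, h]

theorem removeVertexOp_apply_apply (v : V) (f : ChainSpace L) (τ : Finset V) (g : RACG L) :
    removeVertexOp L v f τ g = removeVertex ℝ v (fun σ => f σ g) τ := by
  rw [removeVertexOp_apply]
  by_cases h : v ∈ τ
  · rw [removeVertex_of_mem h, removeVertex_of_mem h]; rfl
  · rw [removeVertex_of_notMem h, removeVertex_of_notMem h]; rfl

theorem joinVertexOp_apply (v : V) (f : ChainSpace L) (τ : Finset V) :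
    joinVertexOp L v f τ = joinVertex ℝ v (fun σ => f σ) τ := by
  by_cases h : v ∈ τ
  · rw [joinVertex_of_mem h]; simp [joinVertexOp, h]
  · rw [joinVertex_of_notMem h]; simp [joinVertexOp, h]

theorem joinVertexOp_apply_apply (v : V) (f : ChainSpace L) (τ : Finset V) (g : RACG L) :
    joinVertexOp L v f τ g = joinVertex ℝ v (fun σ => f σ g) τ := by
  rw [joinVertexOp_apply]
  by_cases h : v ∈ τ
  · rw [joinVertex_of_mem h, joinVertex_of_mem h]; rfl
  · rw [joinVertex_of_notMem h, joinVertex_of_notMem h]; rfl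

theorem boundaryOp_removeVertexOp (F : Set (Finset V)) (v : V) (f : ChainSpace L) :
    boundaryOp L (linkSet F v) (removeVertexOp L v f) = - removeVertexOp L v (boundaryOp L F f) := by
  ext τ g
  have h := congrFun (simplicialBoundary_removeVertex (R := ℝ) (F := F) v (fun σ => f σ g)) τ
  rw [Pi.neg_apply] at h
  rw [boundaryOp_apply_apply, PiLp.neg_apply, lp.coeFn_neg, Pi.neg_apply,
    removeVertexOp_apply_apply]
  simp only [boundaryOp_apply_apply, removeVertexOp_apply_apply]
  exact h

theorem joinVertexOp_removeVertexOp {v : V} {f : ChainSpace L} (hf : ∀ σ, v ∉ σ → f σ = 0) :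
    joinVertexOp L v (removeVertexOp L v f) = f := by
  refine PiLp.ext fun σ => ?_
  rw [joinVertexOp_apply]
  simp only [removeVertexOp_apply]
  exact congrFun (joinVertex_removeVertex (R := ℝ) hf) σ

theorem removeVertexOp_joinVertexOp {v : V} {f : ChainSpace L} (hf : ∀ σ, v ∈ σ → f σ = 0) :
    removeVertexOp L v (joinVertexOp L v f) = f := by
  refine PiLp.ext fun σ => ?_
  rw [removeVertexOp_apply]
  simp only [joinVertexOp_apply]
  exact congrFun (removeVertex_joinVertex (R := ℝ) hf) σ

theorem removeVertexOp_mem_ellTwoChains {F : Set (Finset V)} {v : V} {i : ℕ} {f : ChainSpace L}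
    (hf : f ∈ ellTwoChains L F (i + 1)) :
    removeVertexOp L v f ∈ ellTwoChains L (linkSet F v) i := by
  refine ⟨fun τ hτ => ?_, fun τ s hs g => ?_⟩
  · rw [removeVertexOp_apply]
    by_cases hv : v ∈ τ
    · exact removeVertex_of_mem hv _
    · rw [removeVertex_of_notMem hv, hf.1, smul_zero]
      rintro ⟨h1, h2⟩
      rw [Finset.card_insert_of_notMem hv] at h2
      exact hτ ⟨⟨hv, h1⟩, by omega⟩
  · rw [removeVertexOp_apply_apply, removeVertexOp_apply_apply]
    by_cases hv : v ∈ τ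
    · rw [removeVertex_of_mem hv, removeVertex_of_mem hv, neg_zero]
    · rw [removeVertex_of_notMem hv, removeVertex_of_notMem hv,
        hf.2 _ s (Finset.mem_insert_of_mem hs), smul_neg]

theorem removeVertexOp_mul_gen {F : Set (Finset V)} {v : V} {i : ℕ} {f : ChainSpace L}
    (hf : f ∈ ellTwoChains L F i) (τ : Finset V) (g : RACG L) :
    removeVertexOp L v f τ (g * gen L v) = - removeVertexOp L v f τ g := by
  rw [removeVertexOp_apply_apply, removeVertexOp_apply_apply]
  by_cases hv : v ∈ τ
  · rw [removeVertex_of_mem hv, removeVertex_of_mem hv, neg_zero]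
  · rw [removeVertex_of_notMem hv, removeVertex_of_notMem hv,
      hf.2 _ v (Finset.mem_insert_self _ _), smul_neg]

theorem gen_mul_self (s : V) : gen L s * gen L s = 1 :=
  (racMatrix L).toCoxeterSystem.simple_mul_simple_self s

theorem gen_mul_gen_cancel_right (g : RACG L) (s : V) : g * gen L s * gen L s = g := by
  rw [mul_assoc, gen_mul_self, mul_one]

variable (L) in
/-- Twice the projection onto the chains which are antisymmetric under `v`. -/
def antisymOp (v : V) : ChainSpace L →L[ℝ] ChainSpace L := 1 - rightTranslation L (gen L v)

theorem antisymOp_apply (v : V) (f : ChainSpace L) (σ : Finset V) (g : RACG L) :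
    antisymOp L v f σ g = f σ g - f σ (g * gen L v) := rfl

/-- With cubes oriented at a corner, the boundary formula never changes the group coordinate, so it
commutes with right translations. -/
theorem boundaryOp_antisymOp (F : Set (Finset V)) (v : V) (f : ChainSpace L) :
    boundaryOp L F (antisymOp L v f) = antisymOp L v (boundaryOp L F f) := by
  ext τ g
  rw [antisymOp_apply, boundaryOp_apply_apply, boundaryOp_apply_apply, boundaryOp_apply_apply]
  simp only [antisymOp_apply]
  rw [← Pi.sub_apply (simplicialBoundary ℝ F _), ← map_sub]
  rfl

theorem antisymOp_mem_ellTwoChains {F : Set (Finset V)} {v : V}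
    (hv : ∀ σ ∈ F, ∀ s ∈ σ, Commute (gen L s) (gen L v)) {i : ℕ} {f : ChainSpace L}
    (hf : f ∈ ellTwoChains L F i) : antisymOp L v f ∈ ellTwoChains L F i := by
  refine ⟨fun σ hσ => ?_, fun σ s hs g => ?_⟩
  · ext g
    rw [antisymOp_apply, hf.1 σ hσ]
    simp
  · rw [antisymOp_apply, antisymOp_apply]
    by_cases hF : σ ∈ F
    · rw [mul_assoc, (hv σ hF s hs).eq, ← mul_assoc, hf.2 σ s hs, hf.2 σ s hs]
      ring
    · simp [ellTwoChains_supp hf σ hF]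

theorem joinVertexOp_mem_ellTwoChains {F : Set (Finset V)} {v : V} {i : ℕ} {f : ChainSpace L}
    (hf : f ∈ ellTwoChains L (linkSet F v) i)
    (hv : ∀ σ g, f σ (g * gen L v) = - f σ g) :
    joinVertexOp L v f ∈ ellTwoChains L F (i + 1) := by
  refine ⟨fun σ hσ => ?_, fun σ s hs g => ?_⟩
  · rw [joinVertexOp_apply]
    by_cases h : v ∈ σ
    · rw [joinVertex_of_mem h, hf.1, smul_zero]
      rintro ⟨h1, h2⟩
      rw [Finset.card_erase_of_mem h] at h2
      have := Finset.card_pos.2 ⟨v, h⟩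
      refine hσ ⟨?_, by omega⟩
      have h3 := h1.2
      rwa [Finset.insert_erase h] at h3
    · exact joinVertex_of_notMem h _
  · rw [joinVertexOp_apply_apply, joinVertexOp_apply_apply]
    by_cases h : v ∈ σ
    · rw [joinVertex_of_mem h, joinVertex_of_mem h]
      by_cases hsv : s = v
      · rw [hsv, hv, smul_neg]
      · rw [hf.2 _ s (Finset.mem_erase.2 ⟨hsv, hs⟩), smul_neg]
    · rw [joinVertex_of_notMem h, joinVertex_of_notMem h, neg_zero]

theorem boundaryOp_joinVertexOp {F : Set (Finset V)} {v : V} (hF : ∀ σ ∈ F, v ∈ σ) {i : ℕ}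
    {f : ChainSpace L} (hf : f ∈ ellTwoChains L (linkSet F v) i) :
    boundaryOp L F (joinVertexOp L v f) = - joinVertexOp L v (boundaryOp L (linkSet F v) f) := by
  have h1 := boundaryOp_removeVertexOp F v (joinVertexOp L v f)
  rw [removeVertexOp_joinVertexOp
    (fun σ hσ => ellTwoChains_supp hf σ fun h => h.1 hσ)] at h1
  rw [h1, map_neg, neg_neg, joinVertexOp_removeVertexOp]
  intro σ hσ
  rw [boundaryOp_eq, ellTwoBoundary_apply]
  exact simplicialBoundary_of_notMem (fun h => hσ (hF σ h)) _

theorem antisymOp_mul_gen (v : V) (f : ChainSpace L) (σ : Finset V) (g : RACG L) :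
    antisymOp L v f σ (g * gen L v) = - antisymOp L v f σ g := by
  rw [antisymOp_apply, antisymOp_apply, gen_mul_gen_cancel_right, neg_sub]

/-- Chains on the star are antisymmetric under right multiplication by v, a condition absent for
chains on the link, so bounding chains in the link must first be antisymmetrized. This is possible
as v commutes with all vertices of its star. Since `antisymOp` doubles antisymmetric chains, half of
`joinVertexOp` after `antisymOp` inverts the removal of v. -/
theorem mem_closure_boundaries_of_removeVertexOp {F : Set (Finset V)} {v : V}
    (hF : ∀ σ ∈ F, v ∈ σ) (hcomm : ∀ σ ∈ F, ∀ s ∈ σ, Commute (gen L s) (gen L v)) {i : ℕ}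
    {b : ChainSpace L} (hb : b ∈ ellTwoCycles L F (i + 1))
    (hr : removeVertexOp L v b ∈ (ellTwoBoundaries L (linkSet F v) i).topologicalClosure) :
    b ∈ (ellTwoBoundaries L F (i + 1)).topologicalClosure := by
  have hb' := (mem_ellTwoCycles.1 hb).1
  have h1 := map_mem_closure (show Continuous fun u => (2⁻¹ : ℝ) •
    joinVertexOp L v (antisymOp L v u) by fun_prop) hr
    (t := ellTwoBoundaries L F (i + 1)) (by
      intro u hu
      refine Submodule.smul_mem _ _ ?_
      obtain ⟨w, hw, rfl⟩ := mem_ellTwoBoundaries.1 hu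
      have hw' := antisymOp_mem_ellTwoChains (v := v)
        (fun σ hσ s hs => hcomm _ hσ.2 s (Finset.mem_insert_of_mem hs)) hw
      rw [← boundaryOp_antisymOp, ← neg_neg (joinVertexOp L v _),
        ← boundaryOp_joinVertexOp hF hw']
      exact Submodule.neg_mem _ (mem_ellTwoBoundaries.2
        ⟨_, joinVertexOp_mem_ellTwoChains hw' (antisymOp_mul_gen v w), rfl⟩))
  have h2 : antisymOp L v (removeVertexOp L v b) = (2 : ℝ) • removeVertexOp L v b := by
    ext τ g
    rw [antisymOp_apply, removeVertexOp_mul_gen hb', sub_neg_eq_add, ← two_mul]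
    rfl
  rw [h2, map_smul, smul_smul, joinVertexOp_removeVertexOp
    (fun σ hσ => ellTwoChains_supp hb' σ fun h => hσ (hF σ h))] at h1
  norm_num at h1
  exact h1

end Chains

/-! ### Full subcomplexes, links and deletions -/

section Subcomplexes

variable {V : Type}

theorem PreAbstractSimplicialComplex.nonempty_of_mem (K : PreAbstractSimplicialComplex V)
    {σ : Finset V} (h : σ ∈ K.faces) : σ.Nonempty := (K.isRelLowerSet_faces h).1

theorem PreAbstractSimplicialComplex.down (K : PreAbstractSimplicialComplex V)
    {σ τ : Finset V} (h : σ ∈ K.faces) (hτ : τ ⊆ σ) (h0 : τ.Nonempty) : τ ∈ K.faces :=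
  (K.isRelLowerSet_faces h).2 hτ h0

theorem PreAbstractSimplicialComplex.singleton_mem_of_mem (K : PreAbstractSimplicialComplex V)
    {σ : Finset V} (h : σ ∈ K.faces) {s : V} (hs : s ∈ σ) : {s} ∈ K.faces :=
  K.down h (Finset.singleton_subset_iff.2 hs) (Finset.singleton_nonempty s)

theorem mem_simplices {K : PreAbstractSimplicialComplex V} {σ : Finset V} :
    σ ∈ simplices K ↔ σ = ∅ ∨ σ ∈ K.faces := Iff.rfl

theorem mem_faces_of_mem_simplices {K : PreAbstractSimplicialComplex V} {σ : Finset V}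
    (h : σ ∈ simplices K) (h0 : σ.Nonempty) : σ ∈ K.faces :=
  h.resolve_left h0.ne_empty

theorem isLowerSet_simplices (K : PreAbstractSimplicialComplex V) : IsLowerSet (simplices K) :=
  fun _ _ h hσ => simplices_down K hσ h

theorem ordConnected_simplices (K : PreAbstractSimplicialComplex V) :
    (simplices K).OrdConnected := (isLowerSet_simplices K).ordConnected

theorem ordConnected_simplices_sdiff (K A : PreAbstractSimplicialComplex V) :
    (simplices K \ simplices A).OrdConnected :=
  (ordConnected_simplices K).inter (isLowerSet_simplices A).compl.ordConnected

theorem isClosedIn_simplices [Fintype V] [LinearOrder V] {A B : PreAbstractSimplicialComplex V}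
    (h : A ≤ B) : IsClosedIn (simplices A) (simplices B) :=
  ⟨simplices_mono h, fun _ hσ _ _ hτ => simplices_down A hσ hτ⟩

variable [DecidableEq V]

theorem IsFullSubcomplex.trans {A B C : PreAbstractSimplicialComplex V}
    (h : IsFullSubcomplex A B) (h' : IsFullSubcomplex B C) : IsFullSubcomplex A C :=
  ⟨h.1.trans h'.1, fun σ hσ hs => h.2 σ (h'.2 σ hσ fun s hs' => h.1 (hs s hs')) hs⟩

theorem IsFullSubcomplex.deleteVertex (B : PreAbstractSimplicialComplex V) (v : V) :
    IsFullSubcomplex (deleteVertex B v) B :=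
  ⟨fun _ h => h.1, fun _ hσ hs => ⟨hσ, fun hv => (hs v hv).2 (Finset.mem_singleton_self v)⟩⟩

theorem IsFullSubcomplex.isFlag {A L : PreAbstractSimplicialComplex V}
    (h : IsFullSubcomplex A L) (hL : IsFlag L) : IsFlag A := fun σ h0 hs hst =>
  h.2 σ (hL σ h0 (fun s hs' => h.1 (hs s hs')) (fun s hs' t ht hne => h.1 (hst s hs' t ht hne))) hs

theorem mem_link_singleton {S : PreAbstractSimplicialComplex V} {v : V} {τ : Finset V} :
    τ ∈ (link S {v}).faces ↔ τ.Nonempty ∧ v ∉ τ ∧ insert v τ ∈ S.faces := by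
  show τ.Nonempty ∧ Disjoint τ {v} ∧ τ ∪ {v} ∈ S.faces ↔ _
  rw [Finset.disjoint_singleton_right, Finset.union_singleton]

/-- The edges of σ and the edges from v to its vertices are pairwise present, so flagness fills in
the simplex spanned by σ and v. -/
theorem IsFlag.isFullSubcomplex_link {S : PreAbstractSimplicialComplex V} (hS : IsFlag S) (v : V) :
    IsFullSubcomplex (link S {v}) S := by
  refine ⟨fun τ h => S.down (mem_link_singleton.1 h).2.2 (Finset.subset_insert _ _)
    (mem_link_singleton.1 h).1, fun σ hσ hs => ?_⟩
  have h0 := S.nonempty_of_mem hσ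
  have hs' : ∀ s ∈ σ, s ≠ v ∧ {v, s} ∈ S.faces := fun s h => by
    have := mem_link_singleton.1 (hs s h)
    exact ⟨fun h' => this.2.1 (by simp [h']), this.2.2⟩
  obtain ⟨x, hx⟩ := h0
  have hv : {v} ∈ S.faces := S.singleton_mem_of_mem (hs' x hx).2 (by simp)
  refine mem_link_singleton.2 ⟨⟨x, hx⟩, fun h => (hs' v h).1 rfl, ?_⟩
  refine hS _ (Finset.insert_nonempty _ _) ?_ ?_
  · intro s h
    rcases Finset.mem_insert.1 h with rfl | h
    · exact hv
    · exact S.singleton_mem_of_mem hσ h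
  · intro s h t ht hne
    rcases Finset.mem_insert.1 h with h1 | h1
    · rcases Finset.mem_insert.1 ht with h2 | h2
      · exact absurd (h1.trans h2.symm) hne
      · rw [h1]; exact (hs' t h2).2
    · rcases Finset.mem_insert.1 ht with h2 | h2
      · rw [h2, Finset.pair_comm]; exact (hs' s h1).2
      · refine S.down hσ ?_ (Finset.insert_nonempty _ _)
        intro x hx
        rcases Finset.mem_insert.1 hx with rfl | hx
        · exact h1
        · rwa [Finset.mem_singleton.1 hx]

theorem IsFullSubcomplex.link {B S : PreAbstractSimplicialComplex V}
    (h : IsFullSubcomplex B S) (v : V) : IsFullSubcomplex (link B {v}) (link S {v}) := by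
  refine ⟨fun τ hτ => ?_, fun σ hσ hs => ?_⟩
  · rw [mem_link_singleton] at hτ ⊢
    exact ⟨hτ.1, hτ.2.1, h.1 hτ.2.2⟩
  · rw [mem_link_singleton] at hσ ⊢
    refine ⟨hσ.1, hσ.2.1, h.2 _ hσ.2.2 fun s hs' => ?_⟩
    obtain ⟨x, hx⟩ := hσ.1
    rcases Finset.mem_insert.1 hs' with rfl | hs'
    · exact B.singleton_mem_of_mem (mem_link_singleton.1 (hs x hx)).2.2 (by simp)
    · exact B.singleton_mem_of_mem (mem_link_singleton.1 (hs s hs')).2.2 (by simp)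

/-- The open star of a vertex. -/
def openStar (B : PreAbstractSimplicialComplex V) (v : V) : Set (Finset V) :=
  {σ | v ∈ σ ∧ σ ∈ B.faces}

theorem simplices_sdiff_deleteVertex (B : PreAbstractSimplicialComplex V) (v : V) :
    simplices B \ simplices (deleteVertex B v) = openStar B v := by
  ext σ
  constructor
  · rintro ⟨h1, h2⟩
    rcases h1 with rfl | h1
    · exact absurd (Or.inl rfl) h2
    · refine ⟨?_, h1⟩
      by_contra hv
      exact h2 (Or.inr ⟨h1, hv⟩)
  · rintro ⟨h1, h2⟩
    refine ⟨Or.inr h2, ?_⟩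
    rintro (rfl | h)
    · simp at h1
    · exact h.2 h1

theorem mem_simplices_link {B : PreAbstractSimplicialComplex V} {v : V} (hv : {v} ∈ B.faces)
    {τ : Finset V} : τ ∈ simplices (link B {v}) ↔ v ∉ τ ∧ insert v τ ∈ B.faces := by
  rw [mem_simplices, mem_link_singleton]
  rcases τ.eq_empty_or_nonempty with rfl | h
  · simpa using hv
  · simp [h, h.ne_empty]

theorem mem_simplices_cone {v : V} {K : PreAbstractSimplicialComplex V} {σ : Finset V} :
    σ ∈ simplices (cone v K) ↔ σ.erase v ∈ simplices K := by
  constructor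
  · rintro (rfl | h)
    · exact Or.inl (by simp)
    · exact h.2
  · intro h
    rcases σ.eq_empty_or_nonempty with rfl | h0
    · exact Or.inl rfl
    · exact Or.inr ⟨h0, h⟩

theorem link_link (S : PreAbstractSimplicialComplex V) (ρ : Finset V) {σ : Finset V}
    (hσ : Disjoint σ ρ) : link (link S ρ) σ = link S (σ ∪ ρ) := by
  apply PreAbstractSimplicialComplex.ext
  ext τ
  show (τ.Nonempty ∧ Disjoint τ σ ∧ (τ ∪ σ).Nonempty ∧ Disjoint (τ ∪ σ) ρ ∧ τ ∪ σ ∪ ρ ∈ S.faces) ↔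
    (τ.Nonempty ∧ Disjoint τ (σ ∪ ρ) ∧ τ ∪ (σ ∪ ρ) ∈ S.faces)
  rw [Finset.disjoint_union_right, Finset.disjoint_union_left, Finset.union_assoc]
  constructor
  · rintro ⟨h0, h1, -, h2, h3⟩
    exact ⟨h0, ⟨h1, h2.1⟩, h3⟩
  · rintro ⟨h0, ⟨h1, h2⟩, h3⟩
    exact ⟨h0, h1, h0.mono Finset.subset_union_left, ⟨h2, hσ⟩, h3⟩

end Subcomplexes

/-! ### Links of vertices in homology spheres -/

section LinkOfVertex

variable {V : Type} [Fintype V] [LinearOrder V]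

theorem linkSet_openStar (B : PreAbstractSimplicialComplex V) {v : V}
    (hv : {v} ∈ B.faces) : linkSet (openStar B v) v = simplices (link B {v}) := by
  ext τ
  rw [mem_simplices_link hv]
  simp [linkSet, openStar]

/-- A link inside the link of v is the link in S of a simplex with one vertex more. -/
theorem isGHS_link {S : PreAbstractSimplicialComplex V} {n : ℕ}
    (hS : IsGHS S (n + 1)) {v : V} (hv : {v} ∈ S.faces) : IsGHS (link S {v}) n := by
  refine ⟨?_, fun σ hσ => ?_⟩
  · obtain ⟨j, hj, h⟩ := hS.2 _ hv
    rw [Finset.card_singleton] at hj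
    rwa [show n = j by omega]
  · obtain ⟨h0, hd, hσ⟩ := hσ
    obtain ⟨j, hj, h⟩ := hS.2 _ hσ
    rw [Finset.card_union_of_disjoint hd, Finset.card_singleton] at hj
    refine ⟨j, by omega, ?_⟩
    rwa [link_link S _ hd]

end LinkOfVertex

/-! ### Vanishing statements relative to an ambient complex -/

section Vanishing

/-- The statement `V(n)` for generalized homology spheres which are full subcomplexes of an
ambient flag complex. -/
def AmbientV (n : ℕ) : Prop :=
  ∀ (V : Type) [Fintype V] [LinearOrder V] (L : AbstractSimplicialComplex V)
    (S A : PreAbstractSimplicialComplex V), IsFlag L.toPreAbstractSimplicialComplex →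
      IsFullSubcomplex S L.toPreAbstractSimplicialComplex → IsGHS S n → IsFullSubcomplex A S →
      (∀ k : ℕ, n = 2 * k → ∀ i : ℕ, k < i →
        HomologyVanishes L (simplices S \ simplices A) i) ∧
      (∀ k : ℕ, n = 2 * k + 1 → ∀ i : ℕ, k < i → HomologyVanishes L (simplices A) i)

/-- The statement `III(2m+1)` for generalized homology spheres which are full subcomplexes of an
ambient flag complex. -/
def AmbientIII (m : ℕ) : Prop :=
  ∀ (V : Type) [Fintype V] [LinearOrder V] (L : AbstractSimplicialComplex V)
    (S : PreAbstractSimplicialComplex V) (v : V), IsFlag L.toPreAbstractSimplicialComplex →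
      IsFullSubcomplex S L.toPreAbstractSimplicialComplex → IsGHS S (2 * m + 1) →
      {v} ∈ S.faces → ∀ c ∈ ellTwoCycles L (simplices (link S {v})) m,
      c ∈ (ellTwoBoundaries L (simplices (deleteVertex S v)) m).topologicalClosure →
      c ∈ (ellTwoBoundaries L (simplices (cone v (link S {v}))) m).topologicalClosure →
      c ∈ (ellTwoBoundaries L (simplices (link S {v})) m).topologicalClosure

variable {V : Type} [Fintype V] [LinearOrder V] {L : AbstractSimplicialComplex V}

theorem homologyVanishes_of_forall_card_ne {F : Set (Finset V)} {i : ℕ}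
    (h : ∀ σ ∈ F, σ.card ≠ i) : HomologyVanishes L F i := by
  intro c hc
  have : c = 0 := PiLp.ext fun σ => (mem_ellTwoCycles.1 hc).1.1 σ fun hσ => h σ hσ.1 hσ.2
  rw [this]
  exact Submodule.zero_mem _

theorem commute_gen {s t : V} (h : {s, t} ∈ L.faces) : Commute (gen L s) (gen L t) := by
  by_cases hst : s = t
  · subst hst; exact Commute.refl _
  have h1 : (gen L s * gen L t) ^ 2 = 1 := by
    have := (racMatrix L).toCoxeterSystem.simple_mul_simple_pow s t
    have hM : racMatrix L s t = 2 := by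
      show (racMatrix L).M s t = 2
      simp [racMatrix, hst, h]
    rwa [hM] at this
  have h2 : gen L s * gen L t = (gen L s * gen L t)⁻¹ := by
    rw [eq_inv_iff_mul_eq_one, ← pow_two, h1]
  have h3 : ∀ s, (gen L s)⁻¹ = gen L s := fun s => inv_eq_of_mul_eq_one_right (gen_mul_self s)
  rw [mul_inv_rev, h3, h3] at h2
  exact h2

theorem commute_gen_of_mem {K : PreAbstractSimplicialComplex V}
    (hK : K ≤ L.toPreAbstractSimplicialComplex) {σ : Finset V} (hσ : σ ∈ K.faces) {s t : V}
    (hs : s ∈ σ) (ht : t ∈ σ) : Commute (gen L s) (gen L t) :=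
  commute_gen (hK (K.down hσ (by
    intro x hx
    rcases Finset.mem_insert.1 hx with rfl | hx
    · exact hs
    · rwa [Finset.mem_singleton.1 hx]) (Finset.insert_nonempty _ _)))

/-- A relative cycle on the open star has no boundary at types containing v; what remains of its
absolute boundary is the part on the link. This is the Mayer-Vietoris connecting map, and the same
formula serves for B and for the cone. -/
theorem boundaryOp_eq_removeVertexOp {F O : Set (Finset V)} {v : V}
    (hO : O = {σ | v ∈ σ ∧ σ ∈ F}) (hl : linkSet O v ⊆ F) {i : ℕ} {z : ChainSpace L}
    (hz : z ∈ ellTwoCycles L O i) : boundaryOp L F z = removeVertexOp L v z := by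
  rw [mem_ellTwoCycles] at hz
  have h0 : ∀ σ g, σ ∉ O → z σ g = 0 := fun σ g h => ellTwoChains_supp_apply hz.1 g σ h
  ext τ g
  rw [boundaryOp_apply_apply, removeVertexOp_apply_apply]
  by_cases hv : v ∈ τ
  · rw [removeVertex_of_mem hv]
    by_cases hF : τ ∈ F
    · have h1 : boundaryOp L O z τ g = 0 := by rw [hz.2]; rfl
      rw [boundaryOp_apply_apply, simplicialBoundary_of_mem (by rw [hO]; exact ⟨hv, hF⟩)] at h1
      rw [simplicialBoundary_of_mem hF, h1]
    · rw [simplicialBoundary_of_notMem hF]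
  · rw [removeVertex_of_notMem hv]
    by_cases hF : τ ∈ F
    · rw [simplicialBoundary_of_mem hF, Finset.sum_eq_single v]
      · intro s _ hs
        rw [h0, smul_zero]
        rw [hO]
        intro h
        rcases Finset.mem_insert.1 h.1 with h | h
        · exact hs h.symm
        · exact hv h
      · simp [hv]
    · rw [simplicialBoundary_of_notMem hF, h0, smul_zero]
      exact fun h => hF (hl ⟨hv, h⟩)

theorem isFullSubcomplex_bot (S : PreAbstractSimplicialComplex V) : IsFullSubcomplex ⊥ S := by
  refine ⟨bot_le, fun σ hσ hs => ?_⟩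
  obtain ⟨x, hx⟩ := S.nonempty_of_mem hσ
  exact (hs x hx).elim

theorem simplices_bot : simplices (⊥ : PreAbstractSimplicialComplex V) = {∅} := by
  ext σ
  exact ⟨fun h => h.elim id (fun h => h.elim), fun h => Or.inl h⟩

/-- The empty subcomplex still has the empty simplex, whose cubes are the vertices of the cubical
complex; they carry homology in degree 0 only. -/
theorem homologyVanishes_simplices_of_sdiff_bot {S : PreAbstractSimplicialComplex V} {i : ℕ}
    (hi : 0 < i) (h : HomologyVanishes L (simplices S \ simplices ⊥) i) :
    HomologyVanishes L (simplices S) i := by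
  have hc := isClosedIn_simplices (bot_le : ⊥ ≤ S)
  refine homologyVanishes_of_isClosedIn (ordConnected_simplices S) hc ?_
    fun z hz => h (restrictOp_mem_ellTwoCycles hc hz)
  refine homologyVanishes_of_forall_card_ne fun σ hσ => ?_
  rw [simplices_bot, Set.mem_singleton_iff] at hσ
  rw [hσ, Finset.card_empty]
  exact hi.ne

/-- Adding a vertex `v` to a full subcomplex `B - v` does not create homology in degree `j + 1`
if cycles in the link of `v` which bound in `B - v` and in the cone bound in the link. -/
theorem homologyVanishes_of_deleteVertex {B : PreAbstractSimplicialComplex V}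
    (hB : B ≤ L.toPreAbstractSimplicialComplex) {v : V} (hv : {v} ∈ B.faces) {j : ℕ}
    (hA : HomologyVanishes L (simplices (deleteVertex B v)) (j + 1))
    (hK : ∀ y ∈ ellTwoCycles L (simplices (link B {v})) j,
      y ∈ ellTwoBoundaries L (simplices (deleteVertex B v)) j →
      y ∈ ellTwoBoundaries L (simplices (cone v (link B {v}))) j →
      y ∈ (ellTwoBoundaries L (simplices (link B {v})) j).topologicalClosure) :
    HomologyVanishes L (simplices B) (j + 1) := by
  have hc := isClosedIn_simplices (IsFullSubcomplex.deleteVertex B v).1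
  refine homologyVanishes_of_isClosedIn (ordConnected_simplices B) hc hA fun z hz => ?_
  have hs := restrictOp_mem_ellTwoCycles hc hz
  have hd := sub_restrictOp_mem_ellTwoChains (G := simplices (deleteVertex B v))
    (mem_ellTwoCycles.1 hz).1
  rw [simplices_sdiff_deleteVertex] at hs hd ⊢
  set b := restrictOp L (openStar B v) z
  have hs' := mem_ellTwoCycles.1 hs
  have hlB : linkSet (openStar B v) v ⊆ simplices B := by
    rw [linkSet_openStar B hv]
    intro τ hτ
    rw [mem_simplices_link hv] at hτ
    exact simplices_down B (Or.inr hτ.2) (Finset.subset_insert _ _)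
  have hsB : openStar B v = {σ | v ∈ σ ∧ σ ∈ simplices B} := by
    ext σ
    exact ⟨fun h => ⟨h.1, Or.inr h.2⟩, fun h => ⟨h.1, mem_faces_of_mem_simplices h.2 ⟨v, h.1⟩⟩⟩
  have hbB : boundaryOp L (simplices B) b = removeVertexOp L v b :=
    boundaryOp_eq_removeVertexOp hsB hlB hs
  have hsC : openStar B v = {σ | v ∈ σ ∧ σ ∈ simplices (cone v (link B {v}))} := by
    ext σ
    refine and_congr_right fun h => ?_
    rw [mem_simplices_cone, mem_simplices_link hv, Finset.insert_erase h]
    simp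
  have hlC : linkSet (openStar B v) v ⊆ simplices (cone v (link B {v})) := by
    rw [linkSet_openStar B hv]
    exact simplices_mono (le_cone _ _)
  have hbC : boundaryOp L (simplices (cone v (link B {v}))) b = removeVertexOp L v b :=
    boundaryOp_eq_removeVertexOp hsC hlC hs
  refine mem_closure_boundaries_of_removeVertexOp (fun σ hσ => hσ.1)
    (fun σ hσ s hs => commute_gen_of_mem hB hσ.2 hs hσ.1) hs ?_
  rw [linkSet_openStar B hv]
  -- The link cycle obtained from the star part b of z is the boundary of b in the cone, and of b -
  -- z in B - v because z is a cycle.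
  refine hK _ ?_ ?_ ?_
  · rw [mem_ellTwoCycles, ← linkSet_openStar B hv]
    refine ⟨removeVertexOp_mem_ellTwoChains hs'.1, ?_⟩
    rw [boundaryOp_removeVertexOp, hs'.2, map_zero, neg_zero]
  · refine mem_ellTwoBoundaries.2 ⟨-(z - b), Submodule.neg_mem _ hd, ?_⟩
    rw [← boundaryOp_eq_of_isClosedIn hc (Submodule.neg_mem _ hd), map_neg, map_sub,
      (mem_ellTwoCycles.1 hz).2, hbB, zero_sub, neg_neg]
  · refine mem_ellTwoBoundaries.2 ⟨b, ellTwoChains_le ?_ _ hs'.1, hbC⟩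
    rw [hsC]
    exact fun σ h => h.2

/-- The sphere is empty: a nonempty simplex has no link of the required dimension. -/
theorem ambientV_zero : AmbientV 0 := by
  intro V _ _ L S A _ _ hS _
  refine ⟨fun k hk i hi => ?_, fun k hk => by omega⟩
  refine homologyVanishes_of_forall_card_ne fun σ hσ => ?_
  rcases hσ.1 with h | h
  · exact absurd (Or.inl h) hσ.2
  · obtain ⟨j, hj, -⟩ := hS.2 σ h
    have := Finset.card_pos.2 (S.nonempty_of_mem h)
    omega

/-- Induction on the number of vertices of the subcomplex B. The relative half of V(2m) for the
links of v in S and in B reduces bounding in the link in B to bounding in the link in S, where III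
or the absolute consequence of V(2m) applies. -/
theorem ambientV_odd {m : ℕ} (hV : AmbientV (2 * m)) (hIII : AmbientIII m) :
    AmbientV (2 * m + 1) := by
  classical
  intro V _ _ L S A hL hSL hS hA
  refine ⟨fun k hk => by omega, fun k hk i hi => ?_⟩
  obtain rfl : k = m := by omega
  clear hk
  have key : ∀ N : ℕ, ∀ B : PreAbstractSimplicialComplex V, IsFullSubcomplex B S →
      (Finset.univ.filter fun v => {v} ∈ B.faces).card = N → ∀ i, k < i →
      HomologyVanishes L (simplices B) i := by
    intro N
    induction N with
    | zero =>
      intro B hB hcard i hi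
      refine homologyVanishes_of_forall_card_ne fun σ hσ => ?_
      rcases hσ with rfl | hσ
      · rw [Finset.card_empty]; omega
      · obtain ⟨x, hx⟩ := B.nonempty_of_mem hσ
        have hx' := Finset.card_eq_zero.1 hcard
        have : x ∈ (∅ : Finset V) := by
          rw [← hx']
          simpa using B.singleton_mem_of_mem hσ hx
        simp at this
    | succ N ih =>
      intro B hB hcard i hi
      obtain ⟨j, rfl⟩ : ∃ j, i = j + 1 := ⟨i - 1, by omega⟩
      obtain ⟨v, hv⟩ := Finset.card_pos.1
        (show 0 < (Finset.univ.filter fun v => {v} ∈ B.faces).card by omega)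
      have hvB : {v} ∈ B.faces := by simpa using hv
      have hvS : {v} ∈ S.faces := hB.1 hvB
      have hSv : IsGHS (link S {v}) (2 * k) := isGHS_link hS hvS
      have hSvf : IsFullSubcomplex (link S {v}) L.toPreAbstractSimplicialComplex :=
        ((hSL.isFlag hL).isFullSubcomplex_link v).trans hSL
      have hVv := fun K => hV V L (link S {v}) K hL hSvf hSv
      refine homologyVanishes_of_deleteVertex (hB.1.trans hSL.1) hvB ?_ ?_
      · refine ih _ ((IsFullSubcomplex.deleteVertex B v).trans hB) ?_ _ hi
        have : (Finset.univ.filter fun w => {w} ∈ (deleteVertex B v).faces) =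
            (Finset.univ.filter fun w => {w} ∈ B.faces).erase v := by
          ext w
          simp [deleteVertex, and_comm, eq_comm]
        rw [this, Finset.card_erase_of_mem hv, hcard]
        rfl
      · intro y hy hyA hyC
        have hKf := hB.link v
        refine mem_closure_boundaries_of_homologyVanishes_sdiff (ordConnected_simplices _)
          (isClosedIn_simplices hKf.1) ((hVv _ hKf).1 k rfl _ hi) hy ?_
        have hyS := ellTwoCycles_mono L hKf.1 j hy
        -- In the middle degree III is needed, and the deletion and cone of B are enlarged to those
        -- of S. Above it the link in S, a sphere of index 2k, has no homology at all.
        rcases (show k ≤ j by omega).eq_or_lt with rfl | hkj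
        · refine hIII V L S v hL hSL hS hvS y hyS ?_ ?_
          · refine Submodule.le_topologicalClosure _ (ellTwoBoundaries_mono L ?_ _ hyA)
            exact fun τ hτ => ⟨hB.1 hτ.1, hτ.2⟩
          · refine Submodule.le_topologicalClosure _ (ellTwoBoundaries_mono L ?_ _ hyC)
            exact fun τ hτ => ⟨hτ.1, simplices_mono hKf.1 hτ.2⟩
        · exact homologyVanishes_simplices_of_sdiff_bot (by omega)
            ((hVv ⊥ (isFullSubcomplex_bot _)).1 k rfl j hkj) hyS
  exact key _ A hA rfl i hi

/-- Induction on the number of vertices of S missing from A. Adding one such vertex v, to obtain B,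
splits the relative complex of (S, A) into the open star of v in B and the relative complex of (S,
B). Degree j+1 on the star reduces to degree j on the link of v in B, which is full in a sphere of
index 2m+1, and j > m. -/
theorem ambientV_even {m : ℕ} (hV : AmbientV (2 * m + 1)) : AmbientV (2 * m + 2) := by
  classical
  intro V _ _ L S A hL hSL hS hA
  refine ⟨fun k hk i hi => ?_, fun k hk => by omega⟩
  obtain rfl : k = m + 1 := by omega
  clear hk
  obtain ⟨j, rfl⟩ : ∃ j, i = j + 1 := ⟨i - 1, by omega⟩
  have key : ∀ N : ℕ, ∀ A : PreAbstractSimplicialComplex V, IsFullSubcomplex A S →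
      (Finset.univ.filter fun v => {v} ∈ S.faces ∧ {v} ∉ A.faces).card = N →
      HomologyVanishes L (simplices S \ simplices A) (j + 1) := by
    intro N
    induction N with
    | zero =>
      intro A hA hcard
      refine homologyVanishes_of_forall_card_ne fun σ hσ => ?_
      exfalso
      rcases hσ.1 with h | h
      · exact hσ.2 (Or.inl h)
      · refine hσ.2 (Or.inr (hA.2 σ h fun s hs => ?_))
        by_contra hsA
        have hx' := Finset.card_eq_zero.1 hcard
        have : s ∈ (∅ : Finset V) := by
          rw [← hx']
          simpa using ⟨S.singleton_mem_of_mem h hs, hsA⟩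
        simp at this
    | succ N ih =>
      intro A hA hcard
      obtain ⟨v, hv⟩ := Finset.card_pos.1
        (show 0 < (Finset.univ.filter fun v => {v} ∈ S.faces ∧ {v} ∉ A.faces).card by omega)
      obtain ⟨hvS, hvA⟩ : {v} ∈ S.faces ∧ {v} ∉ A.faces := by simpa using hv
      -- The full subcomplex of S spanned by v and the vertices of A, so that B - v = A.
      let B : PreAbstractSimplicialComplex V :=
        { faces := {σ | σ ∈ S.faces ∧ ∀ s ∈ σ, s = v ∨ {s} ∈ A.faces}
          isRelLowerSet_faces := fun σ hσ => ⟨S.nonempty_of_mem hσ.1, fun ρ hρ h0 =>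
            ⟨S.down hσ.1 hρ h0, fun s hs => hσ.2 s (hρ hs)⟩⟩ }
      have hB : IsFullSubcomplex B S := by
        refine ⟨fun σ hσ => hσ.1, fun σ hσ hs => ⟨hσ, fun s hs' => ?_⟩⟩
        exact (hs s hs').2 s (Finset.mem_singleton_self s)
      have hvB : {v} ∈ B.faces := ⟨hvS, fun s hs => Or.inl (Finset.mem_singleton.1 hs)⟩
      have hAB : deleteVertex B v = A := by
        apply PreAbstractSimplicialComplex.ext
        ext σ
        constructor
        · rintro ⟨h1, h2⟩
          exact hA.2 σ h1.1 fun s hs => (h1.2 s hs).resolve_left fun h => h2 (h ▸ hs)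
        · intro h
          exact ⟨⟨hA.1 h, fun s hs => Or.inr (A.singleton_mem_of_mem h hs)⟩,
            fun hvσ => hvA (A.singleton_mem_of_mem h hvσ)⟩
      have hG : simplices B \ simplices A = openStar B v := by
        rw [← hAB, simplices_sdiff_deleteVertex]
      have hAB' : A ≤ B := hAB ▸ (IsFullSubcomplex.deleteVertex B v).1
      have hO : (simplices S \ simplices A) \ openStar B v = simplices S \ simplices B := by
        rw [← hG]
        ext σ
        have := @simplices_mono _ _ _ hAB' σ
        simp only [Set.mem_sdiff]
        tauto
      have hc : IsClosedIn (openStar B v) (simplices S \ simplices A) := by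
        rw [← hG]
        exact ⟨fun σ hσ => ⟨simplices_mono hB.1 hσ.1, hσ.2⟩,
          fun σ hσ τ hτ h => ⟨simplices_down B hσ.1 h, hτ.2⟩⟩
      have hVO := ih B hB (by
        refine Eq.trans (congrArg Finset.card ?_)
          ((Finset.card_erase_of_mem hv).trans (by rw [hcard]; rfl))
        ext w
        simp only [Finset.mem_filter, Finset.mem_univ, true_and, Finset.mem_erase]
        show _ ∧ ¬ ({w} ∈ S.faces ∧ ∀ s ∈ ({w} : Finset V), s = v ∨ {s} ∈ A.faces) ↔ _
        simp only [Finset.mem_singleton, forall_eq]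
        tauto)
      refine homologyVanishes_of_isClosedIn (ordConnected_simplices_sdiff S A) hc ?_ ?_
      · intro b hb
        refine mem_closure_boundaries_of_removeVertexOp (fun σ hσ => hσ.1)
          (fun σ hσ s hs => commute_gen_of_mem (hB.1.trans hSL.1) hσ.2 hs hσ.1) hb ?_
        have hb' := mem_ellTwoCycles.1 hb
        have hr : removeVertexOp L v b ∈ ellTwoCycles L (linkSet (openStar B v) v) j := by
          rw [mem_ellTwoCycles]
          refine ⟨removeVertexOp_mem_ellTwoChains hb'.1, ?_⟩
          rw [boundaryOp_removeVertexOp, hb'.2, map_zero, neg_zero]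
        rw [linkSet_openStar B hvB] at hr ⊢
        exact (hV V L (link S {v}) (link B {v}) hL
          (((hSL.isFlag hL).isFullSubcomplex_link v).trans hSL) (isGHS_link hS hvS) (hB.link v)).2
          m rfl j (by omega) hr
      · intro z hz
        have := restrictOp_mem_ellTwoCycles hc hz
        rw [hO] at this ⊢
        exact hVO this
  exact key _ A hA rfl

theorem ambientV_of_forall_ambientIII {k : ℕ} (hIII : ∀ m < k, AmbientIII m) :
    ∀ n ≤ 2 * k, AmbientV n := by
  have key : ∀ m ≤ k, AmbientV (2 * m) := by
    intro m
    induction m with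
    | zero => exact fun _ => ambientV_zero
    | succ m ih => exact fun hm => ambientV_even (ambientV_odd (ih (by omega)) (hIII m (by omega)))
  intro n hn
  rcases Nat.even_or_odd' n with ⟨m, rfl | rfl⟩
  · exact key m (by omega)
  · exact ambientV_odd (key m (by omega)) (hIII m (by omega))

/-- A harmonic cycle that is a limit of boundaries is orthogonal to itself. -/
theorem harmonicCycles_eq_bot {F : Set (Finset V)} {i : ℕ} (h : HomologyVanishes L F i) :
    harmonicCycles L F i = ⊥ := by
  refine (Submodule.eq_bot_iff _).2 fun c hc => ?_
  have h1 : c ∈ (ellTwoBoundaries L F i).topologicalClosure := h hc.1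
  have h2 : c ∈ (ellTwoBoundaries L F i).topologicalClosureᗮ := by
    rw [Submodule.orthogonal_closure]; exact hc.2
  exact inner_self_eq_zero.1 ((Submodule.mem_orthogonal _ _).1 h2 c h1)

theorem statementV_of_ambientV {n : ℕ} (h : AmbientV n) : StatementV n := by
  intro V _ _ S A hfl hS hA
  have h1 := h V S S.toPreAbstractSimplicialComplex A hfl ⟨le_rfl, fun _ h _ => h⟩ hS hA
  refine ⟨fun k hk i hi => ?_, fun k hk i hi => ?_⟩
  · rw [ellTwoBettiRel, harmonicCycles_eq_bot (h1.1 k hk i hi), vonNeumannDim_bot]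
  · rw [ellTwoBetti, harmonicCycles_eq_bot (h1.2 k hk i hi), vonNeumannDim_bot]

end Vanishing

/-! ### Rational homology -/

section RationalHomology

theorem finrank_quotient_eq_of_map {E E' : Type*} [AddCommGroup E] [Module ℚ E] [AddCommGroup E']
    [Module ℚ E'] (φ : E →ₗ[ℚ] E') {Z B : Submodule ℚ E} {Z' B' : Submodule ℚ E'}
    (hZ : ∀ z ∈ Z, φ z ∈ Z') (hB : ∀ b ∈ B, φ b ∈ B')
    (hs : ∀ z' ∈ Z', ∃ z ∈ Z, φ z = z') (hi : ∀ z ∈ Z, φ z ∈ B' → z ∈ B) :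
    Module.finrank ℚ (Z ⧸ B.submoduleOf Z) = Module.finrank ℚ (Z' ⧸ B'.submoduleOf Z') := by
  let ψ : (Z ⧸ B.submoduleOf Z) →ₗ[ℚ] (Z' ⧸ B'.submoduleOf Z') :=
    Submodule.mapQ _ _ (φ.restrict hZ) (fun z hz => hB _ hz)
  refine (LinearEquiv.ofBijective ψ ⟨?_, ?_⟩).finrank_eq
  · rw [← LinearMap.ker_eq_bot, LinearMap.ker_eq_bot']
    intro x hx
    obtain ⟨z, rfl⟩ := Submodule.Quotient.mk_surjective _ x
    refine (Submodule.Quotient.mk_eq_zero _).2 (hi z z.2 ?_)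
    exact (Submodule.Quotient.mk_eq_zero (B'.submoduleOf Z') (x := φ.restrict hZ z)).1 hx
  · intro x
    obtain ⟨z', rfl⟩ := Submodule.Quotient.mk_surjective _ x
    obtain ⟨z, hz, hzz⟩ := hs z' z'.2
    exact ⟨Submodule.Quotient.mk ⟨z, hz⟩, congrArg Submodule.Quotient.mk (Subtype.ext hzz)⟩

variable {V : Type} [Fintype V] [LinearOrder V]

theorem mem_rationalCycles {F : Set (Finset V)} {m : ℕ} {f : Finset V → ℚ} :
    f ∈ rationalCycles F m ↔ f ∈ rationalChains F m ∧ simplicialBoundary ℚ F f = 0 := Iff.rfl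

theorem mem_rationalBoundaries {F : Set (Finset V)} {m : ℕ} {f : Finset V → ℚ} :
    f ∈ rationalBoundaries F m ↔ ∃ y ∈ rationalChains F (m + 1), simplicialBoundary ℚ F y = f :=
  Iff.rfl

theorem rationalChains_supp {F : Set (Finset V)} {m : ℕ} {f : Finset V → ℚ}
    (hf : f ∈ rationalChains F m) (σ : Finset V) (h : σ ∉ F) : f σ = 0 :=
  hf σ fun h' => h h'.1

/-- All rational homology of the augmented chain complex on `F` vanishes. -/
def IsRationallyAcyclic (F : Set (Finset V)) : Prop :=
  ∀ m, rationalCycles F m ≤ rationalBoundaries F m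

theorem rationalBetti_eq_zero {F : Set (Finset V)} {m : ℕ}
    (h : rationalCycles F m ≤ rationalBoundaries F m) : rationalBetti F m = 0 := by
  rw [rationalBetti, Submodule.submoduleOf_eq_top.2 h]
  have : Subsingleton (rationalCycles F m ⧸ (⊤ : Submodule ℚ (rationalCycles F m))) :=
    Submodule.Quotient.subsingleton_iff.2 rfl
  exact Module.finrank_zero_of_subsingleton

theorem isRationallyAcyclic_iff {F : Set (Finset V)} :
    IsRationallyAcyclic F ↔ ∀ m, rationalBetti F m = 0 := by
  refine ⟨fun h m => rationalBetti_eq_zero (h m), fun h m => ?_⟩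
  have h1 := Module.finrank_zero_iff.1 (h m)
  have h2 := Submodule.Quotient.subsingleton_iff.1 h1
  exact Submodule.submoduleOf_eq_top.1 h2

theorem simplicialBoundary_mem_rationalChains {F : Set (Finset V)} {m : ℕ} {f : Finset V → ℚ}
    (hf : f ∈ rationalChains F (m + 1)) : simplicialBoundary ℚ F f ∈ rationalChains F m := by
  intro τ hτ
  by_cases hF : τ ∈ F
  · rw [simplicialBoundary_of_mem hF, Finset.sum_eq_zero]
    intro s hs
    rw [hf, smul_zero]
    rintro ⟨_, h⟩
    rw [Finset.card_insert_of_notMem (by simpa using hs)] at h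
    exact hτ ⟨hF, by omega⟩
  · rw [simplicialBoundary_of_notMem hF]

theorem simplicialBoundary_of_rationalChains_zero {F : Set (Finset V)} {f : Finset V → ℚ}
    (hf : f ∈ rationalChains F 0) : simplicialBoundary ℚ F f = 0 := by
  funext τ
  by_cases hF : τ ∈ F
  · rw [simplicialBoundary_of_mem hF, Finset.sum_eq_zero]
    · rfl
    intro s hs
    rw [hf, smul_zero]
    rintro ⟨_, h⟩
    rw [Finset.card_insert_of_notMem (by simpa using hs)] at h
    omega
  · rw [simplicialBoundary_of_notMem hF]; rfl

theorem rationalChains_le {G F : Set (Finset V)} (h : G ⊆ F) (m : ℕ) :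
    rationalChains G m ≤ rationalChains F m :=
  fun _ hf σ hσ => hf σ fun hG => hσ ⟨h hG.1, hG.2⟩

theorem restrictTo_mem_rationalChains {F O : Set (Finset V)} {m : ℕ} {f : Finset V → ℚ}
    (hf : f ∈ rationalChains F m) : restrictTo ℚ O f ∈ rationalChains O m := by
  intro σ hσ
  by_cases hO : σ ∈ O
  · rw [restrictTo_of_mem hO]
    exact hf σ fun h => hσ ⟨hO, h.2⟩
  · exact restrictTo_of_notMem hO f

theorem restrictTo_eq_self {O : Set (Finset V)} {m : ℕ} {f : Finset V → ℚ}
    (hf : f ∈ rationalChains O m) : restrictTo ℚ O f = f := by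
  funext σ
  by_cases hO : σ ∈ O
  · rw [restrictTo_of_mem hO]
  · rw [restrictTo_of_notMem hO, rationalChains_supp hf σ hO]

theorem mem_rationalChains_of_restrictTo_eq_zero {G F : Set (Finset V)} {m : ℕ}
    {f : Finset V → ℚ} (hf : f ∈ rationalChains F m) (h : restrictTo ℚ (F \ G) f = 0) :
    f ∈ rationalChains G m := by
  intro σ hσ
  by_cases hF : σ ∈ F \ G
  · rw [← restrictTo_of_mem (R := ℚ) hF f, h]; rfl
  · exact hf σ fun h => hF ⟨h.1, fun hG => hσ ⟨hG, h.2⟩⟩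

/-- Discarding an acyclic subcomplex does not change homology: a relative cycle lifts after
correction by a chain of G filling its boundary, and a relative boundary lifts in the same way. -/
theorem rationalBetti_sdiff {G F : Set (Finset V)} (hF : F.OrdConnected) (h : IsClosedIn G F)
    (hG : IsRationallyAcyclic G) (m : ℕ) : rationalBetti F m = rationalBetti (F \ G) m := by
  have hbb : ∀ {m f}, f ∈ rationalChains F m →
      simplicialBoundary ℚ F (simplicialBoundary ℚ F f) = 0 :=
    fun hf => simplicialBoundary_boundary hF (rationalChains_supp hf)
  have hGF : ∀ {m f}, f ∈ rationalChains G m →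
      simplicialBoundary ℚ F f = simplicialBoundary ℚ G f :=
    fun hf => simplicialBoundary_eq_of_isClosedIn h (rationalChains_supp hf)
  have hr : ∀ {m f}, f ∈ rationalChains F m → simplicialBoundary ℚ (F \ G)
      (restrictTo ℚ (F \ G) f) = restrictTo ℚ (F \ G) (simplicialBoundary ℚ F f) :=
    fun hf => simplicialBoundary_restrictTo h (rationalChains_supp hf)
  refine finrank_quotient_eq_of_map (restrictTo ℚ (F \ G)) ?_ ?_ ?_ ?_
  · intro z hz
    rw [mem_rationalCycles] at hz ⊢
    exact ⟨restrictTo_mem_rationalChains hz.1, by rw [hr hz.1, hz.2, map_zero]⟩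
  · intro b hb
    obtain ⟨y, hy, rfl⟩ := mem_rationalBoundaries.1 hb
    exact mem_rationalBoundaries.2 ⟨_, restrictTo_mem_rationalChains hy, hr hy⟩
  · intro z' hz'
    rw [mem_rationalCycles] at hz'
    have hzF := rationalChains_le (F := F) Set.sdiff_subset _ hz'.1
    -- In degree 0, that of the empty simplex, chains have no boundary and there is no lower degree
    -- in which to use acyclicity of G.
    cases m with
    | zero => exact ⟨z', mem_rationalCycles.2
        ⟨hzF, simplicialBoundary_of_rationalChains_zero hzF⟩, restrictTo_eq_self hz'.1⟩
    | succ m =>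
      have he : simplicialBoundary ℚ F z' ∈ rationalChains G m := by
        refine mem_rationalChains_of_restrictTo_eq_zero
          (simplicialBoundary_mem_rationalChains hzF) ?_
        rw [← hr hzF, restrictTo_eq_self hz'.1, hz'.2]
      obtain ⟨y, hy, hye⟩ := mem_rationalBoundaries.1 (hG m (mem_rationalCycles.2
        ⟨he, by rw [← hGF he, hbb hzF]⟩))
      have hyF := rationalChains_le h.1 _ hy
      refine ⟨z' - y, mem_rationalCycles.2 ⟨Submodule.sub_mem _ hzF hyF, ?_⟩, ?_⟩
      · rw [map_sub, hGF hy, hye, sub_self]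
      · rw [map_sub, restrictTo_eq_self hz'.1, sub_eq_self]
        funext σ
        by_cases hσ : σ ∈ F \ G
        · rw [restrictTo_of_mem hσ, rationalChains_supp hy σ hσ.2]; rfl
        · rw [restrictTo_of_notMem hσ]; rfl
  · intro z hz hzO
    rw [mem_rationalCycles] at hz
    obtain ⟨y, hy, hyz⟩ := mem_rationalBoundaries.1 hzO
    have hyF := rationalChains_le (F := F) Set.sdiff_subset _ hy
    have hd : z - simplicialBoundary ℚ F y ∈ rationalChains G m := by
      refine mem_rationalChains_of_restrictTo_eq_zero
        (Submodule.sub_mem _ hz.1 (simplicialBoundary_mem_rationalChains hyF)) ?_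
      rw [map_sub, ← hr hyF, restrictTo_eq_self hy, hyz, sub_self]
    obtain ⟨w, hw, hwd⟩ := mem_rationalBoundaries.1 (hG m (mem_rationalCycles.2
      ⟨hd, by rw [← hGF hd, map_sub, hz.2, hbb hyF, sub_self]⟩))
    refine mem_rationalBoundaries.2 ⟨w + y, Submodule.add_mem _ (rationalChains_le h.1 _ hw) hyF, ?_⟩
    rw [map_add, hGF hw, hwd, sub_add_cancel]

theorem simplicialBoundary_apply_of_star {F : Set (Finset V)} {p : V} {f : Finset V → ℚ}
    {τ : Finset V} (hτ : τ ∈ F) (hp : p ∉ τ) (hf : ∀ σ, p ∉ σ → f σ = 0) :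
    simplicialBoundary ℚ F f τ = incidence ℚ τ p • f (insert p τ) := by
  rw [simplicialBoundary_of_mem hτ, Finset.sum_eq_single p]
  · intro s _ hs
    rw [hf, smul_zero]
    simp [hp, Ne.symm hs]
  · simp [hp]

/-- Subtracting the boundary of the cone on z leaves a cycle w supported on simplices containing p.
The coefficient of ∂w at such a simplex with p removed is ± the coefficient of w, so w = 0. -/
theorem isRationallyAcyclic_of_cone {F : Set (Finset V)} (hF : F.OrdConnected) (p : V)
    (hp : ∀ σ, σ ∈ F ↔ σ.erase p ∈ F) : IsRationallyAcyclic F := by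
  intro m z hz
  rw [mem_rationalCycles] at hz
  set y := joinVertex ℚ p z with hy
  have hyc : y ∈ rationalChains F (m + 1) := by
    intro σ hσ
    by_cases h : p ∈ σ
    · rw [hy, joinVertex_of_mem h, hz.1, smul_zero]
      rintro ⟨h1, h2⟩
      rw [Finset.card_erase_of_mem h] at h2
      have := Finset.card_pos.2 ⟨p, h⟩
      exact hσ ⟨(hp σ).2 h1, by omega⟩
    · exact joinVertex_of_notMem h _
  refine mem_rationalBoundaries.2 ⟨y, hyc, ?_⟩
  set w := z - simplicialBoundary ℚ F y with hw
  have hwc : w ∈ rationalChains F m :=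
    Submodule.sub_mem _ hz.1 (simplicialBoundary_mem_rationalChains hyc)
  have hw0 : ∀ σ, p ∉ σ → w σ = 0 := by
    intro τ hτ
    by_cases hF : τ ∈ F
    · rw [hw, Pi.sub_apply, simplicialBoundary_apply_of_star hF hτ
        (fun σ hσ => joinVertex_of_notMem hσ _),
        joinVertex_of_mem (Finset.mem_insert_self _ _), Finset.erase_insert hτ, smul_smul,
        incidence_mul_self, one_smul, sub_self]
    · exact rationalChains_supp hwc τ hF
  have hwb : simplicialBoundary ℚ F w = 0 := by
    rw [hw, map_sub, hz.2, simplicialBoundary_boundary hF (rationalChains_supp hyc), sub_self]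
  have : w = 0 := by
    funext σ
    by_cases h : p ∈ σ
    · by_cases hσ : σ ∈ F
      · have h1 := congrFun hwb (σ.erase p)
        rw [simplicialBoundary_apply_of_star ((hp σ).1 hσ) (Finset.notMem_erase _ _) hw0,
          Finset.insert_erase h] at h1
        have h2 := congrArg (incidence ℚ (σ.erase p) p • ·) h1
        simp only [smul_smul, incidence_mul_self, one_smul] at h2
        simpa using h2
      · exact rationalChains_supp hwc σ hσ
    · exact hw0 σ h
  exact (sub_eq_zero.1 this).symm

theorem joinVertex_mem_rationalChains {F : Set (Finset V)} {p : V} {m : ℕ} {f : Finset V → ℚ}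
    (hf : f ∈ rationalChains (linkSet F p) m) : joinVertex ℚ p f ∈ rationalChains F (m + 1) := by
  intro σ hσ
  by_cases h : p ∈ σ
  · rw [joinVertex_of_mem h, hf, smul_zero]
    rintro ⟨h1, h2⟩
    rw [Finset.card_erase_of_mem h] at h2
    have := Finset.card_pos.2 ⟨p, h⟩
    have h3 := h1.2
    rw [Finset.insert_erase h] at h3
    exact hσ ⟨h3, by omega⟩
  · exact joinVertex_of_notMem h _

theorem removeVertex_mem_rationalChains {F : Set (Finset V)} {p : V} {m : ℕ} {f : Finset V → ℚ}
    (hf : f ∈ rationalChains F (m + 1)) : removeVertex ℚ p f ∈ rationalChains (linkSet F p) m := by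
  intro τ hτ
  by_cases hv : p ∈ τ
  · exact removeVertex_of_mem hv _
  · rw [removeVertex_of_notMem hv, hf, smul_zero]
    rintro ⟨h1, h2⟩
    rw [Finset.card_insert_of_notMem hv] at h2
    exact hτ ⟨⟨hv, h1⟩, by omega⟩

/-- Removal of p is invertible by joining with p and commutes with the boundary up to sign. -/
theorem rationalBetti_star {F : Set (Finset V)} {p : V} (hp : ∀ σ ∈ F, p ∈ σ) (m : ℕ) :
    rationalBetti F (m + 1) = rationalBetti (linkSet F p) m := by
  have hb : ∀ f : Finset V → ℚ, f ∈ rationalChains (linkSet F p) m →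
      removeVertex ℚ p (joinVertex ℚ p f) = f := fun f hf =>
    removeVertex_joinVertex fun σ hσ => rationalChains_supp hf σ fun h => h.1 hσ
  have hbj : ∀ {m} {f : Finset V → ℚ}, f ∈ rationalChains (linkSet F p) m →
      simplicialBoundary ℚ F (joinVertex ℚ p f) =
        - joinVertex ℚ p (simplicialBoundary ℚ (linkSet F p) f) := by
    intro m f hf
    have h1 := simplicialBoundary_removeVertex (R := ℚ) (F := F) p (joinVertex ℚ p f)
    rw [removeVertex_joinVertex (fun σ hσ => rationalChains_supp hf σ fun h => h.1 hσ)] at h1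
    rw [h1, map_neg, neg_neg, joinVertex_removeVertex]
    intro σ hσ
    exact simplicialBoundary_of_notMem (fun h => hσ (hp σ h)) _
  refine finrank_quotient_eq_of_map (removeVertex ℚ p) ?_ ?_ ?_ ?_
  · intro z hz
    rw [mem_rationalCycles] at hz ⊢
    exact ⟨removeVertex_mem_rationalChains hz.1,
      by rw [simplicialBoundary_removeVertex, hz.2, map_zero, neg_zero]⟩
  · intro b hb
    obtain ⟨y, hy, rfl⟩ := mem_rationalBoundaries.1 hb
    refine mem_rationalBoundaries.2 ⟨- removeVertex ℚ p y,
      Submodule.neg_mem _ (removeVertex_mem_rationalChains hy), ?_⟩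
    rw [map_neg, simplicialBoundary_removeVertex, neg_neg]
  · intro z hz
    rw [mem_rationalCycles] at hz
    refine ⟨joinVertex ℚ p z, mem_rationalCycles.2 ⟨joinVertex_mem_rationalChains hz.1, ?_⟩,
      hb z hz.1⟩
    rw [hbj hz.1, hz.2, map_zero, neg_zero]
  · intro z hz hzr
    obtain ⟨y, hy, hyz⟩ := mem_rationalBoundaries.1 hzr
    refine mem_rationalBoundaries.2 ⟨- joinVertex ℚ p y,
      Submodule.neg_mem _ (joinVertex_mem_rationalChains hy), ?_⟩
    rw [map_neg, hbj hy, neg_neg, hyz, joinVertex_removeVertex]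
    exact fun σ hσ => rationalChains_supp hz.1 σ fun h => hσ (hp σ h)

theorem rationalBetti_zero_of_empty_notMem {F : Set (Finset V)} (h : ∅ ∉ F) :
    rationalBetti F 0 = 0 := by
  refine rationalBetti_eq_zero fun z hz => ?_
  have : z = 0 := by
    funext σ
    refine hz.1 σ fun hσ => h ?_
    rw [← Finset.card_eq_zero.1 hσ.2]
    exact hσ.1
  rw [this]
  exact Submodule.zero_mem _

/-- If the simplices of `F` without the vertex `p` are acyclic, then the homology of `F` is that of
the link of `p`, shifted by one. -/
theorem rationalBetti_succ_of_acyclic {F : Set (Finset V)} (hF : F.OrdConnected) (p : V)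
    (hp : IsRationallyAcyclic {σ | σ ∈ F ∧ p ∉ σ}) (m : ℕ) :
    rationalBetti F (m + 1) = rationalBetti (linkSet F p) m := by
  have hc : IsClosedIn {σ | σ ∈ F ∧ p ∉ σ} F :=
    ⟨fun σ h => h.1, fun σ hσ τ hτ h => ⟨hτ, fun hpτ => hσ.2 (h hpτ)⟩⟩
  rw [rationalBetti_sdiff hF hc hp, rationalBetti_star (p := p)]
  · congr 1
    ext τ
    simp [linkSet]
  · intro σ hσ
    by_contra h
    exact hσ.2 ⟨hσ.1, h⟩

theorem rationalBetti_zero_of_acyclic {F : Set (Finset V)} (hF : F.OrdConnected) (p : V)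
    (hp : IsRationallyAcyclic {σ | σ ∈ F ∧ p ∉ σ}) : rationalBetti F 0 = 0 := by
  have hc : IsClosedIn {σ | σ ∈ F ∧ p ∉ σ} F :=
    ⟨fun σ h => h.1, fun σ hσ τ hτ h => ⟨hτ, fun hpτ => hσ.2 (h hpτ)⟩⟩
  rw [rationalBetti_sdiff hF hc hp]
  refine rationalBetti_zero_of_empty_notMem fun h => h.2 ⟨h.1, Finset.notMem_empty p⟩

theorem isRationallyAcyclic_of_deletion_of_link {F : Set (Finset V)} (hF : F.OrdConnected) (p : V)
    (hp : IsRationallyAcyclic {σ | σ ∈ F ∧ p ∉ σ}) (hl : IsRationallyAcyclic (linkSet F p)) :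
    IsRationallyAcyclic F := by
  rw [isRationallyAcyclic_iff] at hl ⊢
  intro m
  cases m with
  | zero => exact rationalBetti_zero_of_acyclic hF p hp
  | succ m => rw [rationalBetti_succ_of_acyclic hF p hp, hl]

/-- Unused elements of the vertex type do not affect homology. This moves a sphere to its own set of
vertices and identifies the join with the empty complex. -/
theorem rationalBetti_map {U : Type} [Fintype U] [LinearOrder U] (ι : U ↪o V)
    {F : Set (Finset V)} (hF : ∀ σ ∈ F, ∀ s ∈ σ, s ∈ Set.range ι) (m : ℕ) :
    rationalBetti F m =
      rationalBetti ((fun τ : Finset U => τ.map ι.toEmbedding) ⁻¹' F) m := by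
  let φ : (Finset V → ℚ) →ₗ[ℚ] (Finset U → ℚ) := LinearMap.funLeft ℚ ℚ
    (fun τ : Finset U => τ.map ι.toEmbedding)
  have hφ : ∀ f τ, φ f τ = f (τ.map ι.toEmbedding) := fun _ _ => rfl
  have hinj : Function.Injective (fun τ : Finset U => τ.map ι.toEmbedding) :=
    Finset.map_injective _
  have hsurj : ∀ σ ∈ F, ∃ τ : Finset U, τ.map ι.toEmbedding = σ := by
    intro σ hσ
    refine ⟨Finset.univ.filter fun s => ι s ∈ σ, ?_⟩
    ext t
    simp only [Finset.mem_map, Finset.mem_filter, Finset.mem_univ, true_and]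
    constructor
    · rintro ⟨s, hs, rfl⟩; exact hs
    · intro ht
      obtain ⟨s, rfl⟩ := hF σ hσ t ht
      exact ⟨s, ht, rfl⟩
  have hb : ∀ {m f}, f ∈ rationalChains F m → simplicialBoundary ℚ
      ((fun τ : Finset U => τ.map ι.toEmbedding) ⁻¹' F) (φ f) = φ (simplicialBoundary ℚ F f) :=
    fun hf => funext fun τ => simplicialBoundary_map ι hF (rationalChains_supp hf) τ
  have hc : ∀ {m f}, f ∈ rationalChains F m →
      φ f ∈ rationalChains ((fun τ : Finset U => τ.map ι.toEmbedding) ⁻¹' F) m := by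
    intro m f hf τ hτ
    refine hf _ fun h => hτ ⟨h.1, ?_⟩
    rw [← h.2, Finset.card_map]
  have hext : ∀ m f, f ∈ rationalChains ((fun τ : Finset U => τ.map ι.toEmbedding) ⁻¹' F) m →
      ∃ f' ∈ rationalChains F m, φ f' = f := by
    intro m f hf
    refine ⟨Function.extend (fun τ : Finset U => τ.map ι.toEmbedding) f 0, ?_, ?_⟩
    · intro σ hσ
      by_cases h : ∃ τ : Finset U, τ.map ι.toEmbedding = σ
      · obtain ⟨τ, rfl⟩ := h
        rw [hinj.extend_apply]
        refine hf τ fun h => hσ ⟨h.1, ?_⟩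
        rw [Finset.card_map]; exact h.2
      · rw [Function.extend_apply' _ _ _ h]; rfl
    · funext τ
      rw [hφ, hinj.extend_apply]
  have hφinj : ∀ {m f}, f ∈ rationalChains F m → φ f = 0 → f = 0 := by
    intro m f hf h
    funext σ
    by_cases hσ : σ ∈ F
    · obtain ⟨τ, rfl⟩ := hsurj σ hσ
      exact congrFun h τ
    · exact rationalChains_supp hf σ hσ
  refine finrank_quotient_eq_of_map φ ?_ ?_ ?_ ?_
  · intro z hz
    rw [mem_rationalCycles] at hz ⊢
    exact ⟨hc hz.1, by rw [hb hz.1, hz.2, map_zero]⟩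
  · intro b hb'
    obtain ⟨y, hy, rfl⟩ := mem_rationalBoundaries.1 hb'
    exact mem_rationalBoundaries.2 ⟨φ y, hc hy, hb hy⟩
  · intro z' hz'
    rw [mem_rationalCycles] at hz'
    obtain ⟨z, hz, rfl⟩ := hext m z' hz'.1
    refine ⟨z, mem_rationalCycles.2 ⟨hz, ?_⟩, rfl⟩
    have h1 := hz'.2
    rw [hb hz] at h1
    cases m with
    | zero => exact simplicialBoundary_of_rationalChains_zero hz
    | succ m => exact hφinj (simplicialBoundary_mem_rationalChains hz) h1
  · intro z hz hzB
    rw [mem_rationalCycles] at hz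
    obtain ⟨y', hy', hyz⟩ := mem_rationalBoundaries.1 hzB
    obtain ⟨y, hy, rfl⟩ := hext _ y' hy'
    refine mem_rationalBoundaries.2 ⟨y, hy, ?_⟩
    rw [hb hy] at hyz
    refine sub_eq_zero.1 (hφinj (Submodule.sub_mem _
      (simplicialBoundary_mem_rationalChains hy) hz.1) ?_)
    rw [map_sub, hyz, sub_self]

/-! ### Vertex deletions in homology spheres are homology disks -/

theorem isRationallyAcyclic_simplices_cone (v : V) (K : PreAbstractSimplicialComplex V) :
    IsRationallyAcyclic (simplices (cone v K)) := by
  refine isRationallyAcyclic_of_cone (ordConnected_simplices _) v fun σ => ?_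
  rw [mem_simplices_cone, mem_simplices_cone, Finset.erase_idem]

/-- Excision: the pair of deletion and link has the same relative simplices as X modulo the cone on
the link, and the cone is acyclic. -/
theorem HasHomologyOfSphere.hasHomologyOfDisk {X : PreAbstractSimplicialComplex V} {n : ℕ}
    (h : HasHomologyOfSphere X n) {v : V} (hv : {v} ∈ X.faces) :
    HasHomologyOfDisk (deleteVertex X v) (link X {v}) n := by
  have hle : cone v (link X {v}) ≤ X := by
    rintro σ ⟨h0, hσ⟩
    rw [mem_simplices_link hv] at hσ
    exact X.down hσ.2 (fun x hx => by
      by_cases hxv : x = v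
      · simp [hxv]
      · simp [hx, hxv]) h0
  have hs : simplices (deleteVertex X v) \ simplices (link X {v}) =
      simplices X \ simplices (cone v (link X {v})) := by
    ext σ
    simp only [Set.mem_sdiff]
    rw [mem_simplices_cone, mem_simplices_link hv, mem_simplices_link hv, mem_simplices,
      mem_simplices]
    rcases σ.eq_empty_or_nonempty with rfl | h0
    · simp [hv]
    · simp only [h0.ne_empty, false_or]
      show (σ ∈ X.faces ∧ v ∉ σ) ∧ _ ↔ _
      constructor
      · rintro ⟨⟨h1, h2⟩, h3⟩
        rw [Finset.erase_eq_of_notMem h2]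
        exact ⟨h1, h3⟩
      · rintro ⟨h1, h3⟩
        have hvσ : v ∉ σ := fun hvσ => h3 ⟨Finset.notMem_erase _ _, by
          rwa [Finset.insert_erase hvσ]⟩
        rw [Finset.erase_eq_of_notMem hvσ] at h3
        exact ⟨⟨h1, hvσ⟩, h3⟩
  intro m
  rw [hs, ← rationalBetti_sdiff (ordConnected_simplices X) (isClosedIn_simplices hle)
    (isRationallyAcyclic_simplices_cone _ _)]
  exact h m

/-- For σ outside the link of v, deleting v does not change the link of σ. For σ in the link of v,
the link of σ in S is a homology sphere with v as a vertex, and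
`HasHomologyOfSphere.hasHomologyOfDisk` applies to it since links and deletions commute. Thus the
disk hypothesis of III is automatic. -/
theorem IsGHS.isGHD {S : PreAbstractSimplicialComplex V} {n : ℕ} (hS : IsGHS S n) {v : V}
    (hv : {v} ∈ S.faces) : IsGHD (deleteVertex S v) (link S {v}) n := by
  refine ⟨link_le_deleteVertex S v, hS.1.hasHomologyOfDisk hv, ?_, ?_⟩
  · intro σ hσ hσl
    obtain ⟨j, hj, h⟩ := hS.2 σ hσ.1
    refine ⟨j, hj, ?_⟩
    have : link (deleteVertex S v) σ = link S σ := by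
      apply PreAbstractSimplicialComplex.ext
      ext τ
      show (τ.Nonempty ∧ Disjoint τ σ ∧ τ ∪ σ ∈ S.faces ∧ v ∉ τ ∪ σ) ↔
        (τ.Nonempty ∧ Disjoint τ σ ∧ τ ∪ σ ∈ S.faces)
      refine and_congr_right fun _ => and_congr_right fun _ => and_iff_left_of_imp fun h1 h2 => ?_
      refine hσl (mem_link_singleton.2 ⟨S.nonempty_of_mem hσ.1, hσ.2, ?_⟩)
      exact S.down h1 (Finset.insert_subset h2 Finset.subset_union_right)
        (Finset.insert_nonempty _ _)
    rwa [this]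
  · intro σ hσ
    obtain ⟨h0, hvσ, hins⟩ := mem_link_singleton.1 hσ
    obtain ⟨j, hj, h⟩ := hS.2 σ (S.down hins (Finset.subset_insert _ _) h0)
    refine ⟨j, hj, ?_⟩
    have hv' : {v} ∈ (link S σ).faces :=
      ⟨Finset.singleton_nonempty v, Finset.disjoint_singleton_left.2 hvσ, by
        rwa [Finset.singleton_union]⟩
    have h1 : link (deleteVertex S v) σ = deleteVertex (link S σ) v := by
      apply PreAbstractSimplicialComplex.ext
      ext τ
      show (τ.Nonempty ∧ Disjoint τ σ ∧ τ ∪ σ ∈ S.faces ∧ v ∉ τ ∪ σ) ↔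
        ((τ.Nonempty ∧ Disjoint τ σ ∧ τ ∪ σ ∈ S.faces) ∧ v ∉ τ)
      rw [Finset.mem_union]
      tauto
    have h2 : link (link S {v}) σ = link (link S σ) {v} := by
      rw [link_link S _ (Finset.disjoint_singleton_right.2 hvσ),
        link_link S _ (Finset.disjoint_singleton_left.2 hvσ), Finset.union_comm]
    rw [h1, h2]
    exact h.hasHomologyOfDisk hv'

end RationalHomology

/-! ### Harmonic chains -/

section Harmonic

variable {V : Type} [Fintype V] [LinearOrder V] {L : AbstractSimplicialComplex V}

variable (L) in
open Classical in
/-- Twice the coboundary operator, on the cubes with type in `F`. -/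
def coboundaryOp (F : Set (Finset V)) : ChainSpace L →L[ℝ] ChainSpace L :=
  EllTwoPow.pi fun σ => if σ ∈ F then
    ∑ s ∈ σ, incidence ℝ (σ.erase s) s • (EllTwoPow.coord (σ.erase s) ∘L antisymOp L s) else 0

theorem coboundaryOp_of_mem {F : Set (Finset V)} {σ : Finset V} (h : σ ∈ F) (c : ChainSpace L) :
    coboundaryOp L F c σ = ∑ s ∈ σ, incidence ℝ (σ.erase s) s • antisymOp L s c (σ.erase s) := by
  simp [coboundaryOp, h]

theorem coboundaryOp_of_notMem {F : Set (Finset V)} {σ : Finset V} (h : σ ∉ F)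
    (c : ChainSpace L) : coboundaryOp L F c σ = 0 := by
  simp [coboundaryOp, h]

theorem coboundaryOp_apply_of_mem {F : Set (Finset V)} {σ : Finset V} (h : σ ∈ F)
    (c : ChainSpace L) (g : RACG L) : coboundaryOp L F c σ g =
      ∑ s ∈ σ, incidence ℝ (σ.erase s) s *
        (c (σ.erase s) g - c (σ.erase s) (g * gen L s)) := by
  rw [coboundaryOp_of_mem h]
  exact map_sum (EllTwo.eval g) _ _

theorem sum_notMem_insert_eq_sum_mem_erase (φ : Finset V → V → Finset V → ℝ) :
    ∑ τ : Finset V, ∑ s with s ∉ τ, φ τ s (insert s τ) =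
      ∑ σ : Finset V, ∑ s ∈ σ, φ (σ.erase s) s σ := by
  rw [Finset.sum_sigma', Finset.sum_sigma']
  refine Finset.sum_bij' (fun x _ => ⟨insert x.2 x.1, x.2⟩) (fun x _ => ⟨x.1.erase x.2, x.2⟩)
    ?_ ?_ ?_ ?_ ?_
  · rintro ⟨τ, s⟩ _
    simp
  · rintro ⟨τ, s⟩ _
    simp
  · rintro ⟨τ, s⟩ h
    simp only [Finset.mem_sigma, Finset.mem_filter, Finset.mem_univ, true_and] at h
    simp [Finset.erase_insert h]
  · rintro ⟨σ, s⟩ h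
    simp only [Finset.mem_sigma, Finset.mem_univ, true_and] at h
    simp [Finset.insert_erase h]
  · rintro ⟨τ, s⟩ h
    simp only [Finset.mem_sigma, Finset.mem_filter, Finset.mem_univ, true_and] at h
    simp [Finset.erase_insert h]

theorem inner_antisymOp {F : Set (Finset V)} {i : ℕ} {y : ChainSpace L}
    (hy : y ∈ ellTwoChains L F i) (c : ChainSpace L) {σ : Finset V} {s : V} (hs : s ∈ σ)
    (τ : Finset V) : inner ℝ (y σ) (antisymOp L s c τ) = 2 * inner ℝ (y σ) (c τ) := by
  have h1 : antisymOp L s c τ = c τ - rightTranslation L (gen L s) c τ := rfl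
  have h2 : inner ℝ (y σ) (rightTranslation L (gen L s) c τ) = - inner ℝ (y σ) (c τ) := by
    rw [EllTwo.inner_eq, EllTwo.inner_eq, ← tsum_neg, ← (Equiv.mulRight (gen L s)).tsum_eq]
    refine tsum_congr fun g => ?_
    rw [Equiv.coe_mulRight, rightTranslation_apply, gen_mul_gen_cancel_right, hy.2 σ s hs, neg_mul]
  rw [h1, inner_sub_right, h2]
  ring

/-- Summation by parts; the factor 2 is that of `antisymOp`, which keeps `coboundaryOp` inside the
antisymmetric chains. -/
theorem inner_coboundaryOp {F : Set (Finset V)} {i j : ℕ} {y c : ChainSpace L}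
    (hy : y ∈ ellTwoChains L F i) (hc : c ∈ ellTwoChains L F j) :
    inner ℝ y (coboundaryOp L F c) = 2 * inner ℝ (boundaryOp L F y) c := by
  have h1 : inner ℝ (boundaryOp L F y) c =
      ∑ τ : Finset V, ∑ s with s ∉ τ, incidence ℝ τ s * inner ℝ (y (insert s τ)) (c τ) := by
    rw [PiLp.inner_apply]
    refine Finset.sum_congr rfl fun τ _ => ?_
    by_cases hτ : τ ∈ F
    · rw [boundaryOp_eq, ellTwoBoundary_apply, simplicialBoundary_of_mem hτ, sum_inner]
      exact Finset.sum_congr rfl fun s _ => real_inner_smul_left _ _ _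
    · simp [ellTwoChains_supp hc τ hτ]
  rw [h1, sum_notMem_insert_eq_sum_mem_erase
    (fun τ s σ => incidence ℝ τ s * inner ℝ (y σ) (c τ)), Finset.mul_sum, PiLp.inner_apply]
  refine Finset.sum_congr rfl fun σ _ => ?_
  by_cases hσ : σ ∈ F
  · rw [coboundaryOp_of_mem hσ, inner_sum, Finset.mul_sum]
    refine Finset.sum_congr rfl fun s hs => ?_
    rw [real_inner_smul_right, inner_antisymOp hy c hs]
    ring
  · simp [ellTwoChains_supp hy σ hσ]

theorem coboundaryOp_mem_ellTwoChains {F : Set (Finset V)}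
    (hcomm : ∀ σ ∈ F, ∀ s ∈ σ, ∀ t ∈ σ, Commute (gen L s) (gen L t)) {i : ℕ} {c : ChainSpace L}
    (hc : c ∈ ellTwoChains L F i) : coboundaryOp L F c ∈ ellTwoChains L F (i + 1) := by
  refine ⟨fun σ hσ => ?_, fun σ t ht g => ?_⟩
  · by_cases h : σ ∈ F
    · rw [coboundaryOp_of_mem h, Finset.sum_eq_zero]
      intro s hs
      have : antisymOp L s c (σ.erase s) = 0 := by
        ext g
        rw [antisymOp_apply, hc.1]
        · simp
        · rintro ⟨_, h2⟩
          rw [Finset.card_erase_of_mem hs] at h2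
          have := Finset.card_pos.2 ⟨s, hs⟩
          exact hσ ⟨h, by omega⟩
      rw [this, smul_zero]
    · exact coboundaryOp_of_notMem h c
  · by_cases h : σ ∈ F
    · rw [coboundaryOp_apply_of_mem h, coboundaryOp_apply_of_mem h, ← Finset.sum_neg_distrib]
      refine Finset.sum_congr rfl fun s hs => ?_
      by_cases hst : s = t
      · subst hst
        rw [gen_mul_gen_cancel_right]
        ring
      · have ht' : t ∈ σ.erase s := Finset.mem_erase.2 ⟨Ne.symm hst, ht⟩
        rw [mul_assoc g, (hcomm σ h t ht s hs).eq, ← mul_assoc, hc.2 _ t ht', hc.2 _ t ht']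
        ring
    · rw [coboundaryOp_of_notMem h]
      simp

/-- Since the coboundary of c is itself a chain, testing orthogonality against its boundary shows
that it vanishes. Harmonicity thus becomes a system of finite linear relations between values of c,
which survive restriction to cosets and exterior products, whereas orthogonality to boundaries is
not visibly local. -/
theorem mem_harmonicCycles_iff {F : Set (Finset V)}
    (hcomm : ∀ σ ∈ F, ∀ s ∈ σ, ∀ t ∈ σ, Commute (gen L s) (gen L t)) {i : ℕ} {c : ChainSpace L} :
    c ∈ harmonicCycles L F i ↔ c ∈ ellTwoChains L F i ∧ boundaryOp L F c = 0 ∧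
      coboundaryOp L F c = 0 := by
  rw [harmonicCycles, Submodule.mem_inf, mem_ellTwoCycles, and_assoc]
  refine and_congr_right fun hc => and_congr_right fun _ => ?_
  rw [Submodule.mem_orthogonal]
  constructor
  · intro h
    have hd := coboundaryOp_mem_ellTwoChains hcomm hc
    have h1 := inner_coboundaryOp hd hc
    rw [h _ (mem_ellTwoBoundaries.2 ⟨_, hd, rfl⟩), mul_zero] at h1
    exact inner_self_eq_zero.1 h1
  · intro h u hu
    obtain ⟨y, hy, rfl⟩ := mem_ellTwoBoundaries.1 hu
    have h1 := inner_coboundaryOp hy hc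
    rw [h, inner_zero_right] at h1
    linarith

/-- Hodge decomposition: the harmonic representative is c minus its projection to the closed
boundaries, which are cycles. -/
theorem exists_harmonic_sub_mem {F : Set (Finset V)} (hF : F.OrdConnected) {i : ℕ}
    {c : ChainSpace L} (hc : c ∈ ellTwoCycles L F i) :
    ∃ h ∈ harmonicCycles L F i, c - h ∈ (ellTwoBoundaries L F i).topologicalClosure := by
  have : CompleteSpace (ellTwoBoundaries L F i).topologicalClosure :=
    (Submodule.isClosed_topologicalClosure _).completeSpace_coe
  have hb := Submodule.starProjection_apply_mem (ellTwoBoundaries L F i).topologicalClosure c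
  refine ⟨c - (ellTwoBoundaries L F i).topologicalClosure.starProjection c, ⟨?_, ?_⟩, ?_⟩
  · exact Submodule.sub_mem _ hc (closure_ellTwoBoundaries_le_ellTwoCycles hF i hb)
  · have := Submodule.sub_starProjection_mem_orthogonal
      (K := (ellTwoBoundaries L F i).topologicalClosure) c
    rwa [Submodule.orthogonal_closure] at this
  · rwa [sub_sub_cancel]

theorem eq_zero_of_mem_harmonicCycles {F : Set (Finset V)} {i : ℕ} {c : ChainSpace L}
    (hc : c ∈ harmonicCycles L F i)
    (hb : c ∈ (ellTwoBoundaries L F i).topologicalClosure) : c = 0 := by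
  have h2 : c ∈ (ellTwoBoundaries L F i).topologicalClosureᗮ := by
    rw [Submodule.orthogonal_closure]; exact hc.2
  exact inner_self_eq_zero.1 ((Submodule.mem_orthogonal _ _).1 h2 c hb)

end Harmonic

/-! ### Homomorphisms of right-angled Coxeter groups -/

section Homomorphisms

variable {U V : Type} [Fintype U] [LinearOrder U] [Fintype V] [LinearOrder V]
  {L' : AbstractSimplicialComplex U} {L : AbstractSimplicialComplex V}

theorem racMatrix_isLiftable {H : Type} [Group H] (f : V → H) (h1 : ∀ s, f s * f s = 1)
    (h2 : ∀ s t, {s, t} ∈ L.faces → Commute (f s) (f t)) : (racMatrix L).IsLiftable f := by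
  intro s t
  show (f s * f t) ^ (racMatrix L).M s t = 1
  by_cases hst : s = t
  · subst hst
    simp [racMatrix, h1]
  · by_cases h : {s, t} ∈ L.faces
    · simp only [racMatrix, Matrix.of_apply, hst, if_false, h, if_true]
      rw [(h2 s t h).mul_pow, pow_two, pow_two, h1, h1, one_mul]
    · simp [racMatrix, hst, h]

/-- The homomorphism from a right-angled Coxeter group given by commuting involutions. -/
def racLift {H : Type} [Group H] (f : V → H) (h1 : ∀ s, f s * f s = 1)
    (h2 : ∀ s t, {s, t} ∈ L.faces → Commute (f s) (f t)) : RACG L →* H :=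
  (racMatrix L).toCoxeterSystem.lift ⟨f, racMatrix_isLiftable f h1 h2⟩

@[simp]
theorem racLift_gen {H : Type} [Group H] (f : V → H) (h1 : ∀ s, f s * f s = 1)
    (h2 : ∀ s t, {s, t} ∈ L.faces → Commute (f s) (f t)) (s : V) :
    racLift f h1 h2 (gen L s) = f s :=
  (racMatrix L).toCoxeterSystem.lift_apply_simple (racMatrix_isLiftable f h1 h2) s

theorem racHom_ext {H : Type} [Group H] {φ ψ : RACG L →* H}
    (h : ∀ s, φ (gen L s) = ψ (gen L s)) : φ = ψ :=
  (racMatrix L).toCoxeterSystem.ext_simple h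

/-- `L'` is a full subcomplex of `L` via the embedding `ι` of vertices (on edges). -/
def EdgeFull (L' : AbstractSimplicialComplex U) (L : AbstractSimplicialComplex V)
    (ι : U ↪o V) : Prop :=
  ∀ s t, {s, t} ∈ L'.faces ↔ {ι s, ι t} ∈ L.faces

theorem map_pair (ι : U ↪o V) (s t : U) : ({s, t} : Finset U).map ι.toEmbedding = {ι s, ι t} := by
  rw [Finset.map_insert, Finset.map_singleton]
  rfl

/-- The inclusion of a special subgroup. -/
def racInclusion {ι : U ↪o V} (h : EdgeFull L' L ι) : RACG L' →* RACG L :=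
  racLift (fun s => gen L (ι s)) (fun _ => gen_mul_self _)
    (fun s t hst => commute_gen ((h s t).1 hst))

open Classical in
/-- The generator over `t`, or `1` if there is none. -/
def genOrOne (L' : AbstractSimplicialComplex U) (ι : U ↪o V) (t : V) : RACG L' :=
  if h : ∃ s, ι s = t then gen L' h.choose else 1

theorem genOrOne_apply (ι : U ↪o V) (s : U) : genOrOne L' ι (ι s) = gen L' s := by
  have h : ∃ s', ι s' = ι s := ⟨s, rfl⟩
  rw [genOrOne, dif_pos h, ι.injective h.choose_spec]

theorem genOrOne_of_notMem {ι : U ↪o V} {t : V} (h : t ∉ Set.range ι) : genOrOne L' ι t = 1 :=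
  dif_neg h

/-- The retraction onto a special subgroup. -/
def racRetraction {ι : U ↪o V} (h : EdgeFull L' L ι) : RACG L →* RACG L' :=
  racLift (genOrOne L' ι) (fun t => by
    by_cases ht : t ∈ Set.range ι
    · obtain ⟨s, rfl⟩ := ht
      rw [genOrOne_apply, gen_mul_self]
    · rw [genOrOne_of_notMem ht, one_mul]) (fun t t' htt => by
    by_cases ht : t ∈ Set.range ι
    · by_cases ht' : t' ∈ Set.range ι
      · obtain ⟨s, rfl⟩ := ht
        obtain ⟨s', rfl⟩ := ht'
        rw [genOrOne_apply, genOrOne_apply]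
        exact commute_gen ((h s s').2 htt)
      · rw [genOrOne_of_notMem ht']
        exact Commute.one_right _
    · rw [genOrOne_of_notMem ht]
      exact Commute.one_left _)

@[simp]
theorem racInclusion_gen {ι : U ↪o V} (h : EdgeFull L' L ι) (s : U) :
    racInclusion h (gen L' s) = gen L (ι s) := racLift_gen _ _ _ s

@[simp]
theorem racRetraction_gen {ι : U ↪o V} (h : EdgeFull L' L ι) (t : V) :
    racRetraction h (gen L t) = genOrOne L' ι t := racLift_gen _ _ _ t

theorem racRetraction_racInclusion {ι : U ↪o V} (h : EdgeFull L' L ι) (x : RACG L') :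
    racRetraction h (racInclusion h x) = x := by
  have : (racRetraction h).comp (racInclusion h) = MonoidHom.id _ :=
    racHom_ext fun s => by simp [genOrOne_apply]
  exact DFunLike.congr_fun this x

/-- Sending the generators outside the special subgroup to 1 gives a left inverse; no normal form
for words is needed. -/
theorem racInclusion_injective {ι : U ↪o V} (h : EdgeFull L' L ι) :
    Function.Injective (racInclusion h) :=
  Function.LeftInverse.injective (racRetraction_racInclusion h)

/-! ### Restriction to cosets of special subgroups -/

/-- The restriction of chains to the coset `w W_{L'}`. -/
def cosetRestriction {ι : U ↪o V} (h : EdgeFull L' L ι) (w : RACG L) :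
    ChainSpace L →L[ℝ] ChainSpace L' :=
  EllTwoPow.pi fun σ => EllTwo.pullback (fun x => w * racInclusion h x)
    ((mul_right_injective w).comp (racInclusion_injective h)) ∘L
      EllTwoPow.coord (σ.map ι.toEmbedding)

theorem cosetRestriction_apply {ι : U ↪o V} (h : EdgeFull L' L ι) (w : RACG L)
    (f : ChainSpace L) (σ : Finset U) (x : RACG L') :
    cosetRestriction h w f σ x = f (σ.map ι.toEmbedding) (w * racInclusion h x) := rfl

theorem cosetRestriction_mem_ellTwoChains {ι : U ↪o V} (h : EdgeFull L' L ι) (w : RACG L)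
    {F : Set (Finset V)} {F' : Set (Finset U)} (hF' : ∀ σ, σ ∈ F' ↔ σ.map ι.toEmbedding ∈ F)
    {i : ℕ} {f : ChainSpace L} (hf : f ∈ ellTwoChains L F i) :
    cosetRestriction h w f ∈ ellTwoChains L' F' i := by
  refine ⟨fun σ hσ => ?_, fun σ s hs g => ?_⟩
  · ext x
    rw [cosetRestriction_apply, hf.1]
    · rfl
    · rw [Finset.card_map, ← hF']
      exact hσ
  · rw [cosetRestriction_apply, cosetRestriction_apply, map_mul, racInclusion_gen, ← mul_assoc,
      hf.2 _ (ι s) (Finset.mem_map_of_mem ι.toEmbedding hs)]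

theorem boundaryOp_cosetRestriction {ι : U ↪o V} (h : EdgeFull L' L ι) (w : RACG L)
    {F : Set (Finset V)} {F' : Set (Finset U)} (hF' : ∀ σ, σ ∈ F' ↔ σ.map ι.toEmbedding ∈ F)
    (hF : ∀ σ ∈ F, ∀ s ∈ σ, s ∈ Set.range ι)
    {i : ℕ} {f : ChainSpace L} (hf : f ∈ ellTwoChains L F i) :
    boundaryOp L' F' (cosetRestriction h w f) = cosetRestriction h w (boundaryOp L F f) := by
  obtain rfl : F' = (fun τ : Finset U => τ.map ι.toEmbedding) ⁻¹' F := Set.ext hF'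
  ext τ x
  rw [boundaryOp_apply_apply, cosetRestriction_apply, boundaryOp_apply_apply]
  exact simplicialBoundary_map ι hF (ellTwoChains_supp_apply hf _) τ

theorem cosetRestriction_mem_closure {ι : U ↪o V} (h : EdgeFull L' L ι) (w : RACG L)
    {F : Set (Finset V)} {F' : Set (Finset U)} (hF' : ∀ σ, σ ∈ F' ↔ σ.map ι.toEmbedding ∈ F)
    (hF : ∀ σ ∈ F, ∀ s ∈ σ, s ∈ Set.range ι) {i : ℕ} {f : ChainSpace L}
    (hf : f ∈ (ellTwoBoundaries L F i).topologicalClosure) :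
    cosetRestriction h w f ∈ (ellTwoBoundaries L' F' i).topologicalClosure := by
  refine map_mem_closure (cosetRestriction h w).continuous hf ?_
  intro u hu
  obtain ⟨y, hy, rfl⟩ := mem_ellTwoBoundaries.1 hu
  exact mem_ellTwoBoundaries.2 ⟨_, cosetRestriction_mem_ellTwoChains h w hF' hy,
    boundaryOp_cosetRestriction h w hF' hF hy⟩

theorem coboundaryOp_cosetRestriction {ι : U ↪o V} (h : EdgeFull L' L ι) (w : RACG L)
    {F : Set (Finset V)} {F' : Set (Finset U)} (hF' : ∀ σ, σ ∈ F' ↔ σ.map ι.toEmbedding ∈ F)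
    (f : ChainSpace L) :
    coboundaryOp L' F' (cosetRestriction h w f) = cosetRestriction h w (coboundaryOp L F f) := by
  ext σ x
  rw [cosetRestriction_apply]
  by_cases hσ : σ ∈ F'
  · rw [coboundaryOp_apply_of_mem hσ, coboundaryOp_apply_of_mem ((hF' σ).1 hσ), Finset.sum_map]
    refine Finset.sum_congr rfl fun s _ => ?_
    have h1 : (σ.map ι.toEmbedding).erase (ι.toEmbedding s) = (σ.erase s).map ι.toEmbedding :=
      (Finset.map_erase _ _ _).symm
    have h2 : incidence ℝ ((σ.erase s).map ι.toEmbedding) (ι.toEmbedding s) =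
      incidence ℝ (σ.erase s) s := incidence_map ι _ s
    rw [h1, h2, cosetRestriction_apply, cosetRestriction_apply, map_mul, racInclusion_gen,
      mul_assoc]
    rfl
  · rw [coboundaryOp_of_notMem hσ, coboundaryOp_of_notMem (fun h => hσ ((hF' σ).2 h))]
    rfl

/-- The boundary and coboundary relations for types in the range of ι only involve cubes based in
one coset, so they restrict to each coset separately. -/
theorem cosetRestriction_mem_harmonicCycles {ι : U ↪o V} (h : EdgeFull L' L ι) (w : RACG L)
    {F : Set (Finset V)} {F' : Set (Finset U)} (hF' : ∀ σ, σ ∈ F' ↔ σ.map ι.toEmbedding ∈ F)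
    (hF : ∀ σ ∈ F, ∀ s ∈ σ, s ∈ Set.range ι)
    (hcomm : ∀ σ ∈ F, ∀ s ∈ σ, ∀ t ∈ σ, Commute (gen L s) (gen L t))
    (hcomm' : ∀ σ ∈ F', ∀ s ∈ σ, ∀ t ∈ σ, Commute (gen L' s) (gen L' t)) {i : ℕ}
    {f : ChainSpace L} (hf : f ∈ harmonicCycles L F i) :
    cosetRestriction h w f ∈ harmonicCycles L' F' i := by
  rw [mem_harmonicCycles_iff hcomm] at hf
  rw [mem_harmonicCycles_iff hcomm']
  refine ⟨cosetRestriction_mem_ellTwoChains h w hF' hf.1, ?_, ?_⟩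
  · rw [boundaryOp_cosetRestriction h w hF' hF hf.1, hf.2.1, map_zero]
  · rw [coboundaryOp_cosetRestriction h w hF', hf.2.2, map_zero]

end Homomorphisms

/-! ### The statement III in ambient form -/

section AmbientThree

/-- The statement `III` for harmonic cycles. -/
def HarmonicIII (m : ℕ) : Prop :=
  ∀ (V : Type) [Fintype V] [LinearOrder V] (L : AbstractSimplicialComplex V)
    (S : PreAbstractSimplicialComplex V) (v : V), IsFlag L.toPreAbstractSimplicialComplex →
      IsFullSubcomplex S L.toPreAbstractSimplicialComplex → IsGHS S (2 * m + 1) →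
      {v} ∈ S.faces → ∀ c ∈ harmonicCycles L (simplices (link S {v})) m,
      c ∈ (ellTwoBoundaries L (simplices (deleteVertex S v)) m).topologicalClosure →
      c ∈ (ellTwoBoundaries L (simplices (cone v (link S {v}))) m).topologicalClosure → c = 0

/-- A cycle differs from its harmonic representative by a limit of boundaries in the link, which is
also one in the deletion and in the cone. So the hypotheses pass to the representative. -/
theorem ambientIII_of_harmonicIII {m : ℕ} (h : HarmonicIII m) : AmbientIII m := by
  intro V _ _ L S v hL hSL hS hv c hc hcD hcC
  obtain ⟨c', hc', hb⟩ := exists_harmonic_sub_mem (ordConnected_simplices _) hc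
  have hbD := Submodule.topologicalClosure_mono
    (ellTwoBoundaries_mono L (link_le_deleteVertex S v) m) hb
  have hbC := Submodule.topologicalClosure_mono
    (ellTwoBoundaries_mono L (le_cone v (link S {v})) m) hb
  have h0 := h V L S v hL hSL hS hv c' hc' (by
    have := Submodule.sub_mem _ hcD hbD
    rwa [sub_sub_cancel] at this) (by
    have := Submodule.sub_mem _ hcC hbC
    rwa [sub_sub_cancel] at this)
  rwa [h0, sub_zero] at hb

variable {V : Type} [Fintype V] [LinearOrder V]

theorem commute_gen_of_mem_simplices {L : AbstractSimplicialComplex V}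
    {K : PreAbstractSimplicialComplex V} (hK : K ≤ L.toPreAbstractSimplicialComplex) :
    ∀ σ ∈ simplices K, ∀ s ∈ σ, ∀ t ∈ σ, Commute (gen L s) (gen L t) :=
  fun _ hσ s hs _ ht => commute_gen_of_mem hK (mem_faces_of_mem_simplices hσ ⟨s, hs⟩) hs ht

theorem eq_zero_of_statementIII {m : ℕ} (hIII : StatementIII (2 * m + 1))
    (S : AbstractSimplicialComplex V) (v : V) (hfl : IsFlag S.toPreAbstractSimplicialComplex)
    (hS : IsGHS S.toPreAbstractSimplicialComplex (2 * m + 1)) {c : ChainSpace S}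
    (hc : c ∈ harmonicCycles S (simplices (link S.toPreAbstractSimplicialComplex {v})) m)
    (hcD : c ∈ (ellTwoBoundaries S
      (simplices (deleteVertex S.toPreAbstractSimplicialComplex v)) m).topologicalClosure)
    (hcC : c ∈ (ellTwoBoundaries S
      (simplices (cone v (link S.toPreAbstractSimplicialComplex {v}))) m).topologicalClosure) :
    c = 0 := by
  have hinj := hIII m rfl V S v hfl hS (hS.isGHD (S.singleton_mem v))
  have h0 : (Submodule.Quotient.mk ⟨c, hc.1⟩ :
      hHomology S (link S.toPreAbstractSimplicialComplex {v}) m) = 0 := by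
    apply hinj
    rw [map_zero]
    refine Prod.ext ?_ ?_
    · exact (Submodule.Quotient.mk_eq_zero _).2 hcD
    · exact (Submodule.Quotient.mk_eq_zero _).2 hcC
  exact eq_zero_of_mem_harmonicCycles hc ((Submodule.Quotient.mk_eq_zero
    (closedBoundaries S (simplices (link S.toPreAbstractSimplicialComplex {v})) m)
    (x := ⟨c, hc.1⟩)).1 h0)

/-- A subcomplex as a complex on its own set of vertices. -/
def onVertices (S : PreAbstractSimplicialComplex V) :
    AbstractSimplicialComplex {x : V // {x} ∈ S.faces} where
  faces := {σ | σ.map (Function.Embedding.subtype _) ∈ S.faces}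
  isRelLowerSet_faces := fun _ hσ => ⟨Finset.map_nonempty.1 (S.nonempty_of_mem hσ),
    fun _ hρ h0 => S.down hσ (Finset.map_subset_map.2 hρ) (Finset.map_nonempty.2 h0)⟩
  singleton_mem := fun v => v.2

/-- The subcomplex of cubes with type in S is a union of translates of the intrinsic complex of S,
one for each coset of its special subgroup. Each coset restriction of c satisfies the hypotheses of
III over the group of S and therefore vanishes. For a chain that is not harmonic the restrictions
would only be limits of boundaries, with nothing to assemble them; this is why harmonic
representatives are used. -/
theorem harmonicIII_of_statementIII {m : ℕ} (hIII : StatementIII (2 * m + 1)) :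
    HarmonicIII m := by
  intro V _ _ L S v hL hSL hS hv c hc hcD hcC
  let U := {x : V // {x} ∈ S.faces}
  have : Fintype U := Fintype.ofFinite U
  let ι : U ↪o V := OrderEmbedding.subtype _
  let S' : AbstractSimplicialComplex U := onVertices S
  let v' : U := ⟨v, hv⟩
  have hmem : ∀ σ : Finset U, σ ∈ S'.faces ↔ σ.map ι.toEmbedding ∈ S.faces := fun σ => Iff.rfl
  have hrange : ∀ σ ∈ S.faces, ∀ s ∈ σ, s ∈ Set.range ι := fun σ hσ s hs =>
    ⟨⟨s, S.singleton_mem_of_mem hσ hs⟩, rfl⟩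
  have hfull : EdgeFull S' L ι := by
    intro s t
    refine (hmem _).trans ?_
    rw [map_pair ι s t]
    refine ⟨fun h => hSL.1 h, fun h => hSL.2 _ h fun x hx => ?_⟩
    rcases Finset.mem_insert.1 hx with rfl | hx
    · exact s.2
    · rw [Finset.mem_singleton.1 hx]; exact t.2
  have hflS := hSL.isFlag hL
  have hfl : IsFlag S'.toPreAbstractSimplicialComplex := by
    intro σ h0 _ hst
    rw [hmem]
    refine hflS _ (Finset.map_nonempty.2 h0) ?_ ?_
    · intro s hs
      obtain ⟨s', _, rfl⟩ := Finset.mem_map.1 hs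
      exact s'.2
    · intro s hs t ht hne
      obtain ⟨s', hs', rfl⟩ := Finset.mem_map.1 hs
      obtain ⟨t', ht', rfl⟩ := Finset.mem_map.1 ht
      have := hst s' hs' t' ht' (fun h => hne (by rw [h]))
      exact map_pair ι s' t' ▸ (hmem _).1 this
  have hsimp : ∀ (K : PreAbstractSimplicialComplex V) (K' : PreAbstractSimplicialComplex U),
      (∀ σ : Finset U, σ ∈ K'.faces ↔ σ.map ι.toEmbedding ∈ K.faces) →
      ∀ σ : Finset U, σ ∈ simplices K' ↔ σ.map ι.toEmbedding ∈ simplices K := by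
    intro K K' hK σ
    rw [mem_simplices, mem_simplices, hK, Finset.map_eq_empty]
  have hlink : ∀ ρ σ : Finset U, σ ∈ (link S'.toPreAbstractSimplicialComplex ρ).faces ↔
      σ.map ι.toEmbedding ∈ (link S (ρ.map ι.toEmbedding)).faces := by
    intro ρ σ
    show σ.Nonempty ∧ Disjoint σ ρ ∧ σ ∪ ρ ∈ S'.faces ↔ (σ.map ι.toEmbedding).Nonempty ∧
      Disjoint (σ.map ι.toEmbedding) (ρ.map ι.toEmbedding) ∧
      σ.map ι.toEmbedding ∪ ρ.map ι.toEmbedding ∈ S.faces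
    rw [Finset.map_nonempty, Finset.disjoint_map, hmem, Finset.map_union]
  have hlinkr : ∀ ρ, ∀ σ ∈ (link S ρ).faces, ∀ s ∈ σ, s ∈ Set.range ι := fun ρ σ hσ s hs =>
    hrange _ hσ.2.2 s (Finset.mem_union_left _ hs)
  have hsr : ∀ K : PreAbstractSimplicialComplex V,
      (∀ σ ∈ K.faces, ∀ s ∈ σ, s ∈ Set.range ι) → ∀ σ ∈ simplices K, ∀ s ∈ σ, s ∈ Set.range ι :=
    fun K hK σ hσ s hs => hK σ (mem_faces_of_mem_simplices hσ ⟨s, hs⟩) s hs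
  have hbetti : ∀ (K : PreAbstractSimplicialComplex V) (K' : PreAbstractSimplicialComplex U),
      (∀ σ : Finset U, σ ∈ K'.faces ↔ σ.map ι.toEmbedding ∈ K.faces) →
      (∀ σ ∈ K.faces, ∀ s ∈ σ, s ∈ Set.range ι) → ∀ j, HasHomologyOfSphere K j →
      HasHomologyOfSphere K' j := by
    intro K K' hK hr j h n
    rw [← h n, rationalBetti_map ι (hsr K hr)]
    congr 1
    exact Set.ext (hsimp K K' hK)
  have hGHS : IsGHS S'.toPreAbstractSimplicialComplex (2 * m + 1) := by
    refine ⟨hbetti S _ hmem hrange _ hS.1, fun σ hσ => ?_⟩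
    obtain ⟨j, hj, h⟩ := hS.2 _ ((hmem σ).1 hσ)
    rw [Finset.card_map] at hj
    exact ⟨j, hj, hbetti _ _ (hlink σ) (hlinkr _) j h⟩
  have hv'map : ({v'} : Finset U).map ι.toEmbedding = {v} := rfl
  have hlv := hlink {v'}
  rw [hv'map] at hlv
  have hvm : ∀ σ : Finset U, v ∈ σ.map ι.toEmbedding ↔ v' ∈ σ := fun σ =>
    Finset.mem_map' ι.toEmbedding (a := v')
  have hdv : ∀ σ : Finset U, σ ∈ (deleteVertex S'.toPreAbstractSimplicialComplex v').faces ↔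
      σ.map ι.toEmbedding ∈ (deleteVertex S v).faces := by
    intro σ
    show σ ∈ S'.faces ∧ v' ∉ σ ↔ σ.map ι.toEmbedding ∈ S.faces ∧ v ∉ σ.map ι.toEmbedding
    rw [hmem, hvm]
  have hcv : ∀ σ : Finset U,
      σ ∈ (cone v' (link S'.toPreAbstractSimplicialComplex {v'})).faces ↔
      σ.map ι.toEmbedding ∈ (cone v (link S {v})).faces := by
    intro σ
    show σ.Nonempty ∧ σ.erase v' ∈ _ ↔ (σ.map ι.toEmbedding).Nonempty ∧
      (σ.map ι.toEmbedding).erase v ∈ _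
    rw [Finset.map_nonempty, hsimp _ _ hlv, Finset.map_erase]
    rfl
  have hcr : ∀ σ ∈ (cone v (link S {v})).faces, ∀ s ∈ σ, s ∈ Set.range ι := by
    intro σ hσ s hs
    by_cases hsv : s = v
    · exact ⟨v', hsv.symm⟩
    · exact hsr _ (hlinkr _) _ hσ.2 s (Finset.mem_erase.2 ⟨hsv, hs⟩)
  have hSv : link S {v} ≤ L.toPreAbstractSimplicialComplex :=
    ((hflS.isFullSubcomplex_link v).trans hSL).1
  have key : ∀ w, cosetRestriction hfull w c = 0 := by
    intro w
    refine eq_zero_of_statementIII hIII S' v' hfl hGHS ?_ ?_ ?_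
    · exact cosetRestriction_mem_harmonicCycles hfull w (hsimp _ _ hlv) (hsr _ (hlinkr _))
        (commute_gen_of_mem_simplices hSv)
        (commute_gen_of_mem_simplices (hfl.isFullSubcomplex_link v').1) hc
    · exact cosetRestriction_mem_closure hfull w (hsimp _ _ hdv)
        (hsr _ fun σ hσ => hrange σ hσ.1) hcD
    · exact cosetRestriction_mem_closure hfull w (hsimp _ _ hcv) (hsr _ hcr) hcC
  have hcc := (mem_ellTwoCycles.1 hc.1).1
  ext σ g
  by_cases hσ : σ ∈ simplices (link S {v})
  · have hσr := hsr _ (hlinkr _) σ hσ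
    have : σ = (Finset.univ.filter fun x : U => ι x ∈ σ).map ι.toEmbedding := by
      ext x
      simp only [Finset.mem_map, Finset.mem_filter, Finset.mem_univ, true_and]
      constructor
      · intro hx
        obtain ⟨y, rfl⟩ := hσr x hx
        exact ⟨y, hx, rfl⟩
      · rintro ⟨y, hy, rfl⟩; exact hy
    -- The value of c at g is the value at 1 of its restriction to the coset of g.
    have h1 := cosetRestriction_apply hfull g c (Finset.univ.filter fun x : U => ι x ∈ σ) 1
    rw [key, ← this, map_one, mul_one] at h1
    exact h1.symm
  · rw [ellTwoChains_supp hcc σ hσ]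
    rfl

end AmbientThree

/-! ### Joins -/

section Join

variable {V Q U : Type} [Fintype V] [LinearOrder V] [Fintype Q] [LinearOrder Q]
  [Fintype U] [LinearOrder U]

/-- `U` is the ordered disjoint union of the images of `ι₁` and `ι₂`. -/
structure IsOrderedSum (ι₁ : V ↪o U) (ι₂ : Q ↪o U) : Prop where
  lt : ∀ x y, ι₁ x < ι₂ y
  cover : ∀ u, (∃ x, ι₁ x = u) ∨ ∃ y, ι₂ y = u

/-- The part of a set of vertices of `U` in `V`. -/
def part (ι : V ↪o U) (σ : Finset U) : Finset V := Finset.univ.filter fun x => ι x ∈ σ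

@[simp]
theorem mem_part {ι : V ↪o U} {σ : Finset U} {x : V} : x ∈ part ι σ ↔ ι x ∈ σ := by
  simp [part]

theorem part_mono (ι : V ↪o U) {σ τ : Finset U} (h : σ ⊆ τ) : part ι σ ⊆ part ι τ :=
  fun x hx => by
    rw [mem_part] at hx ⊢
    exact h hx

@[simp]
theorem part_empty (ι : V ↪o U) : part ι ∅ = ∅ := by
  ext; simp

@[simp]
theorem part_map_self (ι : V ↪o U) (σ : Finset V) : part ι (σ.map ι.toEmbedding) = σ := by
  ext x
  exact mem_part.trans (Finset.mem_map' ι.toEmbedding)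

@[simp]
theorem part_union (ι : V ↪o U) (σ τ : Finset U) : part ι (σ ∪ τ) = part ι σ ∪ part ι τ := by
  ext; simp

@[simp]
theorem part_insert_self (ι : V ↪o U) (x : V) (σ : Finset U) :
    part ι (insert (ι x) σ) = insert x (part ι σ) := by
  ext; simp

@[simp]
theorem part_erase_self (ι : V ↪o U) (x : V) (σ : Finset U) :
    part ι (σ.erase (ι x)) = (part ι σ).erase x := by
  ext; simp

theorem part_insert_of_notMem {ι : V ↪o U} {u : U} (h : ∀ x, ι x ≠ u) (σ : Finset U) :
    part ι (insert u σ) = part ι σ := by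
  ext; simp [h]

theorem part_erase_of_notMem {ι : V ↪o U} {u : U} (h : ∀ x, ι x ≠ u) (σ : Finset U) :
    part ι (σ.erase u) = part ι σ := by
  ext; simp [h]

namespace IsOrderedSum

variable {ι₁ : V ↪o U} {ι₂ : Q ↪o U} (h : IsOrderedSum ι₁ ι₂)
include h

theorem ne (x : V) (y : Q) : ι₁ x ≠ ι₂ y := (h.lt x y).ne

theorem part_left_insert (y : Q) (σ : Finset U) : part ι₁ (insert (ι₂ y) σ) = part ι₁ σ :=
  part_insert_of_notMem (fun x => h.ne x y) σ

theorem part_right_insert (x : V) (σ : Finset U) : part ι₂ (insert (ι₁ x) σ) = part ι₂ σ :=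
  part_insert_of_notMem (fun y => (h.ne x y).symm) σ

theorem part_left_erase (y : Q) (σ : Finset U) : part ι₁ (σ.erase (ι₂ y)) = part ι₁ σ :=
  part_erase_of_notMem (fun x => h.ne x y) σ

theorem part_right_erase (x : V) (σ : Finset U) : part ι₂ (σ.erase (ι₁ x)) = part ι₂ σ :=
  part_erase_of_notMem (fun y => (h.ne x y).symm) σ

theorem part_left_map (σ : Finset Q) : part ι₁ (σ.map ι₂.toEmbedding) = ∅ := by
  ext x
  simp [(h.ne x _).symm]

theorem part_right_map (σ : Finset V) : part ι₂ (σ.map ι₁.toEmbedding) = ∅ := by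
  ext y
  simp [h.ne _ y]

theorem ext {σ τ : Finset U} (h1 : part ι₁ σ = part ι₁ τ) (h2 : part ι₂ σ = part ι₂ τ) : σ = τ := by
  ext u
  rcases h.cover u with ⟨x, rfl⟩ | ⟨y, rfl⟩
  · rw [← mem_part, h1, mem_part]
  · rw [← mem_part, h2, mem_part]

theorem map_union_map (σ : Finset U) :
    (part ι₁ σ).map ι₁.toEmbedding ∪ (part ι₂ σ).map ι₂.toEmbedding = σ := by
  apply h.ext <;> simp [h.part_left_map, h.part_right_map]

theorem card_eq (σ : Finset U) : σ.card = (part ι₁ σ).card + (part ι₂ σ).card := by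
  conv_lhs => rw [← h.map_union_map σ]
  rw [Finset.card_union_of_disjoint, Finset.card_map, Finset.card_map]
  rw [Finset.disjoint_left]
  intro u hu hu'
  obtain ⟨x, _, rfl⟩ := Finset.mem_map.1 hu
  obtain ⟨y, _, hy⟩ := Finset.mem_map.1 hu'
  exact h.ne x y hy.symm

theorem disjoint_iff {σ τ : Finset U} :
    Disjoint σ τ ↔ Disjoint (part ι₁ σ) (part ι₁ τ) ∧ Disjoint (part ι₂ σ) (part ι₂ τ) := by
  simp only [Finset.disjoint_left, mem_part]
  refine ⟨fun H => ⟨fun _ hx => H hx, fun _ hx => H hx⟩, fun H u => ?_⟩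
  rcases h.cover u with ⟨x, rfl⟩ | ⟨y, rfl⟩
  · exact @H.1 x
  · exact @H.2 y

end IsOrderedSum

/-- The joins of elements of `F` with elements of `G`. -/
def joinSet (ι₁ : V ↪o U) (ι₂ : Q ↪o U) (F : Set (Finset V)) (G : Set (Finset Q)) :
    Set (Finset U) := {σ | part ι₁ σ ∈ F ∧ part ι₂ σ ∈ G}

section

variable {ι₁ : V ↪o U} {ι₂ : Q ↪o U} {F : Set (Finset V)} {G : Set (Finset Q)}

theorem mem_joinSet {σ : Finset U} : σ ∈ joinSet ι₁ ι₂ F G ↔ part ι₁ σ ∈ F ∧ part ι₂ σ ∈ G :=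
  Iff.rfl

theorem ordConnected_joinSet (hF : IsLowerSet F) (hG : IsLowerSet G) :
    (joinSet ι₁ ι₂ F G).OrdConnected := IsLowerSet.ordConnected
  fun _ _ h hσ => ⟨hF (part_mono ι₁ h) hσ.1, hG (part_mono ι₂ h) hσ.2⟩

theorem isLowerSet_deletion (hG : IsLowerSet G) (q : Q) : IsLowerSet {σ | σ ∈ G ∧ q ∉ σ} :=
  fun _ _ h hσ => ⟨hG h hσ.1, fun hq => hσ.2 (h hq)⟩

theorem isLowerSet_linkSet (hG : IsLowerSet G) (q : Q) : IsLowerSet (linkSet G q) :=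
  fun _ _ h hσ => ⟨fun hq => hσ.1 (h hq), hG (Finset.insert_subset_insert q h) hσ.2⟩

theorem deletion_joinSet (q : Q) : {σ | σ ∈ joinSet ι₁ ι₂ F G ∧ ι₂ q ∉ σ} =
    joinSet ι₁ ι₂ F {τ | τ ∈ G ∧ q ∉ τ} := by
  ext σ
  simp [mem_joinSet, and_assoc]

variable (h : IsOrderedSum ι₁ ι₂)
include h

theorem linkSet_joinSet (q : Q) :
    linkSet (joinSet ι₁ ι₂ F G) (ι₂ q) = joinSet ι₁ ι₂ F (linkSet G q) := by
  ext σ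
  simp only [linkSet, mem_joinSet, Set.mem_ofPred_eq, h.part_left_insert, part_insert_self, mem_part]
  tauto

theorem isRationallyAcyclic_joinSet_of_cone (hF : IsLowerSet F) (hG : IsLowerSet G) (q : Q)
    (hq : ∀ τ, τ ∈ G ↔ τ.erase q ∈ G) : IsRationallyAcyclic (joinSet ι₁ ι₂ F G) := by
  refine isRationallyAcyclic_of_cone (ordConnected_joinSet hF hG) (ι₂ q) fun σ => ?_
  rw [mem_joinSet, mem_joinSet, h.part_left_erase, part_erase_self, hq (part ι₂ σ)]

theorem rationalBetti_joinSet_singleton_empty (m : ℕ) :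
    rationalBetti (joinSet ι₁ ι₂ F {∅}) m = rationalBetti F m := by
  rw [rationalBetti_map ι₁]
  · congr 1
    ext τ
    simp [mem_joinSet, h.part_right_map]
  · intro σ hσ s hs
    rcases h.cover s with ⟨x, rfl⟩ | ⟨y, rfl⟩
    · exact ⟨x, rfl⟩
    · have h2 : part ι₂ σ = ∅ := hσ.2
      have := mem_part.2 hs
      rw [h2] at this
      exact absurd this (Finset.notMem_empty y)

end

/-- Joining with `G` shifts homology by `n`, as for a sphere of dimension `n - 1`. -/
def JoinShifts (ι₁ : V ↪o U) (ι₂ : Q ↪o U) (G : Set (Finset Q)) (n : ℕ) : Prop :=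
  ∀ F : Set (Finset V), IsLowerSet F →
    (∀ m, rationalBetti (joinSet ι₁ ι₂ F G) (m + n) = rationalBetti F m) ∧
      ∀ m < n, rationalBetti (joinSet ι₁ ι₂ F G) m = 0

variable {ι₁ : V ↪o U} {ι₂ : Q ↪o U}

theorem joinShifts_singleton_empty (h : IsOrderedSum ι₁ ι₂) : JoinShifts ι₁ ι₂ {∅} 0 :=
  fun _ _ => ⟨fun m => rationalBetti_joinSet_singleton_empty h m, fun _ hm => by omega⟩

/-- If the join with G - q is acyclic, the homology of the join is that of the link of q shifted by
one, and this link is the join with the link of q in G. -/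
theorem JoinShifts.succ (h : IsOrderedSum ι₁ ι₂) {G : Set (Finset Q)} (hG : IsLowerSet G) (q : Q)
    {n : ℕ} (hl : JoinShifts ι₁ ι₂ (linkSet G q) n)
    (hd : ∀ F : Set (Finset V), IsLowerSet F →
      IsRationallyAcyclic (joinSet ι₁ ι₂ F {τ | τ ∈ G ∧ q ∉ τ})) :
    JoinShifts ι₁ ι₂ G (n + 1) := by
  intro F hF
  have hO := ordConnected_joinSet (ι₁ := ι₁) (ι₂ := ι₂) hF hG
  have hd' := hd F hF
  rw [← deletion_joinSet] at hd'
  have hs := rationalBetti_succ_of_acyclic hO (ι₂ q) hd'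
  rw [linkSet_joinSet h] at hs
  refine ⟨fun m => ?_, fun m hm => ?_⟩
  · rw [← (hl F hF).1 m, ← hs]
    rfl
  · cases m with
    | zero => exact rationalBetti_zero_of_acyclic hO (ι₂ q) hd'
    | succ m => rw [hs, (hl F hF).2 m (by omega)]

/-- Suspension: the link of b is empty, and without b the join is a cone with apex a. -/
theorem joinShifts_two_points (h : IsOrderedSum ι₁ ι₂) {a b : Q} (hab : a ≠ b) :
    JoinShifts ι₁ ι₂ {∅, {a}, {b}} 1 := by
  have hlow : ∀ c : Q, IsLowerSet ({∅, {c}} : Set (Finset Q)) := by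
    rintro c σ τ hτσ (rfl | rfl)
    · exact Or.inl (Finset.subset_empty.1 hτσ)
    · exact Finset.subset_singleton_iff.1 hτσ
  refine JoinShifts.succ h ?_ b (n := 0) ?_ ?_
  · rintro σ τ hτσ (rfl | rfl | rfl)
    · exact Or.inl (Finset.subset_empty.1 hτσ)
    · exact (Finset.subset_singleton_iff.1 hτσ).imp_right Or.inl
    · exact (Finset.subset_singleton_iff.1 hτσ).imp_right Or.inr
  · convert joinShifts_singleton_empty h using 1
    ext τ
    simp only [linkSet, Set.mem_ofPred_eq, Set.mem_insert_iff, Set.mem_singleton_iff]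
    constructor
    · rintro ⟨h1, h2 | h2 | h2⟩
      · exact absurd h2 (Finset.insert_ne_empty _ _)
      · have := h2 ▸ Finset.mem_insert_self b τ
        exact absurd (Finset.mem_singleton.1 this).symm hab
      · rw [← Finset.erase_insert h1, h2]
        simp
    · rintro rfl
      simp
  · intro F hF
    have : {τ | τ ∈ ({∅, {a}, {b}} : Set (Finset Q)) ∧ b ∉ τ} = {∅, {a}} := by
      ext τ
      simp only [Set.mem_ofPred_eq, Set.mem_insert_iff, Set.mem_singleton_iff]
      constructor
      · rintro ⟨h1 | h1 | h1, h2⟩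
        · exact Or.inl h1
        · exact Or.inr h1
        · exact absurd (h1 ▸ Finset.mem_singleton_self b) h2
      · rintro (rfl | rfl)
        · simp
        · simp [Ne.symm hab]
    rw [this]
    refine isRationallyAcyclic_joinSet_of_cone h hF (hlow a) a fun τ => ?_
    simp only [Set.mem_insert_iff, Set.mem_singleton_iff, Finset.erase_eq_empty_iff]
    refine ⟨fun h => Or.inl h, ?_⟩
    rintro (h | h)
    · exact h
    · exact absurd (h ▸ Finset.mem_singleton_self a) (Finset.notMem_erase a τ)

/-- The join of two complexes. -/
def joinComplex (ι₁ : V ↪o U) (ι₂ : Q ↪o U) (K : PreAbstractSimplicialComplex V)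
    (M : PreAbstractSimplicialComplex Q) : PreAbstractSimplicialComplex U where
  faces := {σ | σ.Nonempty ∧ part ι₁ σ ∈ simplices K ∧ part ι₂ σ ∈ simplices M}
  isRelLowerSet_faces := by
    rintro σ ⟨h0, h1, h2⟩
    exact ⟨h0, fun τ hτ hτ0 => ⟨hτ0, simplices_down K h1 (part_mono ι₁ hτ),
      simplices_down M h2 (part_mono ι₂ hτ)⟩⟩

theorem mem_faces_joinComplex {K : PreAbstractSimplicialComplex V}
    {M : PreAbstractSimplicialComplex Q} {σ : Finset U} :
    σ ∈ (joinComplex ι₁ ι₂ K M).faces ↔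
      σ.Nonempty ∧ part ι₁ σ ∈ simplices K ∧ part ι₂ σ ∈ simplices M := Iff.rfl

theorem simplices_joinComplex (K : PreAbstractSimplicialComplex V)
    (M : PreAbstractSimplicialComplex Q) :
    simplices (joinComplex ι₁ ι₂ K M) = joinSet ι₁ ι₂ (simplices K) (simplices M) := by
  ext σ
  rw [mem_simplices, mem_joinSet, mem_faces_joinComplex]
  constructor
  · rintro (rfl | h)
    · simp [mem_simplices]
    · exact h.2
  · intro h
    rcases σ.eq_empty_or_nonempty with h0 | h0
    · exact Or.inl h0
    · exact Or.inr ⟨h0, h⟩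

theorem preAbstractSimplicialComplex_ext_simplices {K M : PreAbstractSimplicialComplex U}
    (h : simplices K = simplices M) : K = M := by
  have key : ∀ {K M : PreAbstractSimplicialComplex U}, simplices K = simplices M →
      K.faces ⊆ M.faces := fun {K M} h σ hσ =>
    mem_faces_of_mem_simplices (h ▸ Or.inr hσ : σ ∈ simplices M) (K.nonempty_of_mem hσ)
  exact PreAbstractSimplicialComplex.ext (Set.Subset.antisymm (key h) (key h.symm))

theorem mem_simplices_link_of_mem {K : PreAbstractSimplicialComplex V} {σ τ : Finset V}
    (hσ : σ ∈ simplices K) :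
    τ ∈ simplices (link K σ) ↔ Disjoint τ σ ∧ τ ∪ σ ∈ simplices K := by
  rw [mem_simplices]
  rcases τ.eq_empty_or_nonempty with rfl | h0
  · simpa using hσ
  · constructor
    · rintro (h | h)
      · exact absurd h h0.ne_empty
      · exact ⟨h.2.1, Or.inr h.2.2⟩
    · exact fun h => Or.inr ⟨h0, h.1, mem_faces_of_mem_simplices h.2
        (h0.mono Finset.subset_union_left)⟩

theorem link_empty (K : PreAbstractSimplicialComplex V) : link K ∅ = K :=
  preAbstractSimplicialComplex_ext_simplices (Set.ext fun τ => by
    rw [mem_simplices_link_of_mem (Or.inl rfl)]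
    simp)

theorem link_joinComplex (h : IsOrderedSum ι₁ ι₂) {K : PreAbstractSimplicialComplex V}
    {M : PreAbstractSimplicialComplex Q} {σ : Finset U}
    (hσ : σ ∈ simplices (joinComplex ι₁ ι₂ K M)) :
    link (joinComplex ι₁ ι₂ K M) σ =
      joinComplex ι₁ ι₂ (link K (part ι₁ σ)) (link M (part ι₂ σ)) := by
  apply preAbstractSimplicialComplex_ext_simplices
  ext τ
  have hσ' := hσ
  rw [simplices_joinComplex, mem_joinSet] at hσ'
  rw [mem_simplices_link_of_mem hσ, simplices_joinComplex, simplices_joinComplex, mem_joinSet,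
    mem_joinSet, mem_simplices_link_of_mem hσ'.1, mem_simplices_link_of_mem hσ'.2, h.disjoint_iff,
    part_union, part_union]
  tauto

theorem deleteVertex_joinComplex (K : PreAbstractSimplicialComplex V)
    (M : PreAbstractSimplicialComplex Q) (v : V) :
    deleteVertex (joinComplex ι₁ ι₂ K M) (ι₁ v) = joinComplex ι₁ ι₂ (deleteVertex K v) M := by
  have hdel : ∀ {W : Type} [DecidableEq W] (K : PreAbstractSimplicialComplex W) (w : W)
      (τ : Finset W), τ ∈ simplices (deleteVertex K w) ↔ τ ∈ simplices K ∧ w ∉ τ := by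
    intro W _ K w τ
    rcases τ.eq_empty_or_nonempty with rfl | h0
    · simp [mem_simplices]
    · exact ⟨fun h => ⟨Or.inr (mem_faces_of_mem_simplices h h0).1,
        (mem_faces_of_mem_simplices h h0).2⟩,
        fun h => Or.inr ⟨mem_faces_of_mem_simplices h.1 h0, h.2⟩⟩
  apply preAbstractSimplicialComplex_ext_simplices
  ext τ
  rw [hdel, simplices_joinComplex, simplices_joinComplex, mem_joinSet, mem_joinSet, hdel, mem_part]
  tauto

theorem cone_joinComplex (h : IsOrderedSum ι₁ ι₂) (K : PreAbstractSimplicialComplex V)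
    (M : PreAbstractSimplicialComplex Q) (v : V) :
    cone (ι₁ v) (joinComplex ι₁ ι₂ K M) = joinComplex ι₁ ι₂ (cone v K) M := by
  apply preAbstractSimplicialComplex_ext_simplices
  ext τ
  rw [mem_simplices_cone, simplices_joinComplex, simplices_joinComplex, mem_joinSet, mem_joinSet,
    mem_simplices_cone, part_erase_self, h.part_right_erase]

theorem link_joinComplex_singleton (h : IsOrderedSum ι₁ ι₂) {K : PreAbstractSimplicialComplex V}
    (M : PreAbstractSimplicialComplex Q) {v : V} (hv : {v} ∈ K.faces) :
    link (joinComplex ι₁ ι₂ K M) {ι₁ v} = joinComplex ι₁ ι₂ (link K {v}) M := by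
  have h1 : part ι₁ {ι₁ v} = {v} := part_map_self ι₁ {v}
  have h2 : part ι₂ {ι₁ v} = ∅ := h.part_right_map {v}
  rw [link_joinComplex h, h1, h2, link_empty]
  rw [simplices_joinComplex, mem_joinSet, h1, h2]
  exact ⟨Or.inr hv, Or.inl rfl⟩

theorem mem_simplices_joinComplex_map_left (h : IsOrderedSum ι₁ ι₂)
    {K : PreAbstractSimplicialComplex V} {M : PreAbstractSimplicialComplex Q} {σ : Finset V} :
    σ.map ι₁.toEmbedding ∈ simplices (joinComplex ι₁ ι₂ K M) ↔ σ ∈ simplices K := by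
  rw [simplices_joinComplex, mem_joinSet, part_map_self, h.part_right_map]
  exact and_iff_left (Or.inl rfl)

theorem mem_simplices_joinComplex_map_right (h : IsOrderedSum ι₁ ι₂)
    {K : PreAbstractSimplicialComplex V} {M : PreAbstractSimplicialComplex Q} {σ : Finset Q} :
    σ.map ι₂.toEmbedding ∈ simplices (joinComplex ι₁ ι₂ K M) ↔ σ ∈ simplices M := by
  rw [simplices_joinComplex, mem_joinSet, part_map_self, h.part_left_map]
  exact and_iff_right (Or.inl rfl)

theorem mem_faces_iff_mem_simplices {K : PreAbstractSimplicialComplex V} {σ : Finset V}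
    (h0 : σ.Nonempty) : σ ∈ K.faces ↔ σ ∈ simplices K :=
  ⟨Or.inr, fun h => mem_faces_of_mem_simplices h h0⟩

theorem mem_faces_joinComplex_map_left (h : IsOrderedSum ι₁ ι₂)
    {K : PreAbstractSimplicialComplex V} {M : PreAbstractSimplicialComplex Q} {σ : Finset V}
    (h0 : σ.Nonempty) : σ.map ι₁.toEmbedding ∈ (joinComplex ι₁ ι₂ K M).faces ↔ σ ∈ K.faces := by
  rw [mem_faces_iff_mem_simplices (Finset.map_nonempty.2 h0),
    mem_simplices_joinComplex_map_left h, mem_faces_iff_mem_simplices h0]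

theorem mem_faces_joinComplex_map_right (h : IsOrderedSum ι₁ ι₂)
    {K : PreAbstractSimplicialComplex V} {M : PreAbstractSimplicialComplex Q} {σ : Finset Q}
    (h0 : σ.Nonempty) : σ.map ι₂.toEmbedding ∈ (joinComplex ι₁ ι₂ K M).faces ↔ σ ∈ M.faces := by
  rw [mem_faces_iff_mem_simplices (Finset.map_nonempty.2 h0),
    mem_simplices_joinComplex_map_right h, mem_faces_iff_mem_simplices h0]

theorem IsFlag.joinComplex (h : IsOrderedSum ι₁ ι₂) {K : PreAbstractSimplicialComplex V}
    {M : PreAbstractSimplicialComplex Q} (hK : IsFlag K) (hM : IsFlag M) :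
    IsFlag (joinComplex ι₁ ι₂ K M) := by
  intro σ h0 hs hst
  refine ⟨h0, ?_, ?_⟩
  · rcases (part ι₁ σ).eq_empty_or_nonempty with h1 | h1
    · exact Or.inl h1
    refine Or.inr (hK _ h1 (fun s hs' => ?_) fun s hs' t ht' hne => ?_)
    · exact (mem_faces_joinComplex_map_left h (Finset.singleton_nonempty s)).1
        (hs _ (mem_part.1 hs'))
    · refine (mem_faces_joinComplex_map_left (M := M) h (Finset.insert_nonempty _ _)).1 ?_
      rw [map_pair]
      exact hst _ (mem_part.1 hs') _ (mem_part.1 ht') (ι₁.injective.ne hne)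
  · rcases (part ι₂ σ).eq_empty_or_nonempty with h1 | h1
    · exact Or.inl h1
    refine Or.inr (hM _ h1 (fun s hs' => ?_) fun s hs' t ht' hne => ?_)
    · exact (mem_faces_joinComplex_map_right h (Finset.singleton_nonempty s)).1
        (hs _ (mem_part.1 hs'))
    · refine (mem_faces_joinComplex_map_right (K := K) h (Finset.insert_nonempty _ _)).1 ?_
      rw [map_pair]
      exact hst _ (mem_part.1 hs') _ (mem_part.1 ht') (ι₂.injective.ne hne)

theorem IsFullSubcomplex.joinComplex (h : IsOrderedSum ι₁ ι₂)
    {K K' : PreAbstractSimplicialComplex V} (hK : IsFullSubcomplex K K')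
    (M : PreAbstractSimplicialComplex Q) :
    IsFullSubcomplex (joinComplex ι₁ ι₂ K M) (joinComplex ι₁ ι₂ K' M) := by
  refine ⟨fun σ hσ => ⟨hσ.1, simplices_mono hK.1 hσ.2.1, hσ.2.2⟩, fun σ hσ hs =>
    ⟨hσ.1, ?_, hσ.2.2⟩⟩
  rcases (part ι₁ σ).eq_empty_or_nonempty with h1 | h1
  · exact Or.inl h1
  · refine Or.inr (hK.2 _ (mem_faces_of_mem_simplices hσ.2.1 h1) fun s hs' => ?_)
    exact (mem_faces_joinComplex_map_left h (Finset.singleton_nonempty s)).1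
      (hs _ (mem_part.1 hs'))

theorem IsGHS.exists_link {S : PreAbstractSimplicialComplex V} {n : ℕ} (hS : IsGHS S n)
    {σ : Finset V} (hσ : σ ∈ simplices S) :
    ∃ j, j + σ.card = n ∧ HasHomologyOfSphere (link S σ) j := by
  rcases hσ with rfl | hσ
  · exact ⟨n, by simp, by rw [link_empty]; exact hS.1⟩
  · exact hS.2 σ hσ

/-- A link in the join is the join of two links, and the second one shifts the homology of the
first. The empty simplex is treated along with the others and gives the homology of the join itself.
-/
theorem IsGHS.joinComplex (h : IsOrderedSum ι₁ ι₂) {S : PreAbstractSimplicialComplex V} {n : ℕ}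
    (hS : IsGHS S n) {M : PreAbstractSimplicialComplex Q} {k : ℕ}
    (hM : ∀ τ ∈ simplices M, ∃ j, j + τ.card = k ∧ JoinShifts ι₁ ι₂ (simplices (link M τ)) j) :
    IsGHS (joinComplex ι₁ ι₂ S M) (n + k) := by
  have key : ∀ σ ∈ simplices (_root_.joinComplex ι₁ ι₂ S M), ∃ j, j + σ.card = n + k ∧
      HasHomologyOfSphere (link (_root_.joinComplex ι₁ ι₂ S M) σ) j := by
    intro σ hσ
    have hσ' := hσ
    rw [simplices_joinComplex, mem_joinSet] at hσ'
    obtain ⟨j1, hj1, h1⟩ := hS.exists_link hσ'.1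
    obtain ⟨j2, hj2, h2⟩ := hM _ hσ'.2
    refine ⟨j1 + j2, ?_, fun m => ?_⟩
    · rw [h.card_eq]
      omega
    · rw [link_joinComplex h hσ, simplices_joinComplex]
      obtain ⟨h3, h4⟩ := h2 _ (isLowerSet_simplices (link S (part ι₁ σ)))
      rcases lt_or_ge m j2 with hm | hm
      · rw [h4 m hm, if_neg (by omega)]
      · obtain ⟨m, rfl⟩ := Nat.exists_eq_add_of_le' hm
        rw [h3, h1]
        simp
  refine ⟨?_, fun σ hσ => key σ (Or.inr hσ)⟩
  obtain ⟨j, hj, hj'⟩ := key ∅ (Or.inl rfl)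
  rw [link_empty] at hj'
  rw [Finset.card_empty, add_zero] at hj
  exact hj ▸ hj'

end Join

/-! ### The pentagon -/

section Pentagon

/-- The pentagon. -/
def pentagon : AbstractSimplicialComplex (Fin 5) where
  faces := {σ | σ.Nonempty ∧ ∃ i, σ ⊆ {i, i + 1}}
  isRelLowerSet_faces := by
    rintro σ ⟨h0, i, hi⟩
    exact ⟨h0, fun τ hτ hτ0 => ⟨hτ0, i, hτ.trans hi⟩⟩
  singleton_mem := fun v => ⟨Finset.singleton_nonempty v, v, by simp⟩

theorem mem_simplices_pentagon {σ : Finset (Fin 5)} :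
    σ ∈ simplices pentagon.toPreAbstractSimplicialComplex ↔ ∃ i, σ ⊆ {i, i + 1} := by
  rcases σ.eq_empty_or_nonempty with rfl | h0
  · exact ⟨fun _ => ⟨0, Finset.empty_subset _⟩, fun _ => Or.inl rfl⟩
  · exact ⟨fun h => (mem_faces_of_mem_simplices h h0).2, fun h => Or.inr ⟨h0, h⟩⟩

theorem isFlag_pentagon : IsFlag pentagon.toPreAbstractSimplicialComplex := by
  have h : ∀ σ : Finset (Fin 5), (∀ s ∈ σ, ∀ t ∈ σ, s ≠ t →
      ∃ i : Fin 5, {s, t} ⊆ ({i, i + 1} : Finset (Fin 5))) →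
      ∃ i, σ ⊆ {i, i + 1} := by decide
  exact fun σ h0 _ hst => ⟨h0, h σ fun s hs t ht hne => (hst s hs t ht hne).2⟩

theorem pentagon_simplices_cases : ∀ σ : Finset (Fin 5), (∃ i, σ ⊆ {i, i + 1}) →
    σ = ∅ ∨ (∃ i, σ = {i}) ∨ ∃ i, σ = {i, i + 1} := by decide

variable {V U : Type} [Fintype V] [LinearOrder V] [Fintype U] [LinearOrder U]
  {ι₁ : V ↪o U} {ι₂ : Fin 5 ↪o U}

/-- The link of the vertex 4 is the pair of points 0, 3. Deleting 4 leaves the path 0-1-2-3, whose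
join is acyclic: deleting 0 leaves a cone with apex 2, and the link of 0 is a cone with apex 1. -/
theorem joinShifts_pentagon (h : IsOrderedSum ι₁ ι₂) :
    JoinShifts ι₁ ι₂ (simplices pentagon.toPreAbstractSimplicialComplex) 2 := by
  have hlow := isLowerSet_simplices pentagon.toPreAbstractSimplicialComplex
  refine JoinShifts.succ h hlow 4 ?_ fun F hF => ?_
  · convert joinShifts_two_points h (a := 0) (b := 3) (by decide) using 1
    ext τ
    have h1 : ∀ τ : Finset (Fin 5), (4 ∉ τ ∧ ∃ i, insert 4 τ ⊆ {i, i + 1}) ↔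
      τ = ∅ ∨ τ = {0} ∨ τ = {3} := by decide
    exact (and_congr_right fun _ => mem_simplices_pentagon).trans (h1 τ)
  · have hd := isLowerSet_deletion hlow 4
    refine isRationallyAcyclic_of_deletion_of_link (ordConnected_joinSet hF hd) (ι₂ 0) ?_ ?_
    · rw [deletion_joinSet]
      refine isRationallyAcyclic_joinSet_of_cone h hF (isLowerSet_deletion hd 0) 2 fun τ => ?_
      have h1 : ∀ τ : Finset (Fin 5), (((∃ i, τ ⊆ {i, i + 1}) ∧ 4 ∉ τ) ∧ 0 ∉ τ) ↔
        (((∃ i, τ.erase 2 ⊆ {i, i + 1}) ∧ 4 ∉ τ.erase 2) ∧ 0 ∉ τ.erase 2) := by decide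
      simp only [Set.mem_ofPred_eq, mem_simplices_pentagon]
      exact h1 τ
    · rw [linkSet_joinSet h]
      refine isRationallyAcyclic_joinSet_of_cone h hF (isLowerSet_linkSet hd 0) 1 fun τ => ?_
      have h1 : ∀ τ : Finset (Fin 5), (0 ∉ τ ∧ (∃ i, insert 0 τ ⊆ {i, i + 1}) ∧ 4 ∉ insert 0 τ) ↔
        (0 ∉ τ.erase 1 ∧ (∃ i, insert 0 (τ.erase 1) ⊆ {i, i + 1}) ∧
          4 ∉ insert 0 (τ.erase 1)) := by decide
      simp only [linkSet, Set.mem_ofPred_eq, mem_simplices_pentagon]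
      exact h1 τ

theorem joinShifts_link_pentagon (h : IsOrderedSum ι₁ ι₂) {σ : Finset (Fin 5)}
    (hσ : σ ∈ simplices pentagon.toPreAbstractSimplicialComplex) :
    ∃ j, j + σ.card = 2 ∧
      JoinShifts ι₁ ι₂ (simplices (link pentagon.toPreAbstractSimplicialComplex σ)) j := by
  have hl : ∀ τ, τ ∈ simplices (link pentagon.toPreAbstractSimplicialComplex σ) ↔
      Disjoint τ σ ∧ ∃ i, τ ∪ σ ⊆ {i, i + 1} := fun τ => by
    rw [mem_simplices_link_of_mem hσ, mem_simplices_pentagon]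
  rcases pentagon_simplices_cases σ (mem_simplices_pentagon.1 hσ) with rfl | ⟨i, rfl⟩ | ⟨i, rfl⟩
  · refine ⟨2, rfl, ?_⟩
    rw [link_empty]
    exact joinShifts_pentagon h
  · refine ⟨1, rfl, ?_⟩
    -- In `Fin 5` the predecessor of `i` is `i + 4`.
    have h1 : ∀ (i : Fin 5) (τ : Finset (Fin 5)), (Disjoint τ {i} ∧ ∃ j, τ ∪ {i} ⊆ {j, j + 1}) ↔
      τ = ∅ ∨ τ = {i + 4} ∨ τ = {i + 1} := by decide
    have h2 : ∀ i : Fin 5, i + 4 ≠ i + 1 := by decide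
    convert joinShifts_two_points h (h2 i) using 1
    ext τ
    exact (hl τ).trans (h1 i τ)
  · refine ⟨0, ?_, ?_⟩
    · have h1 : ∀ i : Fin 5, 0 + ({i, i + 1} : Finset (Fin 5)).card = 2 := by decide
      exact h1 i
    have h1 : ∀ (i : Fin 5) (τ : Finset (Fin 5)),
      (Disjoint τ {i, i + 1} ∧ ∃ j, τ ∪ {i, i + 1} ⊆ {j, j + 1}) ↔ τ = ∅ := by decide
    convert joinShifts_singleton_empty h using 1
    ext τ
    exact (hl τ).trans (h1 i τ)

end Pentagon

/-! ### Tensor products of chains -/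

section Tensor

theorem EllTwo.summable_tensor {A B : Type} (f : EllTwo A) (ζ : EllTwo B) :
    Summable fun p : A × B => (f p.1 * ζ p.2) * (f p.1 * ζ p.2) :=
  ((EllTwo.summable_mul f f).mul_of_nonneg (EllTwo.summable_mul ζ ζ)
    (fun a => mul_self_nonneg (f a)) (fun b => mul_self_nonneg (ζ b))).congr fun p => by ring

/-- The tensor product with a fixed element of `ℓ²(B)`. -/
def EllTwo.tensor {A B : Type} (ζ : EllTwo B) : EllTwo A →L[ℝ] EllTwo (A × B) :=
  LinearMap.mkContinuous
    { toFun := fun f => EllTwo.ofFun (fun p => f p.1 * ζ p.2) (EllTwo.summable_tensor f ζ)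
      map_add' := fun f g => by ext; simp [add_mul]
      map_smul' := fun c f => by ext; simp [mul_assoc] } ‖ζ‖ (fun f => by
        refine le_of_sq_le_sq ?_ (by positivity)
        rw [mul_pow, EllTwo.norm_sq, EllTwo.norm_sq, EllTwo.norm_sq, mul_comm,
          (EllTwo.summable_mul f f).tsum_mul_tsum (EllTwo.summable_mul ζ ζ)
            (((EllTwo.summable_mul f f).mul_of_nonneg (EllTwo.summable_mul ζ ζ)
              (fun a => mul_self_nonneg (f a)) (fun b => mul_self_nonneg (ζ b))))]
        refine le_of_eq (tsum_congr fun p => ?_)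
        show (f p.1 * ζ p.2) * (f p.1 * ζ p.2) = _
        ring)

variable {V Q U : Type} [Fintype V] [LinearOrder V] [Fintype Q] [LinearOrder Q]
  [Fintype U] [LinearOrder U] {ι₁ : V ↪o U} {ι₂ : Q ↪o U}

theorem IsOrderedSum.sum_filter (h : IsOrderedSum ι₁ ι₂) (p : U → Prop) [DecidablePred p]
    (φ : U → ℝ) : ∑ s with p s, φ s = ∑ x with p (ι₁ x), φ (ι₁ x) + ∑ y with p (ι₂ y), φ (ι₂ y) := by
  rw [Finset.sum_filter, Finset.sum_filter, Finset.sum_filter]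
  have hb : Function.Bijective (Sum.elim ι₁ ι₂) :=
    ⟨Function.Injective.sumElim ι₁.injective ι₂.injective h.ne, fun u => by
      rcases h.cover u with ⟨x, hx⟩ | ⟨y, hy⟩
      · exact ⟨Sum.inl x, hx⟩
      · exact ⟨Sum.inr y, hy⟩⟩
  rw [← Equiv.sum_comp (Equiv.ofBijective _ hb), Fintype.sum_sum_type]
  rfl

theorem IsOrderedSum.sum_notMem (h : IsOrderedSum ι₁ ι₂) (τ : Finset U) (φ : U → ℝ) :
    ∑ s with s ∉ τ, φ s =
      ∑ x with x ∉ part ι₁ τ, φ (ι₁ x) + ∑ y with y ∉ part ι₂ τ, φ (ι₂ y) := by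
  rw [h.sum_filter]
  simp only [mem_part]

theorem IsOrderedSum.sum_mem (h : IsOrderedSum ι₁ ι₂) (τ : Finset U) (φ : U → ℝ) :
    ∑ s ∈ τ, φ s = ∑ x ∈ part ι₁ τ, φ (ι₁ x) + ∑ y ∈ part ι₂ τ, φ (ι₂ y) := by
  have h1 : ∑ s ∈ τ, φ s = ∑ s with s ∈ τ, φ s := by simp
  rw [h1, h.sum_filter]
  rfl

theorem IsOrderedSum.incidence_left (h : IsOrderedSum ι₁ ι₂) (τ : Finset U) (x : V) :
    incidence ℝ τ (ι₁ x) = incidence ℝ (part ι₁ τ) x := by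
  rw [incidence, incidence, h.card_eq]
  have h1 : part ι₁ (τ.filter fun t => t < ι₁ x) = (part ι₁ τ).filter fun t => t < x := by
    ext; simp
  have h2 : part ι₂ (τ.filter fun t => t < ι₁ x) = ∅ := by
    ext y
    simp [(h.lt x y).le]
  rw [h1, h2, Finset.card_empty, add_zero]

/-- All vertices of the first factor precede y; this is the sign of the Leibniz rule. -/
theorem IsOrderedSum.incidence_right (h : IsOrderedSum ι₁ ι₂) (τ : Finset U) (y : Q) :
    incidence ℝ τ (ι₂ y) = (-1) ^ (part ι₁ τ).card * incidence ℝ (part ι₂ τ) y := by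
  rw [incidence, incidence, h.card_eq, pow_add]
  have h1 : part ι₁ (τ.filter fun t => t < ι₂ y) = part ι₁ τ := by
    ext x
    simp [h.lt x y]
  have h2 : part ι₂ (τ.filter fun t => t < ι₂ y) = (part ι₂ τ).filter fun t => t < y := by
    ext; simp
  rw [h1, h2]

/-- The join of two complexes, as a complex with vertex set `U`. -/
def joinAbstract (h : IsOrderedSum ι₁ ι₂) (L : AbstractSimplicialComplex V)
    (M : AbstractSimplicialComplex Q) : AbstractSimplicialComplex U where
  toPreAbstractSimplicialComplex :=
    joinComplex ι₁ ι₂ L.toPreAbstractSimplicialComplex M.toPreAbstractSimplicialComplex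
  singleton_mem := fun u => by
    rcases h.cover u with ⟨x, rfl⟩ | ⟨y, rfl⟩
    · exact (mem_faces_joinComplex_map_left h (Finset.singleton_nonempty x)).2 (L.singleton_mem x)
    · exact (mem_faces_joinComplex_map_right h (Finset.singleton_nonempty y)).2 (M.singleton_mem y)

variable {L : AbstractSimplicialComplex V} {M : AbstractSimplicialComplex Q}

theorem edgeFull_joinAbstract_left (h : IsOrderedSum ι₁ ι₂) (L : AbstractSimplicialComplex V)
    (M : AbstractSimplicialComplex Q) : EdgeFull L (joinAbstract h L M) ι₁ := fun s t => by
  rw [← map_pair]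
  exact (mem_faces_joinComplex_map_left h (Finset.insert_nonempty s _)).symm

theorem edgeFull_joinAbstract_right (h : IsOrderedSum ι₁ ι₂) (L : AbstractSimplicialComplex V)
    (M : AbstractSimplicialComplex Q) : EdgeFull M (joinAbstract h L M) ι₂ := fun s t => by
  rw [← map_pair]
  exact (mem_faces_joinComplex_map_right h (Finset.insert_nonempty s _)).symm

/-- The projection of the group of a join onto the first factor. -/
def joinFst (h : IsOrderedSum ι₁ ι₂) (L : AbstractSimplicialComplex V)
    (M : AbstractSimplicialComplex Q) : RACG (joinAbstract h L M) →* RACG L :=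
  racRetraction (edgeFull_joinAbstract_left h L M)

/-- The projection of the group of a join onto the second factor. -/
def joinSnd (h : IsOrderedSum ι₁ ι₂) (L : AbstractSimplicialComplex V)
    (M : AbstractSimplicialComplex Q) : RACG (joinAbstract h L M) →* RACG M :=
  racRetraction (edgeFull_joinAbstract_right h L M)

section

variable (h : IsOrderedSum ι₁ ι₂)

@[simp]
theorem joinFst_gen_left (x : V) : joinFst h L M (gen _ (ι₁ x)) = gen L x := by
  simp [joinFst, genOrOne_apply]

@[simp]
theorem joinFst_gen_right (y : Q) : joinFst h L M (gen _ (ι₂ y)) = 1 := by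
  simp only [joinFst, racRetraction_gen]
  exact genOrOne_of_notMem fun ⟨x, hx⟩ => h.ne x y hx

@[simp]
theorem joinSnd_gen_left (x : V) : joinSnd h L M (gen _ (ι₁ x)) = 1 := by
  simp only [joinSnd, racRetraction_gen]
  exact genOrOne_of_notMem fun ⟨y, hy⟩ => h.ne x y hy.symm

@[simp]
theorem joinSnd_gen_right (y : Q) : joinSnd h L M (gen _ (ι₂ y)) = gen M y := by
  simp [joinSnd, genOrOne_apply]

/-- The inclusion of the group of the first factor of a join. -/
def joinInl (h : IsOrderedSum ι₁ ι₂) (L : AbstractSimplicialComplex V)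
    (M : AbstractSimplicialComplex Q) : RACG L →* RACG (joinAbstract h L M) :=
  racInclusion (edgeFull_joinAbstract_left h L M)

/-- The inclusion of the group of the second factor of a join. -/
def joinInr (h : IsOrderedSum ι₁ ι₂) (L : AbstractSimplicialComplex V)
    (M : AbstractSimplicialComplex Q) : RACG M →* RACG (joinAbstract h L M) :=
  racInclusion (edgeFull_joinAbstract_right h L M)

@[simp]
theorem joinInl_gen (x : V) : joinInl h L M (gen L x) = gen _ (ι₁ x) := racInclusion_gen _ x

@[simp]
theorem joinInr_gen (y : Q) : joinInr h L M (gen M y) = gen _ (ι₂ y) := racInclusion_gen _ y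

@[simp]
theorem joinFst_joinInl (a : RACG L) : joinFst h L M (joinInl h L M a) = a :=
  racRetraction_racInclusion _ a

@[simp]
theorem joinSnd_joinInr (b : RACG M) : joinSnd h L M (joinInr h L M b) = b :=
  racRetraction_racInclusion _ b

@[simp]
theorem joinFst_joinInr (b : RACG M) : joinFst h L M (joinInr h L M b) = 1 := by
  have : (joinFst h L M).comp (joinInr h L M) = 1 := racHom_ext fun s => by simp
  exact DFunLike.congr_fun this b

@[simp]
theorem joinSnd_joinInl (a : RACG L) : joinSnd h L M (joinInl h L M a) = 1 := by
  have : (joinSnd h L M).comp (joinInl h L M) = 1 := racHom_ext fun s => by simp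
  exact DFunLike.congr_fun this a

/-- In a join every vertex of one factor is connected by an edge to every vertex of the other, so
generators of different factors commute; words follow by induction. -/
theorem commute_joinInl_joinInr (a : RACG L) (b : RACG M) :
    Commute (joinInl h L M a) (joinInr h L M b) := by
  have key : ∀ x y, Commute (gen (joinAbstract h L M) (ι₁ x)) (gen _ (ι₂ y)) := by
    intro x y
    refine commute_gen ⟨Finset.insert_nonempty _ _, ?_, ?_⟩
    · have : part ι₁ {ι₁ x, ι₂ y} = {x} := by
        ext z
        simp [h.ne]
      rw [this]
      exact Or.inr (L.singleton_mem x)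
    · have : part ι₂ {ι₁ x, ι₂ y} = {y} := by
        ext z
        simp [(h.ne x z).symm]
      rw [this]
      exact Or.inr (M.singleton_mem y)
  refine (racMatrix L).toCoxeterSystem.simple_induction_left
    (p := fun a => Commute (joinInl h L M a) (joinInr h L M b)) a ?_ ?_
  · rw [map_one]
    exact Commute.one_left _
  intro w x hw
  show Commute (joinInl h L M (gen L x * w)) _
  rw [map_mul]
  refine Commute.mul_left ?_ hw
  refine (racMatrix M).toCoxeterSystem.simple_induction_left
    (p := fun b => Commute (joinInl h L M (gen L x)) (joinInr h L M b)) b ?_ ?_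
  · rw [map_one]
    exact Commute.one_right _
  intro w' y hw'
  show Commute _ (joinInr h L M (gen M y * w'))
  rw [map_mul]
  refine Commute.mul_right ?_ hw'
  have h1 := joinInl_gen (L := L) (M := M) h x
  have h2 := joinInr_gen (L := L) (M := M) h y
  have := key x y
  rw [← h1, ← h2] at this
  exact this

theorem joinInl_mul_joinInr (g : RACG (joinAbstract h L M)) :
    joinInl h L M (joinFst h L M g) * joinInr h L M (joinSnd h L M g) = g := by
  have : ((joinInl h L M).noncommCoprod (joinInr h L M) (commute_joinInl_joinInr h)).comp
      ((joinFst h L M).prod (joinSnd h L M)) = MonoidHom.id _ := by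
    refine racHom_ext fun s => ?_
    rcases h.cover s with ⟨x, rfl⟩ | ⟨y, rfl⟩ <;> simp
  exact DFunLike.congr_fun this g

theorem injective_joinFst_joinSnd :
    Function.Injective fun g => (joinFst h L M g, joinSnd h L M g) := by
  intro g g' hg
  rw [Prod.mk.injEq] at hg
  rw [← joinInl_mul_joinInr h g, hg.1, hg.2, joinInl_mul_joinInr]

/-- The exterior product with a chain of the second factor of a join. -/
def tensorOp (z : ChainSpace M) : ChainSpace L →L[ℝ] ChainSpace (joinAbstract h L M) :=
  EllTwoPow.pi fun ρ => EllTwo.pullback _ (injective_joinFst_joinSnd h) ∘L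
    EllTwo.tensor (z (part ι₂ ρ)) ∘L EllTwoPow.coord (part ι₁ ρ)

theorem tensorOp_apply (z : ChainSpace M) (c : ChainSpace L) (ρ : Finset U)
    (g : RACG (joinAbstract h L M)) : tensorOp h z c ρ g =
      c (part ι₁ ρ) (joinFst h L M g) * z (part ι₂ ρ) (joinSnd h L M g) := rfl

variable {F : Set (Finset V)} {G : Set (Finset Q)} {i j : ℕ}

theorem tensorOp_mem_ellTwoChains {z : ChainSpace M} (hz : z ∈ ellTwoChains M G j)
    {c : ChainSpace L} (hc : c ∈ ellTwoChains L F i) :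
    tensorOp h z c ∈ ellTwoChains (joinAbstract h L M) (joinSet ι₁ ι₂ F G) (i + j) := by
  refine ⟨fun ρ hρ => ?_, fun ρ s hs g => ?_⟩
  · ext g
    rw [tensorOp_apply]
    by_cases h1 : part ι₁ ρ ∈ F ∧ (part ι₁ ρ).card = i
    · rw [hz.1 (part ι₂ ρ)]
      · exact mul_zero _
      · rintro ⟨h2, h3⟩
        exact hρ ⟨⟨h1.1, h2⟩, by rw [h.card_eq, h1.2, h3]⟩
    · rw [hc.1 _ h1]
      exact zero_mul _
  · rw [tensorOp_apply, tensorOp_apply, map_mul, map_mul]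
    rcases h.cover s with ⟨x, rfl⟩ | ⟨y, rfl⟩
    · rw [joinFst_gen_left, joinSnd_gen_left, mul_one, hc.2 _ x (mem_part.2 hs), neg_mul]
    · rw [joinFst_gen_right, joinSnd_gen_right, mul_one, hz.2 _ y (mem_part.2 hs), mul_neg]

/-- Leibniz rule: the terms that add a vertex of the second factor sum to ± c times ∂z, which is
zero. -/
theorem boundaryOp_tensorOp {z : ChainSpace M} (hz : z ∈ ellTwoCycles M G j)
    (c : ChainSpace L) :
    boundaryOp (joinAbstract h L M) (joinSet ι₁ ι₂ F G) (tensorOp h z c) =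
      tensorOp h z (boundaryOp L F c) := by
  rw [mem_ellTwoCycles] at hz
  ext ρ g
  rw [boundaryOp_apply_apply, tensorOp_apply, boundaryOp_apply_apply]
  by_cases h1 : part ι₁ ρ ∈ F
  · by_cases h2 : part ι₂ ρ ∈ G
    · have h3 : boundaryOp M G z (part ι₂ ρ) (joinSnd h L M g) = 0 := by
        rw [hz.2]
        rfl
      rw [boundaryOp_apply_apply, simplicialBoundary_of_mem h2] at h3
      rw [simplicialBoundary_of_mem (mem_joinSet.2 ⟨h1, h2⟩), simplicialBoundary_of_mem h1,
        h.sum_notMem, Finset.sum_mul]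
      have h4 : ∀ y, incidence ℝ ρ (ι₂ y) • tensorOp h z c (insert (ι₂ y) ρ) g =
          ((-1) ^ (part ι₁ ρ).card * c (part ι₁ ρ) (joinFst h L M g)) *
            (incidence ℝ (part ι₂ ρ) y • z (insert y (part ι₂ ρ)) (joinSnd h L M g)) := by
        intro y
        rw [tensorOp_apply, h.part_left_insert, part_insert_self, h.incidence_right,
          smul_eq_mul, smul_eq_mul]
        ring
      rw [Finset.sum_congr rfl fun y _ => h4 y, ← Finset.mul_sum, h3, mul_zero, add_zero]
      refine Finset.sum_congr rfl fun x _ => ?_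
      rw [tensorOp_apply, h.part_right_insert, part_insert_self, h.incidence_left,
        smul_eq_mul, smul_eq_mul, mul_assoc]
    · rw [simplicialBoundary_of_notMem (fun h3 => h2 h3.2), ellTwoChains_supp_apply hz.1 _ _ h2,
        mul_zero]
  · rw [simplicialBoundary_of_notMem (fun h3 => h1 h3.1), simplicialBoundary_of_notMem h1, zero_mul]

theorem coboundaryOp_tensorOp {z : ChainSpace M} (hz : coboundaryOp M G z = 0)
    {c : ChainSpace L} (hc : coboundaryOp L F c = 0) :
    coboundaryOp (joinAbstract h L M) (joinSet ι₁ ι₂ F G) (tensorOp h z c) = 0 := by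
  ext ρ g
  by_cases hρ : ρ ∈ joinSet ι₁ ι₂ F G
  · have h1 : coboundaryOp L F c (part ι₁ ρ) (joinFst h L M g) = 0 := by
      rw [hc]
      rfl
    have h2 : coboundaryOp M G z (part ι₂ ρ) (joinSnd h L M g) = 0 := by
      rw [hz]
      rfl
    rw [coboundaryOp_apply_of_mem hρ.1] at h1
    rw [coboundaryOp_apply_of_mem hρ.2] at h2
    rw [coboundaryOp_apply_of_mem hρ, h.sum_mem]
    have h3 : ∀ x ∈ part ι₁ ρ, incidence ℝ (ρ.erase (ι₁ x)) (ι₁ x) *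
        (tensorOp h z c (ρ.erase (ι₁ x)) g - tensorOp h z c (ρ.erase (ι₁ x)) (g * gen _ (ι₁ x))) =
        (incidence ℝ ((part ι₁ ρ).erase x) x * (c ((part ι₁ ρ).erase x) (joinFst h L M g) -
          c ((part ι₁ ρ).erase x) (joinFst h L M g * gen L x))) *
            z (part ι₂ ρ) (joinSnd h L M g) := by
      intro x _
      rw [h.incidence_left, tensorOp_apply, tensorOp_apply, map_mul, map_mul, joinFst_gen_left,
        joinSnd_gen_left, mul_one, part_erase_self, h.part_right_erase]
      ring
    have h4 : ∀ y ∈ part ι₂ ρ, incidence ℝ (ρ.erase (ι₂ y)) (ι₂ y) *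
        (tensorOp h z c (ρ.erase (ι₂ y)) g - tensorOp h z c (ρ.erase (ι₂ y)) (g * gen _ (ι₂ y))) =
        ((-1) ^ (part ι₁ ρ).card * c (part ι₁ ρ) (joinFst h L M g)) *
        (incidence ℝ ((part ι₂ ρ).erase y) y * (z ((part ι₂ ρ).erase y) (joinSnd h L M g) -
          z ((part ι₂ ρ).erase y) (joinSnd h L M g * gen M y))) := by
      intro y _
      rw [h.incidence_right, tensorOp_apply, tensorOp_apply, map_mul, map_mul, joinFst_gen_right,
        joinSnd_gen_right, mul_one, part_erase_self, h.part_left_erase]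
      ring
    rw [Finset.sum_congr rfl h3, Finset.sum_congr rfl h4, ← Finset.sum_mul, ← Finset.mul_sum, h1, h2]
    show (0 * _ + _ * 0 : ℝ) = 0
    ring
  · rw [coboundaryOp_of_notMem hρ]
    rfl

/-- Exterior multiplication by a cycle is a bounded chain map, so it preserves limits of boundaries.
-/
theorem tensorOp_mem_closure {z : ChainSpace M} (hz : z ∈ ellTwoCycles M G j) {c : ChainSpace L}
    (hc : c ∈ (ellTwoBoundaries L F i).topologicalClosure) :
    tensorOp h z c ∈ (ellTwoBoundaries (joinAbstract h L M)
      (joinSet ι₁ ι₂ F G) (i + j)).topologicalClosure := by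
  refine map_mem_closure (tensorOp h z).continuous hc ?_
  intro u hu
  obtain ⟨y, hy, rfl⟩ := mem_ellTwoBoundaries.1 hu
  refine mem_ellTwoBoundaries.2 ⟨tensorOp h z y, ?_, boundaryOp_tensorOp h hz y⟩
  have := tensorOp_mem_ellTwoChains h (mem_ellTwoCycles.1 hz).1 hy
  rwa [add_right_comm] at this

/-- Choose τ and b with z nonzero there. The product at the join of σ with τ and at the product of a
and b is then a nonzero multiple of the value of c at σ and a. -/
theorem eq_zero_of_tensorOp_eq_zero {z : ChainSpace M} (hz : z ≠ 0) {c : ChainSpace L}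
    (hc : tensorOp h z c = 0) : c = 0 := by
  have : ∃ τ b, z τ b ≠ 0 := by
    by_contra! H
    exact hz (EllTwoPow.ext' H)
  obtain ⟨τ, b, hb⟩ := this
  ext σ a
  have h1 := tensorOp_apply h z c (σ.map ι₁.toEmbedding ∪ τ.map ι₂.toEmbedding)
    (joinInl h L M a * joinInr h L M b)
  rw [hc] at h1
  simp only [part_union, part_map_self, h.part_left_map, h.part_right_map, map_mul,
    joinFst_joinInl, joinFst_joinInr, joinSnd_joinInl, joinSnd_joinInr, mul_one, one_mul,
    Finset.union_empty, Finset.empty_union] at h1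
  exact (mul_eq_zero.1 h1.symm).resolve_right hb

end

end Tensor

/-! ### Descent of the statement III -/

section Descent

/-- The inclusion of the first summand of an ordered sum. -/
def sumLexInl (V Q : Type) [LinearOrder V] [LinearOrder Q] : V ↪o V ⊕ₗ Q where
  toFun := Sum.inlₗ
  inj' := fun _ _ h => Sum.inl_injective (toLex.injective h)
  map_rel_iff' := Sum.Lex.inl_le_inl_iff

/-- The inclusion of the second summand of an ordered sum. -/
def sumLexInr (V Q : Type) [LinearOrder V] [LinearOrder Q] : Q ↪o V ⊕ₗ Q where
  toFun := Sum.inrₗ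
  inj' := fun _ _ h => Sum.inr_injective (toLex.injective h)
  map_rel_iff' := Sum.Lex.inr_le_inr_iff

theorem isOrderedSum_sumLex (V Q : Type) [Fintype V] [LinearOrder V] [Fintype Q] [LinearOrder Q]
    [Fintype (V ⊕ₗ Q)] : IsOrderedSum (sumLexInl V Q) (sumLexInr V Q) where
  lt := fun x y => Sum.Lex.inl_lt_inr x y
  cover := fun u => by
    rcases h : ofLex u with x | y
    · exact Or.inl ⟨x, by rw [← toLex_ofLex u, h]; rfl⟩
    · exact Or.inr ⟨y, by rw [← toLex_ofLex u, h]; rfl⟩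

/-- The join of S with the pentagon is a sphere of dimension two more, and its link, deletion and
cone at v are the joins of those of S. The product of c with z is harmonic of degree m+1 and bounds,
up to closure, on both sides, so III in the higher index makes it zero, and hence c = 0. -/
theorem harmonicIII_of_ambientIII_succ {m : ℕ} (hIII : AmbientIII (m + 1))
    {z : ChainSpace pentagon}
    (hz : z ∈ harmonicCycles pentagon (simplices pentagon.toPreAbstractSimplicialComplex) 1)
    (hz0 : z ≠ 0) : HarmonicIII m := by
  intro V _ _ L S v hL hSL hS hv c hc hcD hcC
  have : Fintype (V ⊕ₗ Fin 5) := inferInstanceAs (Fintype (V ⊕ Fin 5))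
  have h := isOrderedSum_sumLex V (Fin 5)
  set P := pentagon.toPreAbstractSimplicialComplex with hP
  have hlink := link_joinComplex_singleton h P hv
  have hdel := deleteVertex_joinComplex (ι₁ := sumLexInl V (Fin 5)) (ι₂ := sumLexInr V (Fin 5)) S P v
  have hcone := cone_joinComplex h (link S {v}) P v
  have hSL' := hSL.joinComplex h P
  have hL' := hL.joinComplex h isFlag_pentagon
  have hS' := hS.joinComplex h (M := P) fun τ hτ => joinShifts_link_pentagon h hτ
  have hv' : {sumLexInl V (Fin 5) v} ∈
      (joinComplex (sumLexInl V (Fin 5)) (sumLexInr V (Fin 5)) S P).faces :=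
    (mem_faces_joinComplex_map_left h (Finset.singleton_nonempty v)).2 hv
  have hzc := (mem_ellTwoCycles.1 hz.1).1
  have hcomm2 := commute_gen_of_mem_simplices (L := pentagon) (K := P) le_rfl
  have hSv := (((hSL.isFlag hL).isFullSubcomplex_link v).trans hSL).1
  have hcomm1 := commute_gen_of_mem_simplices hSv
  have hcomm : ∀ σ ∈ simplices (joinComplex (sumLexInl V (Fin 5)) (sumLexInr V (Fin 5))
      (link S {v}) P), ∀ s ∈ σ, ∀ t ∈ σ, Commute (gen (joinAbstract h L pentagon) s)
        (gen (joinAbstract h L pentagon) t) :=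
    commute_gen_of_mem_simplices fun σ hσ => ⟨hσ.1, simplices_mono hSv hσ.2.1, hσ.2.2⟩
  have hcz : tensorOp h z c ∈ harmonicCycles (joinAbstract h L pentagon)
      (simplices (joinComplex (sumLexInl V (Fin 5)) (sumLexInr V (Fin 5)) (link S {v}) P))
      (m + 1) := by
    rw [mem_harmonicCycles_iff hcomm, simplices_joinComplex]
    have hc1 := (mem_harmonicCycles_iff hcomm1).1 hc
    refine ⟨tensorOp_mem_ellTwoChains h hzc hc1.1, ?_, ?_⟩
    · rw [boundaryOp_tensorOp h hz.1, hc1.2.1, map_zero]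
    · exact coboundaryOp_tensorOp h ((mem_harmonicCycles_iff hcomm2).1 hz).2.2 hc1.2.2
  have key := hIII _ (joinAbstract h L pentagon) _ _ hL' hSL' hS' hv' (tensorOp h z c)
  rw [hlink, hdel, hcone] at key
  refine eq_zero_of_tensorOp_eq_zero h hz0 (eq_zero_of_mem_harmonicCycles hcz (key hcz.1 ?_ ?_))
  · rw [simplices_joinComplex]
    exact tensorOp_mem_closure h hz.1 hcD
  · rw [simplices_joinComplex]
    exact tensorOp_mem_closure h hz.1 hcC

end Descent

/-! ### An Euler characteristic estimate -/

section Euler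

variable {V : Type} [Fintype V] [LinearOrder V] {L : AbstractSimplicialComplex V}

variable (L) in
/-- Cellular `ℓ²`-chains supported on the cubes whose type lies in `E`, in all dimensions. -/
def allChains (E : Set (Finset V)) : Submodule ℝ (ChainSpace L) where
  carrier := {f | (∀ σ ∉ E, f σ = 0) ∧ ∀ σ, ∀ s ∈ σ, ∀ g : RACG L, f σ (g * gen L s) = - f σ g}
  add_mem' := by
    rintro f g ⟨hf, hf'⟩ ⟨hg, hg'⟩
    refine ⟨fun σ h => by simp [hf σ h, hg σ h], fun σ s hs w => ?_⟩
    have h1 := hf' σ s hs w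
    have h2 := hg' σ s hs w
    simp only [PiLp.add_apply, lp.coeFn_add, Pi.add_apply, h1, h2]
    ring
  zero_mem' := ⟨fun σ _ => by simp, fun σ s _ w => by simp⟩
  smul_mem' := by
    rintro c f ⟨hf, hf'⟩
    refine ⟨fun σ h => by simp [hf σ h], fun σ s hs w => ?_⟩
    have h1 := hf' σ s hs w
    simp only [PiLp.smul_apply, lp.coeFn_smul, Pi.smul_apply, h1, smul_neg]

theorem mem_allChains {E : Set (Finset V)} {f : ChainSpace L} : f ∈ allChains L E ↔
    (∀ σ ∉ E, f σ = 0) ∧ ∀ σ, ∀ s ∈ σ, ∀ g : RACG L, f σ (g * gen L s) = - f σ g := Iff.rfl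

theorem isClosed_allChains (E : Set (Finset V)) : IsClosed (allChains L E : Set (ChainSpace L)) := by
  have h : (allChains L E : Set (ChainSpace L)) =
      (⋂ σ, ⋂ (_ : σ ∉ E), {f | EllTwoPow.coord σ f = 0}) ∩
        ⋂ σ, ⋂ s, ⋂ (_ : s ∈ σ), ⋂ g : RACG L,
          {f | evalChain L σ (g * gen L s) f = - evalChain L σ g f} := by
    ext f
    simp only [SetLike.mem_coe, mem_allChains, Set.mem_inter_iff, Set.mem_iInter,
      Set.mem_ofPred_eq, EllTwoPow.coord_apply, evalChain_apply]
  rw [h]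
  refine IsClosed.inter ?_ ?_
  · exact isClosed_iInter fun σ => isClosed_iInter fun _ =>
      isClosed_eq (EllTwoPow.coord σ).continuous continuous_const
  · exact isClosed_iInter fun σ => isClosed_iInter fun s => isClosed_iInter fun _ =>
      isClosed_iInter fun g => isClosed_eq (evalChain L σ _).continuous
        (evalChain L σ g).continuous.neg

theorem ellTwoChains_le_allChains {F : Set (Finset V)} {i j : ℕ} (h : i ≠ j) :
    ellTwoChains L F i ≤ allChains L {σ | σ ∈ F ∧ σ.card ≠ j} :=
  fun _ hf => ⟨fun σ hσ => hf.1 σ fun h' => hσ ⟨h'.1, h'.2 ▸ h⟩, hf.2⟩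

theorem isEquivariant_coboundaryOp (F : Set (Finset V)) : IsEquivariant (coboundaryOp L F) := by
  intro g f
  ext σ x
  rw [leftTranslation_apply]
  by_cases hσ : σ ∈ F
  · rw [coboundaryOp_apply_of_mem hσ, coboundaryOp_apply_of_mem hσ]
    simp only [leftTranslation_apply, mul_assoc]
  · rw [coboundaryOp_of_notMem hσ, coboundaryOp_of_notMem hσ]
    rfl

instance (F : Set (Finset V)) (i : ℕ) : CompleteSpace (ellTwoChains L F i) :=
  (isClosed_ellTwoChains F i).completeSpace_coe

instance (E : Set (Finset V)) : CompleteSpace (allChains L E) :=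
  (isClosed_allChains E).completeSpace_coe

theorem vonNeumannTrace_starProjection_orthogonal {G I : Type} [Group G] [Fintype I]
    (Z : Submodule ℝ (EllTwoPow G I)) [Z.HasOrthogonalProjection] :
    vonNeumannTrace Zᗮ.starProjection = Fintype.card I - vonNeumannTrace Z.starProjection := by
  rw [← vonNeumannTrace_one (G := G), ← vonNeumannTrace_sub, Submodule.starProjection_orthogonal]
  rfl

/-- Boundary plus coboundary maps the chains of degree m+1 into those of other degrees. The two
images lie in different degrees, so the kernel on these chains consists of harmonic cycles and is
zero. The rank theorem turns injectivity into an inequality of dimensions. -/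
theorem trace_chains_le_of_harmonicCycles_eq_bot {F : Set (Finset V)}
    (hcomm : ∀ σ ∈ F, ∀ s ∈ σ, ∀ t ∈ σ, Commute (gen L s) (gen L t)) {m : ℕ}
    (h : harmonicCycles L F (m + 1) = ⊥) :
    vonNeumannTrace (ellTwoChains L F (m + 1)).starProjection ≤
      vonNeumannTrace (allChains L {σ | σ ∈ F ∧ σ.card ≠ m + 1}).starProjection := by
  set C := ellTwoChains L F (m + 1) with hC
  set E := allChains L {σ | σ ∈ F ∧ σ.card ≠ m + 1} with hE
  set T : ChainSpace L →L[ℝ] ChainSpace L :=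
    (boundaryOp L F + coboundaryOp L F) ∘L C.starProjection with hT
  have hTe : IsEquivariant T := by
    refine IsEquivariant.comp (fun g x => ?_) (isStable_ellTwoChains F _).isEquivariant_starProjection
    simp [isEquivariant_boundaryOp F g x, isEquivariant_coboundaryOp F g x]
  have hTE : ∀ x, T x ∈ E := fun x => by
    have hx : C.starProjection x ∈ C := Submodule.starProjection_apply_mem _ _
    exact Submodule.add_mem _
      (ellTwoChains_le_allChains (by omega) (boundaryOp_mem_ellTwoChains hx))
      (ellTwoChains_le_allChains (by omega) (coboundaryOp_mem_ellTwoChains hcomm hx))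
  have h1 : T.ker ≤ Cᗮ := by
    intro x hx
    have hxC : C.starProjection x ∈ C := Submodule.starProjection_apply_mem _ _
    have h0 : boundaryOp L F (C.starProjection x) + coboundaryOp L F (C.starProjection x) = 0 := hx
    have hb := boundaryOp_mem_ellTwoChains hxC
    have hd := coboundaryOp_mem_ellTwoChains hcomm hxC
    have hb0 : boundaryOp L F (C.starProjection x) = 0 := by
      refine PiLp.ext fun σ => ?_
      by_cases hσ : σ.card = m
      · have h2 : boundaryOp L F (C.starProjection x) σ + coboundaryOp L F (C.starProjection x) σ = 0 :=
          congrArg (fun f : ChainSpace L => f σ) h0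
        rw [hd.1 σ (fun h => by omega), add_zero] at h2
        exact h2
      · exact hb.1 σ fun h => hσ h.2
    rw [hb0, zero_add] at h0
    have h3 : C.starProjection x ∈ harmonicCycles L F (m + 1) :=
      (mem_harmonicCycles_iff hcomm).2 ⟨hxC, hb0, h0⟩
    rw [h, Submodule.mem_bot] at h3
    have := Submodule.sub_starProjection_mem_orthogonal (K := C) x
    rwa [h3, sub_zero] at this
  have h2 : Eᗮ ≤ (ContinuousLinearMap.adjoint T).ker := by
    intro x hx
    refine ext_inner_right ℝ fun y => ?_
    show inner ℝ (ContinuousLinearMap.adjoint T x) y = _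
    rw [ContinuousLinearMap.adjoint_inner_left, inner_zero_left, real_inner_comm]
    exact (Submodule.mem_orthogonal _ _).1 hx _ (hTE y)
  have h3 := vonNeumannTrace_starProjection_mono h1
  have h4 := vonNeumannTrace_starProjection_mono h2
  rw [vonNeumannTrace_starProjection_orthogonal] at h3 h4
  have h5 := card_sub_trace_ker T hTe
  linarith

/-! ### Traces of chains -/

open Classical in
theorem unitVector_apply {G I : Type} [Group G] [Fintype I] (i j : I) (g : G) :
    unitVector G I i j g = if j = i ∧ g = 1 then 1 else 0 := by
  by_cases hj : j = i
  · subst hj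
    simp [unitVector, lp.single_apply, Pi.single_apply]
  · simp [unitVector, hj]

/-- The abelianization of a right-angled Coxeter group. -/
def racAbelianization (L : AbstractSimplicialComplex V) : RACG L →* Multiplicative (V → ZMod 2) :=
  racLift (fun s => Multiplicative.ofAdd (Pi.single s 1)) (fun s => by
    rw [← ofAdd_add, ← Pi.single_add, show (1 + 1 : ZMod 2) = 0 from rfl, Pi.single_zero, ofAdd_zero])
    (fun _ _ _ => mul_comm _ _)

theorem racAbelianization_gen (s : V) :
    racAbelianization L (gen L s) = Multiplicative.ofAdd (Pi.single s 1) := racLift_gen _ _ _ s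

theorem gen_ne_one (s : V) : gen L s ≠ 1 := fun h => by
  have h1 := racAbelianization_gen (L := L) s
  rw [h, map_one] at h1
  have h2 : (Pi.single s 1 : V → ZMod 2) = 0 := Multiplicative.ofAdd.injective h1.symm
  exact one_ne_zero (Pi.single_eq_zero_iff.1 h2)

/-- The abelianization sends distinct generators to distinct basis vectors. -/
theorem gen_injective : Function.Injective (gen L) := fun s t h => by
  have h1 := racAbelianization_gen (L := L) s
  rw [h, racAbelianization_gen] at h1
  have h2 : (Pi.single t 1 : V → ZMod 2) = Pi.single s 1 := Multiplicative.ofAdd.injective h1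
  by_contra hst
  have h3 := congrFun h2 s
  rw [Pi.single_eq_same, Pi.single_eq_of_ne hst] at h3
  exact zero_ne_one h3

theorem EllTwoPow.sum_sq_le {G I : Type} [Fintype I] (f : EllTwoPow G I) (i : I) (A : Finset G) :
    ∑ g ∈ A, f i g * f i g ≤ ‖f‖ ^ 2 := by
  have h1 : ‖f i‖ ^ 2 ≤ ‖f‖ ^ 2 := pow_le_pow_left₀ (norm_nonneg _) (PiLp.norm_apply_le f i) 2
  rw [EllTwo.norm_sq] at h1
  exact ((EllTwo.summable_mul (f i) (f i)).sum_le_tsum A fun g _ => mul_self_nonneg _).trans h1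

variable {E : Set (Finset V)}

theorem inner_starProjection_allChains_of_notMem {σ : Finset V} (hσ : σ ∉ E) :
    inner ℝ ((allChains L E).starProjection (unitVector _ _ σ)) (unitVector _ _ σ) = (0 : ℝ) := by
  rw [inner_unitVector, (Submodule.starProjection_apply_mem (allChains L E) _).1 σ hσ]
  rfl

theorem inner_starProjection_allChains_le_one (σ : Finset V) :
    inner ℝ ((allChains L E).starProjection (unitVector _ _ σ)) (unitVector _ _ σ) ≤ (1 : ℝ) := by
  set f := (allChains L E).starProjection (unitVector (RACG L) (Finset V) σ) with hf
  have h1 := inner_starProjection_self (allChains L E) (unitVector (RACG L) (Finset V) σ)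
  have h2 := EllTwoPow.sum_sq_le f σ {1}
  rw [Finset.sum_singleton] at h2
  rw [← hf, inner_unitVector] at h1
  rw [inner_unitVector]
  nlinarith

/-- Let a be the diagonal entry, which equals ‖pe‖². By antisymmetry pe has the values ±a at the
four distinct corners 1, s, t, st of the square, so 4a² ≤ a. -/
theorem inner_starProjection_allChains_pair_le {s t : V} (hst : s ≠ t) :
    inner ℝ ((allChains L E).starProjection (unitVector _ _ {s, t})) (unitVector _ _ {s, t}) ≤
      (1 / 4 : ℝ) := by
  classical
  set f := (allChains L E).starProjection (unitVector (RACG L) (Finset V) {s, t}) with hf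
  have h1 := inner_starProjection_self (allChains L E) (unitVector (RACG L) (Finset V) {s, t})
  have hfc : f ∈ allChains L E := Submodule.starProjection_apply_mem _ _
  have h2 := EllTwoPow.sum_sq_le f {s, t} {1, gen L s, gen L t, gen L s * gen L t}
  have hs := gen_ne_one (L := L) s
  have ht := gen_ne_one (L := L) t
  have hne : gen L s ≠ gen L t := gen_injective.ne hst
  have hst1 : gen L s * gen L t ≠ 1 := fun h => hne (by
    rw [← mul_left_inj (gen L t), h, gen_mul_self])
  rw [Finset.sum_insert (by simp [hs.symm, ht.symm, hst1.symm]),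
    Finset.sum_insert (by simp [hne, ht]), Finset.sum_insert (by simp [hs]),
    Finset.sum_singleton] at h2
  have e1 : f {s, t} (gen L s) = - f {s, t} 1 := by
    have := hfc.2 {s, t} s (by simp) 1
    rwa [one_mul] at this
  have e2 : f {s, t} (gen L t) = - f {s, t} 1 := by
    have := hfc.2 {s, t} t (by simp) 1
    rwa [one_mul] at this
  have e3 : f {s, t} (gen L s * gen L t) = f {s, t} 1 := by
    rw [hfc.2 {s, t} t (by simp), e1, neg_neg]
  rw [e1, e2, e3] at h2
  rw [← hf, inner_unitVector] at h1
  rw [inner_unitVector]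
  nlinarith

/-- Test against the chain u = e - ve, the antisymmetrized unit vector: ‖u‖² = 2 and the inner
product of pe with u is 1, so Cauchy-Schwarz gives ‖pe‖² ≥ 1/2. -/
theorem half_le_inner_starProjection_ellTwoChains {F : Set (Finset V)} {v : V} (hv : {v} ∈ F) :
    (1 / 2 : ℝ) ≤ inner ℝ ((ellTwoChains L F 1).starProjection (unitVector _ _ {v}))
      (unitVector _ _ {v}) := by
  classical
  set e := unitVector (RACG L) (Finset V) {v} with he
  set u := e - leftTranslation (Finset V) (gen L v) e with hu
  have hinv : (gen L v)⁻¹ = gen L v := inv_eq_of_mul_eq_one_left (gen_mul_self v)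
  have huv : ∀ σ g, u σ g = (if σ = {v} ∧ g = 1 then 1 else 0) -
      if σ = {v} ∧ gen L v * g = 1 then 1 else 0 := by
    intro σ g
    show e σ g - leftTranslation (Finset V) (gen L v) e σ g = _
    rw [leftTranslation_apply, unitVector_apply, unitVector_apply, hinv]
    congr!
  have huC : u ∈ ellTwoChains L F 1 := by
    refine ⟨fun σ hσ => ?_, fun σ s hs g => ?_⟩
    · ext g
      have : σ ≠ {v} := by
        rintro rfl
        exact hσ ⟨hv, rfl⟩
      rw [huv]
      simp [this]
    · rw [huv, huv]
      by_cases hσ : σ = {v}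
      · subst hσ
        obtain rfl := Finset.mem_singleton.1 hs
        have h1 : g * gen L s = 1 ↔ gen L s * g = 1 := mul_eq_one_comm
        have h2 : gen L s * (g * gen L s) = 1 ↔ g = 1 := by
          rw [mul_eq_one_iff_inv_eq, hinv]
          constructor
          · intro h
            exact (mul_left_injective (gen L s) (by simpa using h)).symm
          · rintro rfl
            simp
        simp only [h1, h2, true_and]
        ring
      · simp [hσ]
  have hu1 : inner ℝ u e = (1 : ℝ) := by
    rw [inner_unitVector, huv]
    simp [gen_ne_one]
  have hu2 : ‖u‖ ^ 2 = 2 := by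
    rw [← real_inner_self_eq_norm_sq]
    nth_rewrite 2 [hu]
    rw [inner_sub_right, hu1, inner_leftTranslation_unitVector, huv]
    simp [gen_ne_one, gen_mul_self]
    norm_num
  have h1 : inner ℝ ((ellTwoChains L F 1).starProjection e) u = (1 : ℝ) := by
    rw [Submodule.inner_starProjection_left_eq_right, Submodule.starProjection_eq_self_iff.2 huC,
      real_inner_comm, hu1]
  have h2 := real_inner_mul_inner_self_le ((ellTwoChains L F 1).starProjection e) u
  rw [h1, real_inner_self_eq_norm_sq, real_inner_self_eq_norm_sq, hu2] at h2
  rw [inner_starProjection_self]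
  linarith

end Euler

/-! ### Harmonic cycles of the pentagon -/

section PentagonCycle

/-- Otherwise the dimension of the 1-chains would be at most that of the remaining chains. But the
five vertices of the pentagon contribute at least 5/2, while the empty simplex and the five edges
contribute at most 1 + 5/4 = 9/4. -/
theorem exists_harmonicCycle_pentagon :
    ∃ z ∈ harmonicCycles pentagon (simplices pentagon.toPreAbstractSimplicialComplex) 1, z ≠ 0 := by
  by_contra! H
  have hbot := (Submodule.eq_bot_iff _).2 H
  have h1 := trace_chains_le_of_harmonicCycles_eq_bot (m := 0)
    (commute_gen_of_mem_simplices (L := pentagon) le_rfl) hbot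
  set F := simplices pentagon.toPreAbstractSimplicialComplex with hF
  have h2 : (5 / 2 : ℝ) ≤ vonNeumannTrace (ellTwoChains pentagon F (0 + 1)).starProjection := by
    have h3 : ∑ σ ∈ Finset.univ.map ⟨singleton, Finset.singleton_injective⟩,
        inner ℝ ((ellTwoChains pentagon F 1).starProjection
          (unitVector (RACG pentagon) (Finset (Fin 5)) σ)) (unitVector _ _ σ) ≤
        vonNeumannTrace (ellTwoChains pentagon F (0 + 1)).starProjection := by
      refine Finset.sum_le_sum_of_subset_of_nonneg (Finset.subset_univ _) fun σ _ _ => ?_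
      rw [inner_starProjection_self]
      positivity
    refine le_trans ?_ h3
    rw [Finset.sum_map]
    refine le_trans ?_ (Finset.card_nsmul_le_sum _ _ (1 / 2 : ℝ) fun v _ =>
      half_le_inner_starProjection_ellTwoChains (Or.inr (pentagon.singleton_mem v)))
    norm_num
  have h4 : vonNeumannTrace (allChains pentagon {σ | σ ∈ F ∧ σ.card ≠ 0 + 1}).starProjection ≤
      (9 / 4 : ℝ) := by
    set E : Set (Finset (Fin 5)) := {σ | σ ∈ F ∧ σ.card ≠ 0 + 1} with hE
    -- The edges. Only an upper bound for their number is needed, so their distinctness is never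
    -- checked.
    set A : Finset (Finset (Fin 5)) := Finset.univ.image fun i : Fin 5 => {i, i + 1} with hA
    have hsub : vonNeumannTrace (allChains pentagon E).starProjection = ∑ σ ∈ insert ∅ A,
        inner ℝ ((allChains pentagon E).starProjection
          (unitVector (RACG pentagon) (Finset (Fin 5)) σ)) (unitVector _ _ σ) := by
      refine (Finset.sum_subset (Finset.subset_univ _) fun σ _ hσ => ?_).symm
      refine inner_starProjection_allChains_of_notMem fun h => hσ ?_
      rcases pentagon_simplices_cases σ (mem_simplices_pentagon.1 h.1) with rfl | ⟨i, rfl⟩ | ⟨i, rfl⟩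
      · exact Finset.mem_insert_self _ _
      · exact absurd (Finset.card_singleton i) h.2
      · exact Finset.mem_insert_of_mem (Finset.mem_image_of_mem _ (Finset.mem_univ i))
    have hempty : ∅ ∉ A := by
      rw [hA, Finset.mem_image]
      rintro ⟨i, _, hi⟩
      exact Finset.insert_ne_empty _ _ hi
    have hne : ∀ i : Fin 5, i ≠ i + 1 := by decide
    have h5 : ∑ σ ∈ A, inner ℝ ((allChains pentagon E).starProjection
          (unitVector (RACG pentagon) (Finset (Fin 5)) σ)) (unitVector _ _ σ) ≤ A.card • (1 / 4 : ℝ) := by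
      refine Finset.sum_le_card_nsmul _ _ _ fun σ hσ => ?_
      obtain ⟨i, _, rfl⟩ := Finset.mem_image.1 hσ
      exact inner_starProjection_allChains_pair_le (hne i)
    have h6 : (A.card : ℝ) ≤ 5 := by
      exact_mod_cast (Finset.card_image_le.trans_eq (Finset.card_fin 5))
    rw [hsub, Finset.sum_insert hempty]
    have h7 := inner_starProjection_allChains_le_one (L := pentagon) (E := E) ∅
    rw [nsmul_eq_mul] at h5
    linarith
  linarith

end PentagonCycle

/-! ### The theorem -/

/-- The intrinsic statement gives the top case, and each join with the pentagon descends by one. -/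
theorem ambientIII_of_statementIII {k : ℕ} (hIII : StatementIII (2 * k + 1)) :
    ∀ m ≤ k, AmbientIII m := by
  obtain ⟨z, hz, hz0⟩ := exists_harmonicCycle_pentagon
  have key : ∀ j ≤ k, AmbientIII (k - j) := by
    intro j
    induction j with
    | zero => exact fun _ => ambientIII_of_harmonicIII (harmonicIII_of_statementIII hIII)
    | succ j ih =>
      intro hj
      have h1 := ih (by omega)
      rw [show k - j = k - (j + 1) + 1 by omega] at h1
      exact ambientIII_of_harmonicIII (harmonicIII_of_ambientIII_succ h1 hz hz0)
  intro m hm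
  have := key (k - m) (by omega)
  rwa [Nat.sub_sub_self hm] at this

end

theorem theorem9p3p1 (k : ℕ) (hk : 1 ≤ k) (hIII : StatementIII (2 * k - 1)) :
    ∀ n : ℕ, n ≤ 2 * k → StatementV n := by
  obtain ⟨k, rfl⟩ := Nat.exists_eq_add_of_le' hk
  exact fun n hn => statementV_of_ambientV (ambientV_of_forall_ambientIII
    (fun m hm => ambientIII_of_statementIII hIII m (Nat.lt_succ_iff.1 hm)) n hn)
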